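/- Let $\mathbb S^1=\mathbb R/2\pi\mathbb Z$, let $\mathbb S^k$ be the unit sphere of $\mathbb R^{k+1}$, $T\mathbb S^k=\{(y,z)\in\mathbb R^{k+1}\times\mathbb R^{k+1}:|y|=1,\ y\cdot z=0\}$, $\Box=-\partial_{tt}+\partial_{xx}$, and $f^{\phi^\perp}=f-\langle f,\phi\rangle\phi$. Let $\bar T>0$, $M>0$ and $D=[-\bar T,\bar T]\times\mathbb S^1$. A solution on $D$ of $\Box\phi=(|\phi_t|^2-|\phi_x|^2)\phi+F$ means a function $\phi$ with weak derivatives $\phi_x,\phi_t$ such that $(\phi,\phi_t)\in C([-\bar T,\bar T];H^1\times L^2(\mathbb S^1;T\mathbb S^k))$ and, for every $\tau\in(-\bar T,\bar T]$ and every $\psi\in C^1([-\bar T,\tau]\times\mathbb S^1;\mathbb R^{k+1})$, $$\int_{-\bar T}^{\tau}\!\int_{\mathbb S^1}\big(\phi_x\cdot\psi_x-\phi_t\cdot\psi_t+(|\phi_t|^2-|\phi_x|^2)\phi\cdot\psi+F\cdot\psi\big)\,dx\,dt=\int_{\mathbb S^1}\phi_t\cdot\psi(-\bar T,x)\,dx-\int_{\mathbb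 S^1}\phi_t\cdot\psi(\tau,x)\,dx .$$ We write $\phi[0]=(\phi,\phi_t)(0,\cdot)$. Use the null coordinates $u=x+t$, $v=t-x$, so $\partial_u=\tfrac12(\partial_t+\partial_x)$, $\partial_v=\tfrac12(\partial_t-\partial_x)$; mixed norms such as $L^2_uL^\infty_v(D)$ are computed by representing $\mathbb S^1$ by $(0,2\pi]$ and extending functions by zero outside $D$ in the $(u,v)$-plane. Set $$\|w\|_{\mathcal W(D)}=\|(w_x,w_t,w)\|_{L^\infty_tL^2_x(D)}+\|w_u\|_{L^2_uL^\infty_v\cap L^\infty_vL^2_u(D)}+\|w_v\|_{L^2_vL^\infty_u\cap L^\infty_uL^2_v(D)} .$$ (i) There is a constant $C=C(\bar T,M)$ such that, for every $k$, all initial states $\phi[0],\varphi[0]:\mathbb S^1\to T\mathbb S^k$ in $H^1\times L^2$ and all source terms $f,g\in L^2_{t,x}(D;\mathbb R^{k+1})$ with $$\|\phi[0]\|_{\dot H^1\times L^2}+\|\varphi[0]\|_{\dot H^1\times L^2}+\|f\|_{L^2_{t,x}(D)}+\|g\|_{L^2_{t,x}(D)}\le M,$$ any solutions $\phi,\varphi$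 on $D$ of $$\Box\phi=(|\phi_t|^2-|\phi_x|^2)\phi+f^{\phi^\perp},\qquad \Box\varphi=(|\varphi_t|^2-|\varphi_x|^2)\varphi+g^{\varphi^\perp}$$ with these states at time $0$ satisfy, with $w=\phi-\varphi$, $$\|w\|_{\mathcal W(D)}\le C\big(\|w[0]\|_{H^1\times L^2}+\|f-g\|_{L^2_{t,x}(D)}\big).$$ (ii) Let $a\ge 0$ be a fixed continuous function on $\mathbb S^1$. There is a constant $C=C(\bar T,M)$ (for this $a$) such that, for every $k$ and all initial states $\phi[0],\varphi[0]:\mathbb S^1\to T\mathbb S^k$ in $H^1\times L^2$ with $\|\phi[0]\|_{\dot H^1\times L^2}+\|\varphi[0]\|_{\dot H^1\times L^2}\le M$, any solutions $\phi,\varphi$ on $D$ of $$\Box\phi=(|\phi_t|^2-|\phi_x|^2)\phi+a(x)\phi_t,\qquad \Box\varphi=(|\varphi_t|^2-|\varphi_x|^2)\varphi+a(x)\varphi_t$$ with these states at time $0$ satisfy, with $w=\phi-\varphi$, $$\|w\|_{\mathcal W(D)}\le C\,\|w[0]\|_{H^1\times L^2}.$$ -/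

import Mathlib

open MeasureTheory Set Filter Topology
open scoped ENNReal ContDiff RealInnerProductSpace

noncomputable section

namespace WaveMapS1

/-- The ambient Euclidean space `ℝ^{k+1}` of the sphere `𝕊^k`. -/
abbrev Amb (k : ℕ) : Type := EuclideanSpace ℝ (Fin (k + 1))

/-- The period of the circle `𝕊¹ = ℝ / 2πℤ`. Functions on `𝕊¹` are `2π`-periodic functions
on `ℝ`. -/
def period : ℝ := 2 * Real.pi

/-- Lebesgue measure on `𝕊¹`, on the fundamental domain `(0, 2π]`. -/
def circ : Measure ℝ := volume.restrict (Ioc 0 period)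

/-- Lebesgue measure on the space-time cylinder `[T₁, T₂] × 𝕊¹`. -/
def cyl (T₁ T₂ : ℝ) : Measure (ℝ × ℝ) := (volume.restrict (Icc T₁ T₂)).prod circ

/-- `(y, z)` belongs to the tangent bundle `T𝕊^k ⊆ ℝ^{k+1} × ℝ^{k+1}`. -/
def InTangentBundle {k : ℕ} (y z : Amb k) : Prop := ‖y‖ = 1 ∧ ⟪y, z⟫ = 0

/-- The projection `f - ⟨f, y⟩ y`. -/
def perp {k : ℕ} (f y : Amb k) : Amb k := f - ⟪f, y⟫ • y

/-- `g'` is the weak derivative of `g` on `𝕊¹`. -/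
def HasWeakDeriv {k : ℕ} (g g' : ℝ → Amb k) : Prop :=
  ∀ η : ℝ → ℝ, ContDiff ℝ ∞ η → Function.Periodic η period →
    ∫ x, deriv η x • g x ∂circ = - ∫ x, η x • g' x ∂circ

/-- `ht` is the weak (distributional) time derivative of `h` on `(T₁, T₂) × 𝕊¹`. -/
def HasWeakTimeDeriv {k : ℕ} (T₁ T₂ : ℝ) (h ht : ℝ → ℝ → Amb k) : Prop :=
  ∀ η : ℝ → ℝ → ℝ, ContDiff ℝ ∞ (Function.uncurry η) →
    (∀ t, Function.Periodic (η t) period) →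
    (∃ a b, T₁ < a ∧ b < T₂ ∧ ∀ t, t ∉ Icc a b → ∀ x, η t x = 0) →
    ∫ p, deriv (fun s => η s p.2) p.1 • h p.1 p.2 ∂(cyl T₁ T₂)
      = - ∫ p, η p.1 p.2 • ht p.1 p.2 ∂(cyl T₁ T₂)

/-- An element `(g₀, g₁)` of `H¹ × L²(𝕊¹; T𝕊^k)`, recorded together with the weak derivative
`posx` of `g₀ = pos`. -/
structure EnergyState (k : ℕ) where
  pos : ℝ → Amb k
  posx : ℝ → Amb k
  vel : ℝ → Amb k
  pos_periodic : Function.Periodic pos period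
  posx_periodic : Function.Periodic posx period
  vel_periodic : Function.Periodic vel period
  pos_memLp : MemLp pos 2 circ
  posx_memLp : MemLp posx 2 circ
  vel_memLp : MemLp vel 2 circ
  weakDeriv : HasWeakDeriv pos posx
  tangent : ∀ᵐ x ∂circ, InTangentBundle (pos x) (vel x)

/-- `h` is (a jointly measurable representative of) an element of `C([T₁, T₂]; L²(𝕊¹))`. -/
structure IsContL2 {k : ℕ} (T₁ T₂ : ℝ) (h : ℝ → ℝ → Amb k) : Prop where
  aestronglyMeasurable : AEStronglyMeasurable (Function.uncurry h) (cyl T₁ T₂)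
  periodic : ∀ t ∈ Icc T₁ T₂, Function.Periodic (h t) period
  memLp : ∀ t ∈ Icc T₁ T₂, MemLp (h t) 2 circ
  continuous : ∀ t ∈ Icc T₁ T₂,
    Tendsto (fun s => eLpNorm (fun x => h s x - h t x) 2 circ) (𝓝[Icc T₁ T₂] t) (𝓝 0)

/-- `(φ, φ_t) ∈ C([T₁, T₂]; H¹ × L²(𝕊¹; T𝕊^k))`, where `φx` and `φt` are the weak
derivatives of `φ`. -/
structure IsEnergyPath {k : ℕ} (T₁ T₂ : ℝ) (φ φx φt : ℝ → ℝ → Amb k) : Prop where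
  cont : IsContL2 T₁ T₂ φ
  cont_x : IsContL2 T₁ T₂ φx
  cont_t : IsContL2 T₁ T₂ φt
  weakDeriv_x : ∀ t ∈ Icc T₁ T₂, HasWeakDeriv (φ t) (φx t)
  weakDeriv_t : HasWeakTimeDeriv T₁ T₂ φ φt
  tangent : ∀ t ∈ Icc T₁ T₂, ∀ᵐ x ∂circ, InTangentBundle (φ t x) (φt t x)

/-- `φ` is a (weak) solution on `[T₁, T₂] × 𝕊¹`, in the energy class, of
`-φ_tt + φ_xx = (|φ_t|² - |φ_x|²) φ + F`. -/
structure IsSolution {k : ℕ} (T₁ T₂ : ℝ) (F φ φx φt : ℝ → ℝ → Amb k) : Prop where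
  path : IsEnergyPath T₁ T₂ φ φx φt
  equation : ∀ τ ∈ Ioc T₁ T₂, ∀ ψ : ℝ → ℝ → Amb k, ContDiff ℝ 1 (Function.uncurry ψ) →
    (∀ t, Function.Periodic (ψ t) period) →
    ∫ p, (⟪φx p.1 p.2, deriv (ψ p.1) p.2⟫
          - ⟪φt p.1 p.2, deriv (fun s => ψ s p.2) p.1⟫
          + (‖φt p.1 p.2‖ ^ 2 - ‖φx p.1 p.2‖ ^ 2) * ⟪φ p.1 p.2, ψ p.1 p.2⟫
          + ⟪F p.1 p.2, ψ p.1 p.2⟫) ∂(cyl T₁ τ)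
      = ∫ x, ⟪φt T₁ x, ψ T₁ x⟫ ∂circ - ∫ x, ⟪φt τ x, ψ τ x⟫ ∂circ

/-- `(φ, φ_t)(0) = g`. -/
def HasInitialState {k : ℕ} (φ φt : ℝ → ℝ → Amb k) (g : EnergyState k) : Prop :=
  φ 0 =ᵐ[circ] g.pos ∧ φt 0 =ᵐ[circ] g.vel

/-- `φ` solves the inhomogeneous wave maps equation
`□φ = (|φ_t|² - |φ_x|²) φ + f^{φ^⊥}` on `[-T, T] × 𝕊¹`, with state `g` at time `0`. -/
def SolvesInhomogeneous {k : ℕ} (T : ℝ) (f : ℝ → ℝ → Amb k) (g : EnergyState k)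
    (φ φx φt : ℝ → ℝ → Amb k) : Prop :=
  IsSolution (-T) T (fun t x => perp (f t x) (φ t x)) φ φx φt ∧ HasInitialState φ φt g

/-- `φ` solves the damped wave maps equation
`□φ = (|φ_t|² - |φ_x|²) φ + a(x) φ_t` on `[-T, T] × 𝕊¹`, with state `g` at time `0`. -/
def SolvesDamped {k : ℕ} (T : ℝ) (a : ℝ → ℝ) (g : EnergyState k)
    (φ φx φt : ℝ → ℝ → Amb k) : Prop :=
  IsSolution (-T) T (fun t x => a x • φt t x) φ φx φt ∧ HasInitialState φ φt g

/-- `f` is an `L²_{t,x}` source term on `[-T, T] × 𝕊¹`. -/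
def IsSource {k : ℕ} (T : ℝ) (f : ℝ → ℝ → Amb k) : Prop :=
  (∀ t ∈ Icc (-T) T, Function.Periodic (f t) period) ∧
    MemLp (Function.uncurry f) 2 (cyl (-T) T)

/-- The `L²_{t,x}([-T, T] × 𝕊¹)` norm. -/
def normL2 {k : ℕ} (T : ℝ) (f : ℝ → ℝ → Amb k) : ℝ≥0∞ :=
  eLpNorm (Function.uncurry f) 2 (cyl (-T) T)

/-- The norm of a pair in `Ḣ¹ × L²`, the first component being given by its derivative. -/
def normDotH1L2 {k : ℕ} (gx h : ℝ → Amb k) : ℝ≥0∞ :=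
  (eLpNorm gx 2 circ ^ 2 + eLpNorm h 2 circ ^ 2) ^ (1 / 2 : ℝ)

/-- The norm of a pair `(g, h)` in `H¹ × L²`, where `gx` is the derivative of `g`. -/
def normH1L2 {k : ℕ} (g gx h : ℝ → Amb k) : ℝ≥0∞ :=
  (eLpNorm g 2 circ ^ 2 + eLpNorm gx 2 circ ^ 2 + eLpNorm h 2 circ ^ 2) ^ (1 / 2 : ℝ)

/-- A function on `D = [-T, T] × 𝕊¹` in the null coordinates `u = x + t`, `v = t - x`
(so `t = (u + v) / 2`, `x = (u - v) / 2`), where `𝕊¹` is represented by `(0, 2π]`,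
and extended by zero outside `D`. -/
def nullExt {k : ℕ} (T : ℝ) (h : ℝ → ℝ → Amb k) (u v : ℝ) : Amb k :=
  open scoped Classical in
  if (u + v) / 2 ∈ Icc (-T) T ∧ (u - v) / 2 ∈ Ioc 0 period then
    h ((u + v) / 2) ((u - v) / 2) else 0

/-- The mixed norm `L²_α L^∞_β` of `K(α, β)`. -/
def normL2Linf {k : ℕ} (K : ℝ → ℝ → Amb k) : ℝ≥0∞ :=
  (∫⁻ α, eLpNorm (fun β => K α β) ∞ volume ^ 2) ^ (1 / 2 : ℝ)

/-- The mixed norm `L^∞_β L²_α` of `K(α, β)`. -/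
def normLinfL2 {k : ℕ} (K : ℝ → ℝ → Amb k) : ℝ≥0∞ :=
  essSup (fun β => eLpNorm (fun α => K α β) 2 volume) volume

/-- The norm of `h` in `L²_u L^∞_v ∩ L^∞_v L²_u (D)`. -/
def normU {k : ℕ} (T : ℝ) (h : ℝ → ℝ → Amb k) : ℝ≥0∞ :=
  normL2Linf (fun u v => nullExt T h u v) + normLinfL2 (fun u v => nullExt T h u v)

/-- The norm of `h` in `L²_v L^∞_u ∩ L^∞_u L²_v (D)`. -/
def normV {k : ℕ} (T : ℝ) (h : ℝ → ℝ → Amb k) : ℝ≥0∞ :=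
  normL2Linf (fun v u => nullExt T h u v) + normLinfL2 (fun v u => nullExt T h u v)

/-- The norm
`‖(w_x, w_t, w)‖_{L^∞_t L²_x(D)} + ‖w_u‖_{L²_u L^∞_v ∩ L^∞_v L²_u(D)}`
`  + ‖w_v‖_{L²_v L^∞_u ∩ L^∞_u L²_v(D)}`
on `D = [-T, T] × 𝕊¹`, where `w_u = (w_t + w_x) / 2` and `w_v = (w_t - w_x) / 2`.
The time supremum is taken over all times, as `w` is a continuous curve in `H¹ × L²`. -/
def normW {k : ℕ} (T : ℝ) (w wx wt : ℝ → ℝ → Amb k) : ℝ≥0∞ :=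
  (⨆ t ∈ Icc (-T) T, normH1L2 (w t) (wx t) (wt t))
    + normU T (fun t x => (1 / 2 : ℝ) • (wt t x + wx t x))
    + normV T (fun t x => (1 / 2 : ℝ) • (wt t x - wx t x))

end WaveMapS1

end

open scoped NNReal

/-! ### Periodic integrals on the circle and its covering line -/

namespace WaveMapS1

/-! In null coordinates the wave maps equation is a transport equation: for `c = ±1` the null
derivative `φ_t + c φ_x` changes along `x + c t = y` only through the right-hand side, and `|φ_t|² -
|φ_x|² = ⟨φ_t + c φ_x, φ_t - c φ_x⟩` pairs one null derivative of each family. The weak equation is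
brought to this form by testing with travelling functions `η (x + c t)` (`IsSolution.nullDer_eq`).

The nonlinear term is normal to the sphere and the null derivatives are tangent to it, so along a
characteristic `|φ_t + c φ_x|²` grows only through the source (`IsSolution.enorm_nullDer_sq_le`).
Summing over both families and applying Grönwall bounds the energy; the same inequality then gives a
majorant `|φ_t + c φ_x|² ≤ A (x + c t)` with `∫ A` bounded in terms of `T`, `M` and the damping
(`IsControlled.exists_majorant`). A product of functions of the two opposite null coordinates is
integrable over the cylinder, with integral controlled by the product of their integrals over the
circle (`lintegral_mul_null_le`). Hence the nonlinearity, a priori only in `L¹`, lies in `L²_{t,x}`.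

For the difference `w` of two solutions the difference `N - N'` of the right-hand sides telescopes
into products with exactly one factor from `w`, plus the difference of the sources
(`enorm_nonlin_sub_le`). Let `Y` be the integral of `e^{-κ|t|} |N - N'|²`. A weighted Cauchy-Schwarz
inequality in time (`weight_mul_lintegral_sq_le`) bounds `e^{-κ|t|} |w_t + c w_x|²` by a function of
`x + c t` whose integral is at most a multiple of the initial energy of `w` plus `Y / κ`, and
Sobolev's inequality controls `w` itself. The bilinear estimate returns `Y ≤ C (data + Y / κ)` with
`C` independent of `κ` (`diffNorm_le`). As `Y` is finite, a large `κ` absorbs the last term; the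
weight plays the role of a subdivision into short time intervals. Removing it costs a factor
`e^{κT}`.

A majorant depending on one null variable controls both mixed norms at once (`add_mixedNorms_le`),
and the energy norm as well. The two equations enter only through the bounds on the sources
collected in `IsControlledPair`. -/

theorem period_pos : 0 < period := by unfold period; positivity

instance : IsFiniteMeasure circ := by unfold circ; infer_instance

theorem circ_univ : circ univ = ENNReal.ofReal period := by
  simp [circ]

instance vaddInvariant_zmultiples (p : ℝ) :
    VAddInvariantMeasure (AddSubgroup.zmultiples p) ℝ volume :=
  ⟨fun _ _ _ => measure_preimage_add _ _ _⟩

/-- Both intervals are fundamental domains for translation by the period, so no measurability of `g`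
is required. -/
theorem lintegral_Ioc_periodic {g : ℝ → ℝ≥0∞} (hg : Function.Periodic g period) (c : ℝ) :
    ∫⁻ x in Ioc c (c + period), g x = ∫⁻ x, g x ∂circ := by
  have h0 : circ = volume.restrict (Ioc 0 (0 + period)) := by simp [circ]
  rw [h0]
  apply IsAddFundamentalDomain.setLIntegral_eq (G := AddSubgroup.zmultiples period)
  exacts [isAddFundamentalDomain_Ioc period_pos c, isAddFundamentalDomain_Ioc period_pos 0,
    hg.map_vadd_zmultiples]

theorem lintegral_circ_add {g : ℝ → ℝ≥0∞} (hg : Function.Periodic g period) (c : ℝ) :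
    ∫⁻ x, g (x + c) ∂circ = ∫⁻ x, g x ∂circ := by
  rw [← lintegral_Ioc_periodic hg c]
  have := (measurePreserving_add_right volume c).setLIntegral_comp_preimage_emb
    (measurableEmbedding_addRight c) g (Ioc c (c + period))
  rw [← this]
  have h2 : (fun x => x + c) ⁻¹' Ioc c (c + period) = Ioc 0 period := by
    ext x
    simp [add_comm c period]
  rw [h2, circ]

theorem lintegral_circ_sub {g : ℝ → ℝ≥0∞} (hg : Function.Periodic g period) (c : ℝ) :
    ∫⁻ x, g (x - c) ∂circ = ∫⁻ x, g x ∂circ := by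
  simpa [sub_eq_add_neg] using lintegral_circ_add hg (-c)

theorem integral_circ_add {E : Type*} [NormedAddCommGroup E] [NormedSpace ℝ E] {g : ℝ → E}
    (hg : Function.Periodic g period) (c : ℝ) :
    ∫ x, g (x + c) ∂circ = ∫ x, g x ∂circ := by
  have h1 : ∀ h : ℝ → E, ∫ x, h x ∂circ = ∫ x in (0)..period, h x := fun h => by
    rw [intervalIntegral.integral_of_le period_pos.le, circ]
  rw [h1, h1, intervalIntegral.integral_comp_add_right]
  have := hg.intervalIntegral_add_eq c 0
  simpa [add_comm] using this

/-- The exceptional set is invariant under the period lattice, hence null on `ℝ` once it is null on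
one fundamental domain. Statements about characteristics are moved to `ℝ` in this way, where they
can be translated freely. -/
theorem ae_of_ae_circ {P : ℝ → Prop} (hP : ∀ x, P (x + period) ↔ P x)
    (h : ∀ᵐ x ∂circ, P x) : ∀ᵐ x, P x := by
  have h0 : circ = volume.restrict (Ioc 0 (0 + period)) := by simp [circ]
  rw [h0] at h
  have hper : Function.Periodic (fun x => P x) period := fun x => propext (hP x)
  refine (isAddFundamentalDomain_Ioc period_pos 0).measure_zero_of_invariant _ ?_ ?_
  · intro g
    ext x
    rw [mem_vadd_set_iff_neg_vadd_mem]
    have : (-g +ᵥ x ∈ ({x | P x}ᶜ : Set ℝ)) = (x ∈ ({x | P x}ᶜ : Set ℝ)) := by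
      simp only [mem_compl_iff, mem_ofPred_eq]
      rw [show P (-g +ᵥ x) = P x from hper.map_vadd_zmultiples (-g) x]
    exact this.to_iff
  · rw [ae_iff, Measure.restrict_apply₀'] at h
    · exact h
    · exact measurableSet_Ioc.nullMeasurableSet

theorem ae_circ_of_ae {P : ℝ → Prop} (h : ∀ᵐ x, P x) : ∀ᵐ x ∂circ, P x :=
  ae_restrict_of_ae h

theorem ae_add {P : ℝ → Prop} (h : ∀ᵐ x, P x) (c : ℝ) : ∀ᵐ x, P (x + c) :=
  (measurePreserving_add_right volume c).quasiMeasurePreserving.ae h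

theorem lintegral_Ioc_nat_mul_period {g : ℝ → ℝ≥0∞} (hg : Function.Periodic g period) (z : ℝ)
    (n : ℕ) : ∫⁻ x in Ioc z (z + n * period), g x = n * ∫⁻ x, g x ∂circ := by
  induction n with
  | zero => simp
  | succ n ih =>
    have hp := period_pos
    have h1 : z ≤ z + n * period := by
      have : 0 ≤ n * period := by positivity
      linarith
    have : Ioc z (z + (n + 1 : ℕ) * period) = Ioc z (z + n * period) ∪
        Ioc (z + n * period) (z + n * period + period) := by
      rw [Ioc_union_Ioc_eq_Ioc h1 (by linarith)]
      push_cast; ring_nf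
    rw [this, lintegral_union measurableSet_Ioc, ih, lintegral_Ioc_periodic hg]
    · push_cast; ring
    · rw [Set.disjoint_left]
      intro x hx hx'
      exact absurd hx.2 (not_le.2 hx'.1)

/-- The number of periods needed to cover an interval of length `L`. -/
noncomputable def covering (L : ℝ) : ℕ := ⌈L / period⌉₊

theorem lintegral_Ioc_le_covering {g : ℝ → ℝ≥0∞} (hg : Function.Periodic g period) {a b L : ℝ}
    (h : b ≤ a + L) : ∫⁻ x in Ioc a b, g x ≤ covering L * ∫⁻ x, g x ∂circ := by
  rw [← lintegral_Ioc_nat_mul_period hg a]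
  apply lintegral_mono_set
  apply Ioc_subset_Ioc_right
  have h2 := Nat.le_ceil (L / period)
  rw [div_le_iff₀ period_pos] at h2
  unfold covering
  linarith

/-- Opposite characteristics separate at speed 2, whence `c = ±2`. Then `c * r` sweeps an interval
of length `4 * T`; the Jacobian 1/2 is merely bounded by 1. -/
theorem lintegral_comp_add_mul_le (g : ℝ → ℝ≥0∞) (hg : Function.Periodic g period)
    {T : ℝ} {c : ℝ} (hc : c = 2 ∨ c = -2) (y : ℝ) :
    ∫⁻ r in Icc (-T) T, g (y + c * r) ≤ covering (4 * T) * ∫⁻ x, g x ∂circ := by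
  have hc0 : c ≠ 0 := by rcases hc with rfl | rfl <;> norm_num
  have key : ∀ h : ℝ → ℝ≥0∞, ∫⁻ r, h (c * r) ≤ ∫⁻ r, h r := by
    intro h
    have e : ∫⁻ r, h (c * r) = ∫⁻ r, h r ∂(Measure.map (c * ·) volume) :=
      ((Homeomorph.mulLeft₀ c hc0).measurableEmbedding.lintegral_map h).symm
    rw [e, Real.map_volume_mul_left hc0, lintegral_smul_measure]
    calc _ ≤ 1 * ∫⁻ r, h r := by
          refine mul_le_mul_left ?_ _
          simp only [ENNReal.ofReal_le_one]
          rcases hc with rfl | rfl <;> norm_num [abs_of_pos]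
      _ = _ := one_mul _
  calc ∫⁻ r in Icc (-T) T, g (y + c * r)
      = ∫⁻ r, (Icc (-T) T).indicator (fun r => g (y + c * r)) r := by
        rw [lintegral_indicator measurableSet_Icc]
    _ ≤ ∫⁻ r, (Icc (-(2 * T)) (2 * T)).indicator (fun r => g (y + r)) (c * r) := by
        apply lintegral_mono
        intro r
        by_cases hr : r ∈ Icc (-T) T
        · have : c * r ∈ Icc (-(2 * T)) (2 * T) := by
            rcases hc with rfl | rfl <;> constructor <;> linarith [hr.1, hr.2]
          simp [hr, this]
        · simp [hr]
    _ ≤ ∫⁻ r, (Icc (-(2 * T)) (2 * T)).indicator (fun r => g (y + r)) r := key _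
    _ = ∫⁻ r in Ioc (-(2 * T)) (2 * T), g (y + r) := by
        rw [lintegral_indicator measurableSet_Icc, restrict_Ioc_eq_restrict_Icc]
    _ ≤ covering (4 * T) * ∫⁻ x, g (y + x) ∂circ :=
        lintegral_Ioc_le_covering (fun x => by rw [← add_assoc, hg]) (by linarith)
    _ = covering (4 * T) * ∫⁻ x, g x ∂circ := by
        simp_rw [add_comm y]
        rw [lintegral_circ_add hg]

end WaveMapS1

/-! ### Weak derivatives on an interval -/

namespace WaveMapS1

theorem contDiff_primitive {ζ : ℝ → ℝ} (hζ : ContDiff ℝ ∞ ζ) (a : ℝ) :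
    ContDiff ℝ ∞ (fun x => ∫ y in a..x, ζ y) ∧ deriv (fun x => ∫ y in a..x, ζ y) = ζ := by
  have hd : ∀ x, HasDerivAt (fun x => ∫ y in a..x, ζ y) (ζ x) x := fun x =>
    intervalIntegral.integral_hasDerivAt_right (hζ.continuous.intervalIntegrable _ _)
      (hζ.continuous.stronglyMeasurableAtFilter _ _) hζ.continuous.continuousAt
  have hd' : deriv (fun x => ∫ y in a..x, ζ y) = ζ := funext fun x => (hd x).deriv
  refine ⟨?_, hd'⟩
  rw [contDiff_infty_iff_deriv, hd']
  exact ⟨fun x => (hd x).differentiableAt, hζ⟩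

/-- Integration by parts of a smooth function against a primitive of an integrable function. -/
theorem integral_deriv_mul_primitive {a b : ℝ} {θ n : ℝ → ℝ} (hθ : ContDiff ℝ ∞ θ)
    (hn : IntervalIntegrable n volume a b) :
    ∫ x in a..b, deriv θ x * ∫ y in a..x, n y
      = θ b * (∫ y in a..b, n y) - ∫ x in a..b, θ x * n x := by
  have h1 : AbsolutelyContinuousOnInterval θ a b :=
    (hθ.contDiffOn.of_le (by simp)).absolutelyContinuousOnInterval
  have h2 := hn.absolutelyContinuousOnInterval_intervalIntegral (c := a) (by simp)
  have h3 := h1.integral_mul_deriv_eq_deriv_mul h2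
  have h4 : ∫ x in a..b, θ x * deriv (fun x => ∫ y in a..x, n y) x = ∫ x in a..b, θ x * n x := by
    apply intervalIntegral.integral_congr_ae
    filter_upwards [hn.ae_hasDerivAt_integral] with x hx hx'
    rw [(hx (uIoc_subset_uIcc hx') a (by simp)).deriv]
  rw [h4] at h3
  simp at h3
  linarith

theorem exists_Icc_of_tsupport_subset {a b : ℝ} {χ : ℝ → ℝ} (hab : a < b)
    (hχ : HasCompactSupport χ) (h : tsupport χ ⊆ Ioo a b) :
    ∃ a' b', a < a' ∧ a' < b' ∧ b' < b ∧ ∀ x, x ∉ Icc a' b' → χ x = 0 := by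
  -- The midpoint is adjoined so that the compact set is nonempty even when `χ` vanishes
  -- identically.
  let c := (a + b) / 2
  have hc : c ∈ Ioo a b := ⟨by simp only [c]; linarith, by simp only [c]; linarith⟩
  have hK : IsCompact (tsupport χ ∪ {c}) := hχ.isCompact.union isCompact_singleton
  have hne : (tsupport χ ∪ {c}).Nonempty := ⟨c, Or.inr rfl⟩
  have hsub : tsupport χ ∪ {c} ⊆ Ioo a b := union_subset h (by simpa using hc)
  obtain ⟨x0, hx0, hx0'⟩ := hK.exists_isLeast hne
  obtain ⟨x1, hx1, hx1'⟩ := hK.exists_isGreatest hne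
  have h0 := hsub hx0
  have h1 := hsub hx1
  have h2 : x0 ≤ x1 := hx0' hx1
  refine ⟨(a + x0) / 2, (x1 + b) / 2, by linarith [h0.1], by linarith [h0.1, h1.2],
    by linarith [h1.2], fun x hx => ?_⟩
  by_contra hne
  have hx' : x ∈ tsupport χ ∪ {c} := Or.inl (subset_tsupport _ hne)
  have := hx0' hx'
  have := hx1' hx'
  exact hx ⟨by linarith [h0.1], by linarith [h1.2]⟩

theorem ae_eq_zero_of_integral_smooth {a b : ℝ} (hab : a < b) {D : ℝ → ℝ}
    (hD : IntervalIntegrable D volume a b)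
    (h : ∀ χ : ℝ → ℝ, ContDiff ℝ ∞ χ →
      (∃ a' b', a < a' ∧ a' < b' ∧ b' < b ∧ ∀ x, x ∉ Icc a' b' → χ x = 0) →
      ∫ x in a..b, χ x * D x = 0) :
    ∀ᵐ x, x ∈ Ioo a b → D x = 0 := by
  apply isOpen_Ioo.ae_eq_zero_of_integral_contDiff_smul_eq_zero
  · rw [intervalIntegrable_iff_integrableOn_Ioo_of_le hab.le] at hD
    exact hD.locallyIntegrableOn
  · intro g hg hgc hgs
    have hg' := exists_Icc_of_tsupport_subset hab hgc hgs
    have := h g hg hg'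
    rw [intervalIntegral.integral_of_le hab.le] at this
    rw [← this]
    simp only [smul_eq_mul]
    symm
    apply setIntegral_eq_integral_of_forall_compl_eq_zero
    intro x hx
    have : g x = 0 := by
      apply image_eq_zero_of_notMem_tsupport
      intro hx'
      exact hx (Ioo_subset_Ioc_self (hgs hx'))
    simp [this]

/-- A Du Bois-Reymond lemma: a function with an integrable weak derivative on an interval is
almost everywhere equal to a primitive of that derivative. -/
theorem ae_eq_const_add_integral_of_weak {a b : ℝ} (hab : a < b) {m n : ℝ → ℝ}
    (hm : IntervalIntegrable m volume a b) (hn : IntervalIntegrable n volume a b)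
    (h : ∀ θ : ℝ → ℝ, ContDiff ℝ ∞ θ →
      (∃ a' b', a < a' ∧ a' < b' ∧ b' < b ∧ ∀ x, x ∉ Icc a' b' → θ x = 0) →
      ∫ x in a..b, deriv θ x * m x = - ∫ x in a..b, θ x * n x) :
    ∃ c : ℝ, ∀ᵐ x, x ∈ Ioo a b → m x = c + ∫ y in a..x, n y := by
  have hprim : ContinuousOn (fun x => ∫ y in a..x, n y) (uIcc a b) :=
    (hn.absolutelyContinuousOnInterval_intervalIntegral (c := a) (by simp)).continuousOn
  -- The defect `D` has vanishing weak derivative; what remains is to see that it is constant.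
  set D : ℝ → ℝ := fun x => m x - ∫ y in a..x, n y with hDdef
  have hD : IntervalIntegrable D volume a b := hm.sub hprim.intervalIntegrable
  have mulc : ∀ {χ : ℝ → ℝ} {G : ℝ → ℝ}, Continuous χ → IntervalIntegrable G volume a b →
      IntervalIntegrable (fun x => χ x * G x) volume a b := fun hχ hG =>
    hG.continuousOn_mul hχ.continuousOn
  have hDθ : ∀ θ : ℝ → ℝ, ContDiff ℝ ∞ θ →
      (∃ a' b', a < a' ∧ a' < b' ∧ b' < b ∧ ∀ x, x ∉ Icc a' b' → θ x = 0) →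
      ∫ x in a..b, deriv θ x * D x = 0 := by
    intro θ hθ hθs
    have h1 := h θ hθ hθs
    have h2 := integral_deriv_mul_primitive hθ hn
    obtain ⟨a', b', h3, h4, h5, h6⟩ := hθs
    have hb : θ b = 0 := h6 b (fun hb => by linarith [hb.2])
    have hθ' : Continuous (deriv θ) := hθ.continuous_deriv (by simp)
    simp only [hDdef, mul_sub]
    rw [intervalIntegral.integral_sub (mulc hθ' hm) (mulc hθ' hprim.intervalIntegrable), h1, h2, hb]
    ring
  let c0 := (a + b) / 2
  let f : ContDiffBump c0 := ⟨(b - a) / 8, (b - a) / 4, by linarith, by linarith⟩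
  -- A reference bump of mass one inside `(a, b)`. The constant is the integral of `D` against it,
  -- and subtracting a multiple of it gives any test function mean zero.
  set χ₀ : ℝ → ℝ := f.normed volume with hχ₀
  have hχ₀s : ContDiff ℝ ∞ χ₀ := f.contDiff_normed
  have hχ₀i : ∫ x, χ₀ x = 1 := f.integral_normed
  obtain ⟨a₀, b₀, ha₀, hab₀, hb₀, hz₀⟩ : ∃ a' b', a < a' ∧ a' < b' ∧ b' < b ∧
      ∀ x, x ∉ Icc a' b' → χ₀ x = 0 := by
    apply exists_Icc_of_tsupport_subset hab f.hasCompactSupport_normed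
    rw [f.tsupport_normed_eq, Real.closedBall_eq_Icc]
    intro x hx
    have hr : f.rOut = (b - a) / 4 := rfl
    simp only [c0, hr] at hx
    exact ⟨by linarith [hx.1], by linarith [hx.2]⟩
  have hχ₀ab : ∫ x in a..b, χ₀ x = 1 := by
    rw [← hχ₀i, intervalIntegral.integral_of_le hab.le]
    apply setIntegral_eq_integral_of_forall_compl_eq_zero
    intro x hx
    exact hz₀ x fun hx' => hx ⟨by linarith [hx'.1], by linarith [hx'.2]⟩
  set c := ∫ x in a..b, χ₀ x * D x with hc
  refine ⟨c, ?_⟩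
  have key : ∀ᵐ x, x ∈ Ioo a b → D x - c = 0 := by
    apply ae_eq_zero_of_integral_smooth hab (hD.sub intervalIntegrable_const)
    rintro χ hχ ⟨a₁, b₁, ha₁, hab₁, hb₁, hz₁⟩
    set s := ∫ x in a..b, χ x with hs
    have hζ : ContDiff ℝ ∞ (fun x => χ x - s * χ₀ x) := hχ.sub (contDiff_const.mul hχ₀s)
    obtain ⟨p1, p2⟩ := contDiff_primitive hζ a
    have hzero : ∀ x, x ∉ Icc (min a₀ a₁) (max b₀ b₁) → χ x - s * χ₀ x = 0 := by
      intro x hx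
      rw [hz₁ x fun h' => hx ⟨(min_le_right _ _).trans h'.1, h'.2.trans (le_max_right _ _)⟩,
        hz₀ x fun h' => hx ⟨(min_le_left _ _).trans h'.1, h'.2.trans (le_max_left _ _)⟩]
      simp
    have hiζ : ∀ u v, IntervalIntegrable (fun x => χ x - s * χ₀ x) volume u v := fun u v =>
      hζ.continuous.intervalIntegrable u v
    have htot : ∫ x in a..b, (χ x - s * χ₀ x) = 0 := by
      rw [intervalIntegral.integral_sub (hχ.continuous.intervalIntegrable _ _)
        ((hχ₀s.continuous.intervalIntegrable _ _).const_mul s),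
        intervalIntegral.integral_const_mul, hχ₀ab]
      simp [hs]
    have hconst : ∀ u v, (∀ x, x ∈ uIoc u v → χ x - s * χ₀ x = 0) →
        ∫ x in u..v, (χ x - s * χ₀ x) = 0 := by
      intro u v huv
      apply intervalIntegral.integral_zero_ae
      filter_upwards with x hx using huv x hx
    -- The primitive of a mean-zero test function is again compactly supported: it vanishes near `a`
    -- trivially, and near `b` because the total integral is zero.
    have := hDθ _ p1 ⟨min a₀ a₁, max b₀ b₁, lt_min ha₀ ha₁,
      (min_le_left _ _).trans_lt (hab₀.trans_le (le_max_left _ _)), max_lt hb₀ hb₁, ?_⟩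
    · rw [p2] at this
      have e1 : ∀ x, χ x * (D x - c) = (χ x - s * χ₀ x) * D x + (s * (χ₀ x * D x) - c * χ x) := by
        intro x; ring
      simp_rw [e1]
      rw [intervalIntegral.integral_add (mulc hζ.continuous hD), this,
        intervalIntegral.integral_sub, intervalIntegral.integral_const_mul,
        intervalIntegral.integral_const_mul]
      · ring
      · exact (mulc hχ₀s.continuous hD).const_mul s
      · exact (hχ.continuous.intervalIntegrable _ _).const_mul c
      · exact ((mulc hχ₀s.continuous hD).const_mul s).sub
          ((hχ.continuous.intervalIntegrable _ _).const_mul c)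
    · intro x hx
      have hx' : x < min a₀ a₁ ∨ max b₀ b₁ < x := by
        by_contra! hcon
        exact hx ⟨hcon.1, hcon.2⟩
      rcases hx' with hx' | hx'
      · apply hconst
        intro y hy
        apply hzero
        rw [mem_uIoc] at hy
        intro hy'
        have : a < min a₀ a₁ := lt_min ha₀ ha₁
        rcases hy with hy | hy <;> linarith [hy'.1, hy.1, hy.2]
      · have hsplit := intervalIntegral.integral_add_adjacent_intervals (hiζ a x) (hiζ x b)
        rw [htot, hconst x b, add_zero] at hsplit
        · exact hsplit
        intro y hy
        apply hzero
        rw [mem_uIoc] at hy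
        intro hy'
        have : max b₀ b₁ < b := max_lt hb₀ hb₁
        rcases hy with hy | hy <;> linarith [hy'.2, hy.1, hy.2]
  filter_upwards [key] with x hx hx'
  have := hx hx'
  simp only [hDdef] at this
  linarith

end WaveMapS1

/-! ### Weak derivatives, Sobolev's inequality and tangency on the circle -/

namespace WaveMapS1

/-- The periodic extension of the restriction of `θ` to `(0, 2π]`. -/
noncomputable def periodize (θ : ℝ → ℝ) (x : ℝ) : ℝ := θ (toIocMod period_pos 0 x)

theorem periodize_periodic (θ : ℝ → ℝ) : Function.Periodic (periodize θ) period := fun x => by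
  simp [periodize]

theorem periodize_eq (θ : ℝ → ℝ) {x : ℝ} (hx : x ∈ Ioc 0 period) : periodize θ x = θ x := by
  have : toIocMod period_pos 0 x = x := by
    rw [toIocMod_eq_self]; simpa using hx
  rw [periodize, this]

/-- Away from the seam the periodization agrees locally with `θ`; at the seam it is locally zero,
because `θ` vanishes near both ends. All other points are translates of these. -/
theorem contDiff_periodize {θ : ℝ → ℝ} (hθ : ContDiff ℝ ∞ θ) {a' b' : ℝ} (ha : 0 < a')
    (hb : b' < period) (hz : ∀ x, x ∉ Icc a' b' → θ x = 0) : ContDiff ℝ ∞ (periodize θ) := by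
  rw [contDiff_iff_contDiffAt]
  have main : ∀ x ∈ Ioc 0 period, ContDiffAt ℝ ∞ (periodize θ) x := by
    intro x hx
    rcases hx.2.lt_or_eq with hlt | heq
    · have : periodize θ =ᶠ[𝓝 x] θ := by
        filter_upwards [Ioo_mem_nhds hx.1 hlt] with y hy
        exact periodize_eq θ ⟨hy.1, hy.2.le⟩
      exact hθ.contDiffAt.congr_of_eventuallyEq this
    · have : periodize θ =ᶠ[𝓝 x] fun _ => 0 := by
        have hp := period_pos
        filter_upwards [Ioo_mem_nhds (show max 0 b' < x by
          rw [heq]; exact max_lt hp hb) (show x < period + min a' period by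
            rw [heq]; linarith [lt_min ha hp])] with y hy
        have h1 := (max_lt_iff.1 hy.1)
        have h2 := lt_min_iff.1 (show y - period < min a' period by linarith [hy.2])
        rcases le_or_gt y period with hyp | hyp
        · rw [periodize_eq θ ⟨h1.1, hyp⟩]
          exact hz y fun h => by linarith [h.2]
        · rw [← (periodize_periodic θ).sub_eq y, periodize_eq θ ⟨by linarith, h2.2.le⟩]
          exact hz _ fun h => by linarith [h.1, h2.1]
      exact contDiffAt_const.congr_of_eventuallyEq this
  intro x
  have hx := main _ (by simpa using toIocMod_mem_Ioc period_pos 0 x)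
  have hc : ContDiffAt ℝ ∞ (fun y => periodize θ (y - toIocDiv period_pos 0 x • period)) x := by
    refine ContDiffAt.comp x (g := periodize θ) ?_ (contDiffAt_id.sub contDiffAt_const)
    exact hx
  refine hc.congr_of_eventuallyEq (Eventually.of_forall fun y => ?_)
  exact ((periodize_periodic θ).sub_zsmul_eq _).symm

theorem integral_circ_eq {E : Type*} [NormedAddCommGroup E] [NormedSpace ℝ E] (g : ℝ → E) :
    ∫ x, g x ∂circ = ∫ x in (0)..period, g x := by
  rw [intervalIntegral.integral_of_le period_pos.le, circ]

theorem ae_circ_iff {P : ℝ → Prop} : (∀ᵐ x ∂circ, P x) ↔ ∀ᵐ x, x ∈ Ioo 0 period → P x := by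
  rw [circ, ← restrict_Ioo_eq_restrict_Ioc, ae_restrict_iff' measurableSet_Ioo]

theorem intervalIntegrable_of_integrable_circ {E : Type*} [NormedAddCommGroup E] {g : ℝ → E}
    (hg : Integrable g circ) : IntervalIntegrable g volume 0 period := by
  rw [intervalIntegrable_iff_integrableOn_Ioc_of_le period_pos.le]; exact hg

/-- The fundamental lemma of the calculus of variations on the circle. -/
theorem ae_circ_eq_zero_of_integral_smooth {D : ℝ → ℝ} (hD : Integrable D circ)
    (h : ∀ η : ℝ → ℝ, ContDiff ℝ ∞ η → Function.Periodic η period →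
      ∫ x, η x * D x ∂circ = 0) : ∀ᵐ x ∂circ, D x = 0 := by
  rw [ae_circ_iff]
  apply ae_eq_zero_of_integral_smooth period_pos (intervalIntegrable_of_integrable_circ hD)
  rintro χ hχ ⟨a', b', ha, _, hb, hz⟩
  have h1 := h _ (contDiff_periodize hχ ha hb hz) (periodize_periodic χ)
  rw [integral_circ_eq] at h1
  refine Eq.trans ?_ h1
  apply intervalIntegral.integral_congr_ae
  filter_upwards with x hx
  rw [uIoc_of_le period_pos.le] at hx
  rw [periodize_eq χ hx]

theorem ae_circ_eq_const_add_integral_of_weak {m n : ℝ → ℝ} (hm : Integrable m circ)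
    (hn : Integrable n circ)
    (h : ∀ η : ℝ → ℝ, ContDiff ℝ ∞ η → Function.Periodic η period →
      ∫ x, deriv η x * m x ∂circ = - ∫ x, η x * n x ∂circ) :
    ∃ c : ℝ, ∀ᵐ x ∂circ, m x = c + ∫ y in (0)..x, n y := by
  simp_rw [ae_circ_iff]
  apply ae_eq_const_add_integral_of_weak period_pos (intervalIntegrable_of_integrable_circ hm)
    (intervalIntegrable_of_integrable_circ hn)
  rintro θ hθ ⟨a', b', ha, _, hb, hz⟩
  have := h _ (contDiff_periodize hθ ha hb hz) (periodize_periodic θ)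
  rw [integral_circ_eq, integral_circ_eq] at this
  have e1 : ∫ x in (0)..period, θ x * n x = ∫ x in (0)..period, periodize θ x * n x := by
    apply intervalIntegral.integral_congr_ae
    filter_upwards with x hx
    rw [uIoc_of_le period_pos.le] at hx
    rw [periodize_eq θ hx]
  rw [e1, ← this, intervalIntegral.integral_of_le period_pos.le,
    intervalIntegral.integral_of_le period_pos.le, ← restrict_Ioo_eq_restrict_Ioc]
  apply setIntegral_congr_fun measurableSet_Ioo
  intro x hx
  have : periodize θ =ᶠ[𝓝 x] θ := by
    filter_upwards [Ioo_mem_nhds hx.1 hx.2] with y hy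
    exact periodize_eq θ ⟨hy.1, hy.2.le⟩
  simp only
  rw [this.deriv_eq]

variable {k : ℕ}

theorem integral_apply {α : Type*} [MeasurableSpace α] {μ : Measure α} {f : α → Amb k}
    (hf : Integrable f μ) (i : Fin (k + 1)) : (∫ x, f x ∂μ) i = ∫ x, f x i ∂μ :=
  ((EuclideanSpace.proj (𝕜 := ℝ) i).integral_comp_comm hf).symm

theorem intervalIntegral_apply {a b : ℝ} {f : ℝ → Amb k}
    (hf : IntervalIntegrable f volume a b) (i : Fin (k + 1)) :
    (∫ x in a..b, f x) i = ∫ x in a..b, f x i :=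
  ((EuclideanSpace.proj (𝕜 := ℝ) i).intervalIntegral_comp_comm hf).symm

theorem integrable_apply {α : Type*} [MeasurableSpace α] {μ : Measure α} {f : α → Amb k}
    (hf : Integrable f μ) (i : Fin (k + 1)) : Integrable (fun x => f x i) μ :=
  (EuclideanSpace.proj (𝕜 := ℝ) i).integrable_comp hf

theorem memLp_integrable_circ {g : ℝ → Amb k} (hg : MemLp g 2 circ) : Integrable g circ :=
  hg.integrable (by norm_num)

theorem exists_bound_of_periodic {η : ℝ → ℝ} (hη : Continuous η)
    (hp : Function.Periodic η period) : ∃ C, ∀ x, ‖η x‖ ≤ C := by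
  obtain ⟨C, hC⟩ := isCompact_Icc.exists_bound_of_continuousOn (s := Icc 0 period) hη.continuousOn
  refine ⟨C, fun x => ?_⟩
  obtain ⟨y, hy, hy'⟩ := hp.exists_mem_Ico₀ period_pos x
  rw [hy']
  exact hC y ⟨hy.1, hy.2.le⟩

theorem periodic_deriv {η : ℝ → ℝ} (hp : Function.Periodic η period) :
    Function.Periodic (deriv η) period := by
  intro x
  have : η = fun y => η (y + period) := funext fun y => (hp y).symm
  conv_rhs => rw [this]
  rw [deriv_comp_add_const]

theorem integrable_smul_circ {η : ℝ → ℝ} (hη : Continuous η) (hp : Function.Periodic η period)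
    {g : ℝ → Amb k} (hg : Integrable g circ) : Integrable (fun x => η x • g x) circ := by
  obtain ⟨C, hC⟩ := exists_bound_of_periodic hη hp
  exact hg.bdd_smul C hη.aestronglyMeasurable (ae_of_all _ hC)

theorem ae_circ_eq_zero_of_integral_smooth_smul {D : ℝ → Amb k} (hD : Integrable D circ)
    (h : ∀ η : ℝ → ℝ, ContDiff ℝ ∞ η → Function.Periodic η period →
      ∫ x, η x • D x ∂circ = 0) : ∀ᵐ x ∂circ, D x = 0 := by
  have : ∀ i, ∀ᵐ x ∂circ, D x i = 0 := fun i => by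
    apply ae_circ_eq_zero_of_integral_smooth (integrable_apply hD i)
    intro η hη hp
    have h1 := congrArg (fun v : Amb k => v i) (h η hη hp)
    rw [integral_apply (integrable_smul_circ hη.continuous hp hD)] at h1
    simpa using h1
  filter_upwards [ae_all_iff.2 this] with x hx
  ext i
  simpa using hx i

/-- Du Bois-Reymond in each coordinate. The absolutely continuous representative is what the Sobolev
bound and the orthogonality of `φ` and `φ_x` rest on. -/
theorem HasWeakDeriv.ae_eq {g g' : ℝ → Amb k} (h : HasWeakDeriv g g') (hg : Integrable g circ)
    (hg' : Integrable g' circ) :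
    ∃ c : Amb k, ∀ᵐ x ∂circ, g x = c + ∫ y in (0)..x, g' y := by
  have : ∀ i, ∃ c : ℝ, ∀ᵐ x ∂circ, g x i = c + ∫ y in (0)..x, g' y i := fun i => by
    apply ae_circ_eq_const_add_integral_of_weak (integrable_apply hg i) (integrable_apply hg' i)
    intro η hη hp
    have h1 := congrArg (fun v : Amb k => v i) (h η hη hp)
    simp only [PiLp.neg_apply] at h1
    rw [integral_apply (integrable_smul_circ (hη.continuous_deriv (by simp)) (periodic_deriv hp) hg),
      integral_apply (integrable_smul_circ hη.continuous hp hg')] at h1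
    simpa using h1
  choose c hc using this
  refine ⟨WithLp.toLp 2 c, ?_⟩
  filter_upwards [ae_all_iff.2 hc, ae_restrict_mem measurableSet_Ioc] with x hx hx'
  ext i
  rw [hx i, PiLp.add_apply, intervalIntegral_apply]
  refine (intervalIntegrable_of_integrable_circ hg').mono_set ?_
  rw [uIcc_of_le hx'.1.le, uIcc_of_le period_pos.le]
  exact Icc_subset_Icc_right hx'.2

/-- Weak derivatives on the circle are unique. -/
theorem HasWeakDeriv.ae_unique {g h g' h' : ℝ → Amb k} (hg : HasWeakDeriv g g')
    (hh : HasWeakDeriv h h') (hgh : g =ᵐ[circ] h) (hg' : Integrable g' circ)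
    (hh' : Integrable h' circ) : g' =ᵐ[circ] h' := by
  have : ∀ᵐ x ∂circ, g' x - h' x = 0 := by
    apply ae_circ_eq_zero_of_integral_smooth_smul (hg'.sub hh')
    intro η hη hp
    have h1 := hg η hη hp
    have h2 := hh η hη hp
    have h3 : ∫ x, deriv η x • g x ∂circ = ∫ x, deriv η x • h x ∂circ := by
      apply integral_congr_ae
      filter_upwards [hgh] with x hx
      rw [hx]
    simp only [Pi.sub_apply, smul_sub]
    rw [integral_sub (integrable_smul_circ hη.continuous hp hg')
      (integrable_smul_circ hη.continuous hp hh'), ← neg_inj, neg_sub, sub_eq_add_neg, ← h1,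
      h3, h2, add_neg_cancel, neg_zero]
  filter_upwards [this] with x hx
  exact sub_eq_zero.1 hx

theorem eLpNorm_two_sq {α : Type*} [MeasurableSpace α] {E : Type*} [NormedAddCommGroup E]
    (μ : Measure α) (f : α → E) : eLpNorm f 2 μ ^ 2 = ∫⁻ x, ‖f x‖ₑ ^ 2 ∂μ := by
  rw [eLpNorm_eq_lintegral_rpow_enorm_toReal (by norm_num) (by norm_num)]
  simp only [ENNReal.toReal_ofNat, one_div]
  rw [← ENNReal.rpow_natCast, ← ENNReal.rpow_mul]
  norm_num

/-- The Cauchy-Schwarz inequality on the circle. -/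
theorem lintegral_circ_sq_le {g : ℝ → ℝ≥0∞} (hg : AEMeasurable g circ) :
    (∫⁻ x, g x ∂circ) ^ 2 ≤ ENNReal.ofReal period * ∫⁻ x, g x ^ 2 ∂circ := by
  have := ENNReal.lintegral_mul_le_Lp_mul_Lq circ Real.HolderConjugate.two_two
    (f := fun _ => 1) (g := g) aemeasurable_const hg
  simp only [Pi.mul_apply, one_mul, ENNReal.one_rpow, lintegral_const, circ_univ] at this
  calc _ ≤ (ENNReal.ofReal period ^ (1 / 2 : ℝ) * (∫⁻ x, g x ^ (2 : ℝ) ∂circ) ^ (1 / 2 : ℝ)) ^ 2 := by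
        gcongr
    _ = _ := by
        rw [mul_pow, ← ENNReal.rpow_natCast, ← ENNReal.rpow_mul, ← ENNReal.rpow_natCast,
          ← ENNReal.rpow_mul]
        norm_num

theorem add_sq_le_two_mul (a b : ℝ≥0∞) : (a + b) ^ 2 ≤ 2 * (a ^ 2 + b ^ 2) := by
  rcases eq_or_ne a ⊤ with rfl | ha
  · simp
  rcases eq_or_ne b ⊤ with rfl | hb
  · simp
  lift a to NNReal using ha
  lift b to NNReal using hb
  norm_cast
  rw [← NNReal.coe_le_coe]
  push_cast
  nlinarith [sq_nonneg ((a : ℝ) - b)]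

theorem enorm_intervalIntegral_le {E : Type*} [NormedAddCommGroup E] [NormedSpace ℝ E]
    (f : ℝ → E) (a b : ℝ) : ‖∫ x in a..b, f x‖ₑ ≤ ∫⁻ x in uIoc a b, ‖f x‖ₑ := by
  have : ‖∫ x in a..b, f x‖ₑ = ‖∫ x in uIoc a b, f x‖ₑ := by
    rw [← ofReal_norm, ← ofReal_norm, intervalIntegral.norm_intervalIntegral_eq]
  rw [this]
  exact enorm_integral_le_lintegral_enorm _

theorem one_le_ofReal_period : 1 ≤ ENNReal.ofReal period := by
  rw [ENNReal.one_le_ofReal, period]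
  linarith [Real.pi_gt_three]

/-- The Sobolev inequality on the circle. -/
theorem HasWeakDeriv.enorm_sq_le {g g' : ℝ → Amb k} (h : HasWeakDeriv g g')
    (hg : MemLp g 2 circ) (hg' : MemLp g' 2 circ) :
    ∀ᵐ x ∂circ, ‖g x‖ₑ ^ 2 ≤ 2 * ENNReal.ofReal period *
      ((∫⁻ y, ‖g y‖ₑ ^ 2 ∂circ) + ∫⁻ y, ‖g' y‖ₑ ^ 2 ∂circ) := by
  obtain ⟨c, hc⟩ := h.ae_eq (memLp_integrable_circ hg) (memLp_integrable_circ hg')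
  have hi := intervalIntegrable_of_integrable_circ (memLp_integrable_circ hg')
  set p := ENNReal.ofReal period with hp
  have hp1 : 1 ≤ p := one_le_ofReal_period
  set G := ∫⁻ y, ‖g y‖ₑ ^ 2 ∂circ
  set G' := ∫⁻ y, ‖g' y‖ₑ ^ 2 ∂circ with hG'
  have hB := lintegral_circ_sq_le hg'.1.enorm
  set B := ∫⁻ y, ‖g' y‖ₑ ∂circ with hBdef
  have hsub : ∀ x ∈ Ioc 0 period, IntervalIntegrable g' volume 0 x := fun x hx => by
    refine hi.mono_set ?_
    rw [uIcc_of_le hx.1.le, uIcc_of_le period_pos.le]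
    exact Icc_subset_Icc_right hx.2
  filter_upwards [hc, ae_restrict_mem measurableSet_Ioc] with x hx hx'
  -- The base point `y` is free; averaging over it in `h2` replaces a pointwise value by the `L²`
  -- norm.
  have h1 : ∀ᵐ y ∂circ, ‖g x‖ₑ ^ 2 ≤ 2 * (‖g y‖ₑ ^ 2 + B ^ 2) := by
    filter_upwards [hc, ae_restrict_mem measurableSet_Ioc] with y hy hy'
    have e : g x = g y + ∫ z in y..x, g' z := by
      rw [hx, hy, ← intervalIntegral.integral_add_adjacent_intervals (hsub y hy')
        ((hsub y hy').symm.trans (hsub x hx'))]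
      abel
    have e2 : ‖∫ z in y..x, g' z‖ₑ ≤ B := by
      refine (enorm_intervalIntegral_le _ _ _).trans ?_
      rw [hBdef, circ]
      apply lintegral_mono_set
      intro z hz
      rw [mem_uIoc] at hz
      rcases hz with hz | hz
      · exact ⟨hy'.1.trans hz.1, hz.2.trans hx'.2⟩
      · exact ⟨hx'.1.trans hz.1, hz.2.trans hy'.2⟩
    calc ‖g x‖ₑ ^ 2 ≤ (‖g y‖ₑ + B) ^ 2 := by
          rw [e]
          gcongr
          exact (enorm_add_le _ _).trans (by gcongr)
      _ ≤ _ := add_sq_le_two_mul _ _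
  have h2 : p * ‖g x‖ₑ ^ 2 ≤ p * (2 * p * (G + G')) := by
    calc p * ‖g x‖ₑ ^ 2 = ∫⁻ y, ‖g x‖ₑ ^ 2 ∂circ := by
          rw [lintegral_const, circ_univ, mul_comm]
      _ ≤ ∫⁻ y, 2 * (‖g y‖ₑ ^ 2 + B ^ 2) ∂circ := lintegral_mono_ae h1
      _ = 2 * (G + p * B ^ 2) := by
          rw [lintegral_const_mul' _ _ (by norm_num), lintegral_add_right _ measurable_const,
            lintegral_const, circ_univ, mul_comm p]
      -- Since `1 ≤ p`, the factor `p * p` may be inserted before `G`; both terms then share it and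
      -- one power of `p` cancels.
      _ ≤ 2 * (p * p * G + p * (p * G')) := by
          gcongr
          calc G = 1 * 1 * G := by simp
            _ ≤ p * p * G := by gcongr
      _ = _ := by ring
  exact (ENNReal.mul_le_mul_iff_right (by positivity) ENNReal.ofReal_ne_top).1 h2

/-- By continuity the absolutely continuous representative has norm one at every interior point, and
the derivative of its squared norm vanishes. `InTangentBundle` constrains only `φ_t`; this supplies
the tangency of `φ_x`. -/
theorem inner_eq_zero_of_norm_eq_one {g g' : ℝ → Amb k} (h : HasWeakDeriv g g')
    (hg : Integrable g circ) (hg' : Integrable g' circ) (h1 : ∀ᵐ x ∂circ, ‖g x‖ = 1) :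
    ∀ᵐ x ∂circ, ⟪g x, g' x⟫ = 0 := by
  obtain ⟨c, hc⟩ := h.ae_eq hg hg'
  have hi := intervalIntegrable_of_integrable_circ hg'
  set r : ℝ → Amb k := fun x => c + ∫ y in (0)..x, g' y with hr
  have hcont : ContinuousOn r (Icc 0 period) := by
    refine continuousOn_const.add ?_
    have := intervalIntegral.continuousOn_primitive_interval
      (f := g') (μ := volume) (a := 0)
      (b := period) (by
        rw [uIcc_of_le period_pos.le]
        exact (intervalIntegrable_iff_integrableOn_Icc_of_le period_pos.le).1 hi)
    rwa [uIcc_of_le period_pos.le] at this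
  have hone : EqOn (fun x => ‖r x‖ ^ 2) (fun _ => (1 : ℝ)) (Ioo 0 period) := by
    apply Measure.eqOn_open_of_ae_eq (μ := volume) _ isOpen_Ioo
    · exact (hcont.mono Ioo_subset_Icc_self).norm.pow 2
    · exact continuousOn_const
    · have : circ = volume.restrict (Ioo 0 period) := restrict_Ioo_eq_restrict_Ioc.symm
      rw [← this]
      filter_upwards [hc, h1] with x hx hx'
      rw [show r x = g x from hx.symm, hx']
      norm_num
  rw [ae_circ_iff] at hc ⊢
  filter_upwards [hc, hi.ae_hasDerivAt_integral] with x hx hx' hxm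
  have hd : HasDerivAt r (g' x) x := by
    refine HasDerivAt.const_add c (hx' ?_ 0 (by simp))
    rw [uIcc_of_le period_pos.le]
    exact Ioo_subset_Icc_self hxm
  have hd2 := hd.norm_sq
  have hd3 : HasDerivAt (fun x => ‖r x‖ ^ 2) 0 x := by
    refine (hasDerivAt_const x (1 : ℝ)).congr_of_eventuallyEq ?_
    filter_upwards [Ioo_mem_nhds hxm.1 hxm.2] with y hy using hone hy
  have := hd2.unique hd3
  rw [show r x = g x from (hx hxm).symm] at this
  linarith

end WaveMapS1

/-! ### Measurability and integration on the cylinder along characteristics -/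

namespace WaveMapS1

/-- A measurable function on the cylinder `[a, b] × 𝕊¹`. -/
structure Slab {E : Type*} [TopologicalSpace E] (a b : ℝ) (H : ℝ → ℝ → E) : Prop where
  meas : AEStronglyMeasurable (Function.uncurry H) (cyl a b)
  per : ∀ t ∈ Icc a b, Function.Periodic (H t) period

theorem iUnion_Ioc_int_mul_period : ⋃ n : ℤ, Ioc (n * period) ((n + 1) * period) = univ := by
  have := iUnion_Ioc_zsmul period_pos
  simpa [zsmul_eq_mul] using this

theorem cyl_eq_restrict (a b : ℝ) :
    cyl a b = ((volume.restrict (Icc a b)).prod volume).restrict (univ ×ˢ Ioc 0 period) := by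
  rw [cyl, circ, ← Measure.prod_restrict, Measure.restrict_univ]

theorem cyl_mono {a b a' b' : ℝ} (h : Icc a' b' ⊆ Icc a b) : cyl a' b' ≤ cyl a b := by
  have e : cyl a' b' = (cyl a b).restrict (Icc a' b' ×ˢ univ) := by
    rw [cyl, cyl, ← Measure.prod_restrict, Measure.restrict_univ,
      Measure.restrict_restrict measurableSet_Icc, inter_eq_self_of_subset_left h]
  rw [e]
  exact Measure.restrict_le_self

theorem ae_cyl_mem (a b : ℝ) : ∀ᵐ p ∂cyl a b, p.1 ∈ Icc a b := by
  have : ∀ᵐ t ∂volume.restrict (Icc a b), t ∈ Icc a b := ae_restrict_mem measurableSet_Icc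
  exact Measure.quasiMeasurePreserving_fst.ae this

variable {E F G : Type*} {a b : ℝ}

section
variable [TopologicalSpace E] [TopologicalSpace F] [TopologicalSpace G]

theorem Slab.mono {H : ℝ → ℝ → E} (h : Slab a b H) {a' b' : ℝ} (hs : Icc a' b' ⊆ Icc a b) :
    Slab a' b' H :=
  ⟨h.meas.mono_measure (cyl_mono hs), fun t ht => h.per t (hs ht)⟩

theorem Slab.comp {H : ℝ → ℝ → E} (h : Slab a b H) {f : E → G} (hf : Continuous f) :
    Slab a b (fun t x => f (H t x)) :=
  ⟨hf.comp_aestronglyMeasurable h.meas, fun t ht x => by simp only [h.per t ht x]⟩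

theorem Slab.comp₂ {H : ℝ → ℝ → E} {K : ℝ → ℝ → F} (h : Slab a b H) (hK : Slab a b K)
    {f : E → F → G} (hf : Continuous (Function.uncurry f)) :
    Slab a b (fun t x => f (H t x) (K t x)) :=
  ⟨hf.comp_aestronglyMeasurable (h.meas.prodMk hK.meas),
    fun t ht x => by simp only [h.per t ht x, hK.per t ht x]⟩

theorem Slab.of_continuous {H : ℝ → ℝ → E} [TopologicalSpace.PseudoMetrizableSpace E]
    [SecondCountableTopology E] (h : Continuous (Function.uncurry H))
    (hp : ∀ t, Function.Periodic (H t) period) : Slab a b H :=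
  ⟨h.aestronglyMeasurable, fun t _ => hp t⟩

/-- The plane strip is a countable union of translates of the cylinder, on each of which periodicity
reduces to the fundamental one. -/
theorem Slab.aestronglyMeasurable_prod [TopologicalSpace.PseudoMetrizableSpace E]
    {H : ℝ → ℝ → E} (h : Slab a b H) :
    AEStronglyMeasurable (Function.uncurry H) ((volume.restrict (Icc a b)).prod volume) := by
  have hU : ((volume.restrict (Icc a b)).prod (volume : Measure ℝ)) =
      ((volume.restrict (Icc a b)).prod volume).restrict
        (⋃ n : ℤ, univ ×ˢ Ioc (n * period) ((n + 1) * period)) := by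
    rw [← prod_iUnion, iUnion_Ioc_int_mul_period, univ_prod_univ, Measure.restrict_univ]
  rw [hU, aestronglyMeasurable_iUnion_iff]
  intro n
  rw [← Measure.prod_restrict, Measure.restrict_univ]
  have hmp0 : MeasurePreserving (fun x : ℝ => x + (-(n * period)))
      (volume.restrict (Ioc (n * period) ((n + 1) * period))) circ := by
    have := (measurePreserving_add_right volume (-(n * period))).restrict_preimage
      (measurableSet_Ioc (a := 0) (b := period))
    have e : (fun x : ℝ => x + (-(n * period))) ⁻¹' Ioc 0 period =
        Ioc (n * period) ((n + 1) * period) := by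
      ext x
      simp only [mem_preimage, mem_Ioc]
      constructor <;> rintro ⟨h1, h2⟩ <;> constructor <;> linarith
    rwa [e] at this
  have hmp := (MeasurePreserving.id (volume.restrict (Icc a b))).prod hmp0
  have hcomp := h.meas.comp_measurePreserving hmp
  refine hcomp.congr ?_
  have hm : ∀ᵐ p ∂(volume.restrict (Icc a b)).prod
      (volume.restrict (Ioc (n * period) ((n + 1) * period))), p.1 ∈ Icc a b :=
    Measure.quasiMeasurePreserving_fst.ae (ae_restrict_mem measurableSet_Icc)
  filter_upwards [hm] with p hp
  have := (h.per p.1 hp).sub_zsmul_eq n (x := p.2)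
  simpa [Function.uncurry, Prod.map, sub_eq_add_neg] using this

/-- This shear straightens characteristics: for fixed `y` the point `(t, y - c t)` runs along `x + c
t = y`. -/
theorem measurePreserving_shear (μ : Measure ℝ) [SFinite μ] (c : ℝ) :
    MeasurePreserving (fun p : ℝ × ℝ => (p.1, p.2 - c * p.1)) (μ.prod volume)
      (μ.prod volume) := by
  refine (MeasurePreserving.id μ).skew_product (g := fun t y => y - c * t)
    (measurable_snd.sub (measurable_fst.const_mul c)) ?_
  filter_upwards with t
  exact (measurePreserving_sub_right volume (c * t)).map_eq

theorem Slab.shear [TopologicalSpace.PseudoMetrizableSpace E] {H : ℝ → ℝ → E} (h : Slab a b H)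
    (c : ℝ) : AEStronglyMeasurable (fun p : ℝ × ℝ => H p.1 (p.2 - c * p.1))
      ((volume.restrict (Icc a b)).prod volume) :=
  h.aestronglyMeasurable_prod.comp_measurePreserving (measurePreserving_shear _ c)

theorem Slab.shear_circ [TopologicalSpace.PseudoMetrizableSpace E] {H : ℝ → ℝ → E}
    (h : Slab a b H) (c : ℝ) :
    AEStronglyMeasurable (fun p : ℝ × ℝ => H p.1 (p.2 - c * p.1)) (cyl a b) := by
  rw [cyl_eq_restrict]
  exact (h.shear c).restrict

theorem Slab.line [TopologicalSpace.PseudoMetrizableSpace E] {H : ℝ → ℝ → E} (h : Slab a b H)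
    (c : ℝ) : ∀ᵐ y, AEStronglyMeasurable (fun r => H r (y - c * r)) (volume.restrict (Icc a b)) :=
  (h.shear c).prod_swap.prodMk_left

end

theorem Slab.lintegral_eq {H : ℝ → ℝ → ℝ≥0∞} (h : Slab a b H) :
    ∫⁻ p, H p.1 p.2 ∂cyl a b = ∫⁻ r in Icc a b, (∫⁻ x, H r x ∂circ) := by
  rw [cyl, lintegral_prod (fun p : ℝ × ℝ => H p.1 p.2) h.meas.aemeasurable]

/-- Tonelli, together with translation invariance of the circle integral in each time slice. -/
theorem Slab.lintegral_shear {H : ℝ → ℝ → ℝ≥0∞} (h : Slab a b H) (c : ℝ) :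
    ∫⁻ y, (∫⁻ r in Icc a b, H r (y - c * r)) ∂circ = ∫⁻ p, H p.1 p.2 ∂cyl a b := by
  rw [h.lintegral_eq, lintegral_lintegral_swap]
  · apply lintegral_congr_ae
    filter_upwards [ae_restrict_mem measurableSet_Icc] with r hr
    exact lintegral_circ_sub (h.per r hr) _
  · exact (h.shear_circ c).aemeasurable.prod_swap

theorem Slab.measurable_line {H : ℝ → ℝ → ℝ≥0∞} (h : Slab a b H) (c : ℝ) :
    AEMeasurable (fun y => ∫⁻ r in Icc a b, H r (y - c * r)) circ :=
  (h.shear_circ c).aemeasurable.lintegral_prod_left'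

section Normed
variable [NormedAddCommGroup E]

theorem Slab.enorm {H : ℝ → ℝ → E} (h : Slab a b H) : Slab a b (fun t x => ‖H t x‖ₑ) :=
  h.comp continuous_enorm

theorem Slab.integrable_shear {H : ℝ → ℝ → E} (h : Slab a b H)
    (hi : Integrable (fun p : ℝ × ℝ => H p.1 p.2) (cyl a b)) (c : ℝ) :
    Integrable (fun p : ℝ × ℝ => H p.1 (p.2 - c * p.1)) (cyl a b) := by
  refine ⟨h.shear_circ c, ?_⟩
  have h1 := hi.2
  rw [hasFiniteIntegral_iff_enorm] at h1 ⊢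
  rw [← h.enorm.lintegral_shear c] at h1
  rwa [cyl, lintegral_prod_symm _ (h.shear_circ c).enorm]

theorem Slab.integrable_line {H : ℝ → ℝ → E} (h : Slab a b H)
    (hi : Integrable (fun p : ℝ × ℝ => H p.1 p.2) (cyl a b)) (c : ℝ) :
    ∀ᵐ y, IntegrableOn (fun r => H r (y - c * r)) (Icc a b) := by
  refine ae_of_ae_circ ?_ (h.integrable_shear hi c).prod_left_ae
  intro y
  refine integrableOn_congr_fun (fun r hr => ?_) measurableSet_Icc
  rw [add_sub_right_comm, h.per r hr]

theorem Slab.integral_shear [NormedSpace ℝ E] {H : ℝ → ℝ → E} (h : Slab a b H)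
    (hi : Integrable (fun p : ℝ × ℝ => H p.1 p.2) (cyl a b)) (c : ℝ) :
    ∫ p, H p.1 p.2 ∂cyl a b = ∫ y, (∫ r in Icc a b, H r (y - c * r)) ∂circ := by
  rw [cyl] at hi
  have h1 := h.integrable_shear hi c
  rw [cyl] at h1
  rw [← integral_prod_symm _ h1, integral_prod _ h1, cyl, integral_prod _ hi]
  apply integral_congr_ae
  filter_upwards [ae_restrict_mem measurableSet_Icc] with r hr
  have := integral_circ_add (h.per r hr) (-(c * r))
  simp only [← sub_eq_add_neg] at this
  exact this.symm

/-- Joint measurability makes the integral of the norm computable slice by slice, and it vanishes.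
The constraints of an energy path, given at each time, become space-time statements this way. -/
theorem Slab.ae_of_forall {H : ℝ → ℝ → E} (h : Slab a b H)
    (h0 : ∀ t ∈ Icc a b, ∀ᵐ x ∂circ, H t x = 0) : ∀ᵐ p ∂cyl a b, H p.1 p.2 = 0 := by
  have h1 := h.enorm.lintegral_eq
  have h2 : ∫⁻ r in Icc a b, (∫⁻ x, ‖H r x‖ₑ ∂circ) = 0 := by
    rw [lintegral_eq_zero_of_ae_eq_zero]
    filter_upwards [ae_restrict_mem measurableSet_Icc] with r hr
    rw [Pi.zero_apply, lintegral_eq_zero_of_ae_eq_zero]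
    filter_upwards [h0 r hr] with x hx
    simp [hx]
  rw [h2] at h1
  replace h1 := (lintegral_eq_zero_iff' (f := fun p : ℝ × ℝ => ‖H p.1 p.2‖ₑ) h.meas.enorm).1 h1
  filter_upwards [h1] with p hp
  simpa using hp

/-- The integral of the norm over the cylinder is the integral over all characteristics of one
family, so almost every one of them misses the exceptional set. -/
theorem Slab.ae_line_of_ae {H : ℝ → ℝ → E} (h : Slab a b H)
    (h0 : ∀ᵐ p ∂cyl a b, H p.1 p.2 = 0) (c : ℝ) :
    ∀ᵐ y, ∀ᵐ r ∂volume.restrict (Icc a b), H r (y - c * r) = 0 := by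
  have h1 := h.enorm.lintegral_shear c
  have h2 : ∫⁻ p, ‖H p.1 p.2‖ₑ ∂cyl a b = 0 := by
    rw [lintegral_eq_zero_of_ae_eq_zero]
    filter_upwards [h0] with p hp
    simp [hp]
  rw [h2, lintegral_eq_zero_iff' (h.enorm.measurable_line c)] at h1
  refine ae_of_ae_circ ?_ ?_
  · intro y
    refine eventually_congr ?_
    filter_upwards [ae_restrict_mem measurableSet_Icc] with r hr
    rw [add_sub_right_comm, h.per r hr]
  filter_upwards [h1, ae_circ_of_ae (h.line c)] with y hy hm
  rw [Pi.zero_apply, lintegral_eq_zero_iff' hm.enorm] at hy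
  filter_upwards [hy] with r hr
  simpa using hr

end Normed

variable {k : ℕ}

theorem IsContL2.slab {h : ℝ → ℝ → Amb k} (hh : IsContL2 a b h) : Slab a b h :=
  ⟨hh.aestronglyMeasurable, hh.periodic⟩

/-- Continuity bounds the norm near each time, and compactness of the interval does the rest. The
bound is purely qualitative. -/
theorem IsContL2.exists_bound {h : ℝ → ℝ → Amb k} (hh : IsContL2 a b h) :
    ∃ C : ℝ≥0∞, C ≠ ⊤ ∧ ∀ t ∈ Icc a b, eLpNorm (h t) 2 circ ≤ C := by
  refine isCompact_Icc.induction_on (p := fun s => ∃ C : ℝ≥0∞, C ≠ ⊤ ∧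
    ∀ t ∈ s, eLpNorm (h t) 2 circ ≤ C) ⟨0, by simp, by simp⟩ ?_ ?_ ?_ |>.imp fun C hC => hC
  · rintro s t hst ⟨C, hC, hC'⟩
    exact ⟨C, hC, fun r hr => hC' r (hst hr)⟩
  · rintro s t ⟨C, hC, hC'⟩ ⟨D, hD, hD'⟩
    refine ⟨max C D, by simp [hC, hD], ?_⟩
    rintro r (hr | hr)
    · exact (hC' r hr).trans (le_max_left _ _)
    · exact (hD' r hr).trans (le_max_right _ _)
  · intro t ht
    have h1 := (hh.continuous t ht).eventually_lt_const (show (0 : ℝ≥0∞) < 1 by simp)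
    refine ⟨{s | eLpNorm (fun x => h s x - h t x) 2 circ < 1} ∩ Icc a b,
      Filter.inter_mem h1 self_mem_nhdsWithin, 1 + eLpNorm (h t) 2 circ, ?_, ?_⟩
    · simp [(hh.memLp t ht).2.ne]
    · rintro s ⟨hs, hs'⟩
      calc eLpNorm (h s) 2 circ = eLpNorm ((fun x => h s x - h t x) + h t) 2 circ := by
            congr 1
            ext1 x
            simp
        _ ≤ _ := eLpNorm_add_le ((hh.memLp s hs').1.sub (hh.memLp t ht).1) (hh.memLp t ht).1
            (by norm_num)
        _ ≤ _ := by gcongr; exact le_of_lt hs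

theorem IsContL2.lintegral_lt_top {h : ℝ → ℝ → Amb k} (hh : IsContL2 a b h) :
    ∫⁻ p, ‖h p.1 p.2‖ₑ ^ 2 ∂cyl a b < ⊤ := by
  obtain ⟨C, hC, hC'⟩ := hh.exists_bound
  rw [(hh.slab.enorm.comp (f := fun z : ℝ≥0∞ => z ^ 2) (by fun_prop)).lintegral_eq]
  calc _ ≤ ∫⁻ r in Icc a b, C ^ 2 := by
        apply setLIntegral_mono' measurableSet_Icc
        intro r hr
        rw [← eLpNorm_two_sq]
        gcongr
        exact hC' r hr
    _ < ⊤ := by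
        rw [lintegral_const]
        exact ENNReal.mul_lt_top (ENNReal.pow_lt_top hC.lt_top) (by simp)

instance (a b : ℝ) : IsFiniteMeasure (cyl a b) := by
  unfold cyl; infer_instance

theorem memLp_two_of_lintegral {α : Type*} [MeasurableSpace α] {μ : Measure α}
    [NormedAddCommGroup E] {f : α → E} (hf : AEStronglyMeasurable f μ)
    (h : ∫⁻ x, ‖f x‖ₑ ^ 2 ∂μ < ⊤) : MemLp f 2 μ := by
  refine ⟨hf, ?_⟩
  rw [← eLpNorm_two_sq] at h
  simpa using ENNReal.pow_lt_top_iff.1 h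

theorem IsContL2.memLp_cyl {h : ℝ → ℝ → Amb k} (hh : IsContL2 a b h) :
    MemLp (fun p : ℝ × ℝ => h p.1 p.2) 2 (cyl a b) :=
  memLp_two_of_lintegral hh.aestronglyMeasurable hh.lintegral_lt_top

theorem IsContL2.integrable_cyl {h : ℝ → ℝ → Amb k} (hh : IsContL2 a b h) :
    Integrable (fun p : ℝ × ℝ => h p.1 p.2) (cyl a b) :=
  hh.memLp_cyl.integrable (by norm_num)

end WaveMapS1

/-! ### Pairings with travelling test functions -/

namespace WaveMapS1

variable {k : ℕ} {a b : ℝ}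

theorem lintegral_enorm_le_eLpNorm {E : Type*} [NormedAddCommGroup E] {g : ℝ → E}
    (hg : AEStronglyMeasurable g circ) :
    ∫⁻ x, ‖g x‖ₑ ∂circ ≤ ENNReal.ofReal period * eLpNorm g 2 circ := by
  have h := lintegral_circ_sq_le hg.enorm
  rw [← eLpNorm_two_sq] at h
  have h1 : (∫⁻ x, ‖g x‖ₑ ∂circ) ^ 2 ≤ (ENNReal.ofReal period * eLpNorm g 2 circ) ^ 2 := by
    refine h.trans ?_
    rw [mul_pow]
    gcongr
    calc ENNReal.ofReal period = ENNReal.ofReal period * 1 := by simp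
      _ ≤ _ := by rw [sq]; gcongr; exact one_le_ofReal_period
  exact (ENNReal.pow_le_pow_left_iff (by norm_num)).1 h1

/-- The pairing of an `L²`-continuous path with a travelling test function. -/
noncomputable def pairing (c : ℝ) (η : ℝ → ℝ) (h : ℝ → ℝ → Amb k) (t : ℝ) : Amb k :=
  ∫ x, η (x + c * t) • h t x ∂circ

theorem periodic_comp_add {E : Type*} {η : ℝ → E} (hp : Function.Periodic η period) (d : ℝ) :
    Function.Periodic (fun x => η (x + d)) period := fun x => by
  simp only [add_right_comm x period d, hp (x + d)]

theorem integrable_pairing {η : ℝ → ℝ} (hη : Continuous η) (hp : Function.Periodic η period)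
    {g : ℝ → Amb k} (hg : Integrable g circ) (d : ℝ) :
    Integrable (fun x => η (x + d) • g x) circ :=
  integrable_smul_circ (η := fun x => η (x + d)) (by fun_prop) (periodic_comp_add hp d) hg

/-- Both factors move with time. The motion of `η` is handled by dominated convergence with `h`
frozen at `t`, the motion of `h` by continuity in `L²`. -/
theorem continuousOn_pairing {h : ℝ → ℝ → Amb k} (hh : IsContL2 a b h) {η : ℝ → ℝ}
    (hη : Continuous η) (hp : Function.Periodic η period) (c : ℝ) :
    ContinuousOn (pairing c η h) (Icc a b) := by
  intro t ht
  obtain ⟨C, hC⟩ := exists_bound_of_periodic hη hp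
  have hi : ∀ s ∈ Icc a b, Integrable (h s) circ := fun s hs => memLp_integrable_circ (hh.memLp s hs)
  have h1 : Continuous fun s => ∫ x, η (x + c * s) • h t x ∂circ := by
    refine continuous_of_dominated (bound := fun x => C * ‖h t x‖) (fun s => ?_) (fun s => ?_)
      ((hi t ht).norm.const_mul C) ?_
    · exact (integrable_pairing hη hp (hi t ht) _).1
    · filter_upwards with x
      rw [norm_smul]
      gcongr
      exact hC _
    · filter_upwards with x
      fun_prop
  have h2 : Tendsto (fun s => pairing c η h s - ∫ x, η (x + c * s) • h t x ∂circ)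
      (𝓝[Icc a b] t) (𝓝 0) := by
    rw [tendsto_zero_iff_enorm_tendsto_zero]
    have hz : Tendsto (fun s => ENNReal.ofReal C * (ENNReal.ofReal period *
        eLpNorm (fun x => h s x - h t x) 2 circ)) (𝓝[Icc a b] t) (𝓝 0) := by
      have := ENNReal.Tendsto.const_mul (a := ENNReal.ofReal C * ENNReal.ofReal period)
        (hh.continuous t ht) (Or.inr (by finiteness))
      simpa [mul_assoc] using this
    refine tendsto_of_tendsto_of_tendsto_of_le_of_le' tendsto_const_nhds hz
      (Eventually.of_forall fun s => zero_le) ?_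
    filter_upwards [self_mem_nhdsWithin] with s hs
    have hm := (hh.memLp s hs).sub (hh.memLp t ht)
    have e : pairing c η h s - ∫ x, η (x + c * s) • h t x ∂circ =
        ∫ x, η (x + c * s) • (h s x - h t x) ∂circ := by
      rw [pairing, ← integral_sub (integrable_pairing hη hp (hi s hs) _)
        (integrable_pairing hη hp (hi t ht) _)]
      simp only [smul_sub]
    rw [e]
    calc _ ≤ ∫⁻ x, ‖η (x + c * s) • (h s x - h t x)‖ₑ ∂circ := enorm_integral_le_lintegral_enorm _
      _ ≤ ∫⁻ x, ENNReal.ofReal C * ‖h s x - h t x‖ₑ ∂circ := by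
          gcongr with x
          rw [enorm_smul, ← ofReal_norm (η _)]
          gcongr
          exact hC _
      _ = ENNReal.ofReal C * ∫⁻ x, ‖h s x - h t x‖ₑ ∂circ := by
          rw [lintegral_const_mul' _ _ (by finiteness)]
      _ ≤ _ := by
          gcongr
          exact lintegral_enorm_le_eLpNorm hm.1
  have h3 := h2.add (h1.continuousWithinAt (s := Icc a b) (x := t))
  simp only [sub_add_cancel, zero_add] at h3
  exact h3

theorem slab_pairing {h : ℝ → ℝ → Amb k} (hh : Slab a b h) {η : ℝ → ℝ}
    (hη : Continuous η) (hp : Function.Periodic η period) (c : ℝ) :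
    Slab a b (fun t x => η (x + c * t) • h t x) :=
  (Slab.of_continuous (H := fun t x => η (x + c * t)) (by simp only [Function.uncurry_def]; fun_prop)
    (fun t => periodic_comp_add hp _)).comp₂ hh (f := fun r v => r • v)
      (by simp only [Function.uncurry_def]; fun_prop)

theorem integrable_cyl_pairing {h : ℝ → ℝ → Amb k}
    (hi : Integrable (fun p : ℝ × ℝ => h p.1 p.2) (cyl a b)) {η : ℝ → ℝ}
    (hη : Continuous η) (hp : Function.Periodic η period) (c : ℝ) :
    Integrable (fun p : ℝ × ℝ => η (p.2 + c * p.1) • h p.1 p.2) (cyl a b) := by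
  obtain ⟨C, hC⟩ := exists_bound_of_periodic hη hp
  exact hi.bdd_smul C (by fun_prop : Continuous fun p : ℝ × ℝ => η (p.2 + c * p.1)).aestronglyMeasurable
    (ae_of_all _ fun p => hC _)

theorem integrableOn_pairing {h : ℝ → ℝ → Amb k}
    (hi : Integrable (fun p : ℝ × ℝ => h p.1 p.2) (cyl a b)) {η : ℝ → ℝ}
    (hη : Continuous η) (hp : Function.Periodic η period) (c : ℝ) :
    IntegrableOn (pairing c η h) (Icc a b) :=
  (show Integrable (fun p : ℝ × ℝ => η (p.2 + c * p.1) • h p.1 p.2)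
    ((volume.restrict (Icc a b)).prod circ) from
      integrable_cyl_pairing hi hη hp c).integral_prod_left

theorem integral_cyl_pairing {h : ℝ → ℝ → Amb k}
    (hi : Integrable (fun p : ℝ × ℝ => h p.1 p.2) (cyl a b)) {η : ℝ → ℝ}
    (hη : Continuous η) (hp : Function.Periodic η period) (c : ℝ) {θ : ℝ → ℝ}
    (hθ : Continuous θ) :
    Integrable (fun p : ℝ × ℝ => (θ p.1 * η (p.2 + c * p.1)) • h p.1 p.2) (cyl a b) ∧
    ∫ p, (θ p.1 * η (p.2 + c * p.1)) • h p.1 p.2 ∂cyl a b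
      = ∫ t in Icc a b, θ t • pairing c η h t := by
  obtain ⟨C, hC⟩ := isCompact_Icc.exists_bound_of_continuousOn (s := Icc a b) hθ.continuousOn
  have h1 : Integrable (fun p : ℝ × ℝ => θ p.1 • η (p.2 + c * p.1) • h p.1 p.2) (cyl a b) := by
    refine (integrable_cyl_pairing hi hη hp c).bdd_smul C
      (by fun_prop : Continuous fun p : ℝ × ℝ => θ p.1).aestronglyMeasurable ?_
    filter_upwards [ae_cyl_mem a b] with p hp
    exact hC _ hp
  simp only [mul_smul]
  refine ⟨h1, ?_⟩
  rw [cyl] at h1 ⊢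
  rw [integral_prod _ h1]
  apply integral_congr_ae
  filter_upwards with t
  simp only [pairing]
  rw [integral_smul]

theorem intervalIntegrable_of_Icc {E : Type*} [NormedAddCommGroup E] {f : ℝ → E}
    (hf : IntegrableOn f (Icc a b)) {s t : ℝ} (hs : s ∈ Icc a b) (ht : t ∈ Icc a b) :
    IntervalIntegrable f volume s t := by
  rw [intervalIntegrable_iff]
  refine hf.mono_set fun x hx => ?_
  have := uIoc_subset_uIcc hx
  exact uIcc_subset_Icc hs ht this

/-- The time derivative of the pairing of an energy path with a travelling test function. -/
theorem IsEnergyPath.pairing_sub {φ φx φt : ℝ → ℝ → Amb k} (h : IsEnergyPath a b φ φx φt)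
    (hab : a < b) {η : ℝ → ℝ} (hη : ContDiff ℝ ∞ η) (hp : Function.Periodic η period) (c : ℝ)
    {s t : ℝ} (hs : s ∈ Icc a b) (ht : t ∈ Icc a b) :
    pairing c η φ t - pairing c η φ s =
      ∫ r in s..t, (pairing c η φt r - c • pairing c η φx r) := by
  have hη' : Continuous (deriv η) := hη.continuous_deriv (by simp)
  have hp' := periodic_deriv hp
  have hm := continuousOn_pairing h.cont hη.continuous hp c
  have hmi : IntegrableOn (pairing c η φ) (Icc a b) :=
    integrableOn_pairing h.cont.integrable_cyl hη.continuous hp c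
  have hti : IntegrableOn (pairing c η φt) (Icc a b) :=
    integrableOn_pairing h.cont_t.integrable_cyl hη.continuous hp c
  have hxi : IntegrableOn (pairing c η φx) (Icc a b) :=
    integrableOn_pairing h.cont_x.integrable_cyl hη.continuous hp c
  have hdi : IntegrableOn (pairing c (deriv η) φ) (Icc a b) :=
    integrableOn_pairing h.cont.integrable_cyl hη' hp' c
  have hxd : ∀ r ∈ Icc a b, pairing c (deriv η) φ r = - pairing c η φx r := by
    intro r hr
    have := h.weakDeriv_x r hr (fun x => η (x + c * r)) (by fun_prop) (periodic_comp_add hp _)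
    simpa only [deriv_comp_add_const, pairing] using this
  set n : ℝ → Amb k := fun r => pairing c η φt r - c • pairing c η φx r with hn
  have hni : IntegrableOn n (Icc a b) := hti.sub (hxi.smul c)
  have ha : a ∈ Icc a b := left_mem_Icc.2 hab.le
  have hb : b ∈ Icc a b := right_mem_Icc.2 hab.le
  -- Testing with `θ(t) η(x + c t)`: the chain rule produces a term with `c η'`, which the spatial
  -- weak derivative turns into `-c φ_x`.
  have hweak : ∀ θ : ℝ → ℝ, ContDiff ℝ ∞ θ →
      (∃ a' b', a < a' ∧ a' < b' ∧ b' < b ∧ ∀ x, x ∉ Icc a' b' → θ x = 0) →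
      ∫ x in Icc a b, deriv θ x • pairing c η φ x = - ∫ x in Icc a b, θ x • n x := by
    rintro θ hθ ⟨a', b', ha', _, hb', hz⟩
    have hθ' : Continuous (deriv θ) := hθ.continuous_deriv (by simp)
    have h1 := h.weakDeriv_t (fun t x => θ t * η (x + c * t))
      (by simp only [Function.uncurry_def]; fun_prop)
      (fun t x => by simp only [periodic_comp_add hp (c * t) x])
      ⟨a', b', ha', hb', fun t ht x => by rw [hz t ht, zero_mul]⟩
    have hd : ∀ p : ℝ × ℝ, deriv (fun s => θ s * η (p.2 + c * s)) p.1 =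
        deriv θ p.1 * η (p.2 + c * p.1) + (c * θ p.1) * deriv η (p.2 + c * p.1) := by
      intro p
      have d1 : HasDerivAt (fun s => η (p.2 + c * s)) (deriv η (p.2 + c * p.1) * c) p.1 := by
        have hd0 : HasDerivAt η (deriv η (p.2 + c * p.1)) (p.2 + c * p.1) :=
          (hη.differentiable (by simp)).differentiableAt.hasDerivAt
        have hd1 : HasDerivAt (fun s : ℝ => p.2 + c * s) c p.1 := by
          simpa using ((hasDerivAt_id p.1).const_mul c).const_add p.2
        exact hd0.comp p.1 hd1
      have d2 : HasDerivAt θ (deriv θ p.1) p.1 :=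
        (hθ.differentiable (by simp)).differentiableAt.hasDerivAt
      have d3 : HasDerivAt (fun s => θ s * η (p.2 + c * s)) _ p.1 := d2.mul d1
      rw [d3.deriv]
      ring
    have i1 := integral_cyl_pairing h.cont.integrable_cyl hη.continuous hp c hθ'
    have i2 := integral_cyl_pairing h.cont.integrable_cyl hη' hp' c (θ := fun s => c * θ s)
      (by fun_prop)
    have i3 := integral_cyl_pairing h.cont_t.integrable_cyl hη.continuous hp c hθ.continuous
    simp only [hd, add_smul] at h1
    rw [integral_add i1.1 i2.1, i1.2, i2.2, i3.2] at h1
    have e1 : ∫ t in Icc a b, (c * θ t) • pairing c (deriv η) φ t =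
        - ∫ t in Icc a b, θ t • c • pairing c η φx t := by
      rw [← integral_neg]
      apply setIntegral_congr_fun measurableSet_Icc
      intro t ht
      simp only [hxd t ht, smul_neg, smul_smul, mul_comm c]
    have i4 : IntegrableOn (fun t => θ t • pairing c η φt t) (Icc a b) :=
      hti.continuousOn_smul hθ.continuous.continuousOn isCompact_Icc
    have i5 : IntegrableOn (fun t => θ t • c • pairing c η φx t) (Icc a b) :=
      IntegrableOn.continuousOn_smul (hxi.smul c) hθ.continuous.continuousOn isCompact_Icc
    simp only [hn, smul_sub]
    rw [integral_sub i4 i5]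
    rw [e1] at h1
    rw [eq_neg_iff_add_eq_zero] at h1 ⊢
    rw [← h1]
    abel
  have hco : ∀ i, ∃ d : ℝ, ∀ᵐ x, x ∈ Ioo a b → pairing c η φ x i = d + ∫ y in a..x, n y i := by
    intro i
    have hmi' : IntegrableOn (fun x => pairing c η φ x i) (Icc a b) := integrable_apply hmi i
    have hni' : IntegrableOn (fun x => n x i) (Icc a b) := integrable_apply hni i
    apply ae_eq_const_add_integral_of_weak hab (intervalIntegrable_of_Icc hmi' ha hb)
      (intervalIntegrable_of_Icc hni' ha hb)
    intro θ hθ hz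
    have hθ' : Continuous (deriv θ) := hθ.continuous_deriv (by simp)
    have h1 := congrArg (fun v : Amb k => v i) (hweak θ hθ hz)
    simp only [PiLp.neg_apply] at h1
    rw [integral_apply (hmi.continuousOn_smul hθ'.continuousOn isCompact_Icc),
      integral_apply (hni.continuousOn_smul hθ.continuous.continuousOn isCompact_Icc)] at h1
    simp only [PiLp.smul_apply, smul_eq_mul] at h1
    rw [intervalIntegral.integral_of_le hab.le, intervalIntegral.integral_of_le hab.le,
      ← integral_Icc_eq_integral_Ioc, ← integral_Icc_eq_integral_Ioc, h1]
  -- Both sides are continuous up to the endpoints, so the almost everywhere identity holds at every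
  -- time.
  have hall : ∀ i, ∃ d : ℝ, ∀ x ∈ Icc a b, pairing c η φ x i = d + ∫ y in a..x, n y i := by
    intro i
    obtain ⟨d, hd⟩ := hco i
    refine ⟨d, ?_⟩
    have hni' : IntegrableOn (fun x => n x i) (Icc a b) := integrable_apply hni i
    have hc1 : ContinuousOn (fun x => pairing c η φ x i) (Icc a b) :=
      (EuclideanSpace.proj (𝕜 := ℝ) i).continuous.comp_continuousOn hm
    have hc2 : ContinuousOn (fun x => d + ∫ y in a..x, n y i) (Icc a b) := by
      refine continuousOn_const.add ?_
      have := intervalIntegral.continuousOn_primitive_interval (f := fun y => n y i)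
        (μ := volume) (a := a) (b := b) (by rwa [uIcc_of_le hab.le])
      rwa [uIcc_of_le hab.le] at this
    have heq : EqOn (fun x => pairing c η φ x i) (fun x => d + ∫ y in a..x, n y i) (Ioo a b) := by
      apply Measure.eqOn_open_of_ae_eq (μ := volume) _ isOpen_Ioo
        (hc1.mono Ioo_subset_Icc_self) (hc2.mono Ioo_subset_Icc_self)
      exact (ae_restrict_iff' measurableSet_Ioo).2 hd
    have hcl := heq.of_subset_closure hc1 hc2 Ioo_subset_Icc_self
      (by rw [closure_Ioo hab.ne])
    exact fun x hx => hcl hx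
  ext i
  obtain ⟨d, hd⟩ := hall i
  have hni' : IntegrableOn (fun x => n x i) (Icc a b) := integrable_apply hni i
  rw [intervalIntegral_apply (intervalIntegrable_of_Icc hni hs ht), PiLp.sub_apply, hd t ht,
    hd s hs, ← intervalIntegral.integral_add_adjacent_intervals
      (intervalIntegrable_of_Icc hni' ha hs) (intervalIntegrable_of_Icc hni' hs ht)]
  ring

end WaveMapS1

/-! ### The equation integrated along characteristics -/

namespace WaveMapS1

variable {k : ℕ} {a b : ℝ}

/-- A function with prescribed weak derivative along the characteristics `x + c t = const`. -/
theorem ae_line_eq_of_pairing {H N : ℝ → ℝ → Amb k} (hH : ∀ t ∈ Icc a b, Integrable (H t) circ)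
    (hHp : ∀ t ∈ Icc a b, Function.Periodic (H t) period) (hN : Slab a b N)
    (hNi : Integrable (fun p : ℝ × ℝ => N p.1 p.2) (cyl a b)) (c : ℝ)
    (h : ∀ η : ℝ → ℝ, ContDiff ℝ ∞ η → Function.Periodic η period → ∀ t ∈ Icc a b,
      pairing c η H t - pairing c η H a = ∫ r in a..t, pairing c η N r)
    {s t : ℝ} (hs : s ∈ Icc a b) (ht : t ∈ Icc a b) :
    ∀ᵐ y, H t (y - c * t) = H s (y - c * s) + ∫ r in s..t, N r (y - c * r) := by
  have hper : ∀ t ∈ Icc a b, Function.Periodic (fun y => H t (y - c * t)) period :=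
    fun t ht y => by simp only [add_sub_right_comm, hHp t ht (y - c * t)]
  have hshift : ∀ t ∈ Icc a b, Integrable (fun y => H t (y - c * t)) circ := by
    intro t ht
    have h1 := intervalIntegrable_of_integrable_circ (hH t ht)
    have h2 := (hHp t ht).intervalIntegrable₀ period_pos.ne' h1 (0 - c * t) (period - c * t)
    have h3 := h2.comp_sub_right (c * t)
    simp only [sub_add_cancel] at h3
    rwa [intervalIntegrable_iff_integrableOn_Ioc_of_le period_pos.le] at h3
  have key : ∀ t ∈ Icc a b, ∀ᵐ y,
      H t (y - c * t) = H a (y - c * a) + ∫ r in a..t, N r (y - c * r) := by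
    intro t ht
    have hsub : Icc a t ⊆ Icc a b := Icc_subset_Icc_right ht.2
    have hNt := hN.mono hsub
    have hNti := hNi.mono_measure (cyl_mono hsub)
    have e0 : ∀ f : ℝ → Amb k, ∫ r in a..t, f r = ∫ r in Icc a t, f r := fun f => by
      rw [intervalIntegral.integral_of_le ht.1, integral_Icc_eq_integral_Ioc]
    simp only [e0] at h ⊢
    have hI : Integrable (fun y => ∫ r in Icc a t, N r (y - c * r)) circ :=
      (show Integrable (fun p : ℝ × ℝ => N p.1 (p.2 - c * p.1))
        ((volume.restrict (Icc a t)).prod circ) from hNt.integrable_shear hNti c).integral_prod_right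
    have ha : a ∈ Icc a b := ⟨le_rfl, ht.1.trans ht.2⟩
    have hz : ∀ᵐ y ∂circ, H t (y - c * t) - H a (y - c * a) -
        ∫ r in Icc a t, N r (y - c * r) = 0 := by
      apply ae_circ_eq_zero_of_integral_smooth_smul
        (((hshift t ht).sub (hshift a ha)).sub hI)
      intro η hη hp
      -- In the variable `y = x + c t` the test function stands still, so the hypothesis says that
      -- the identity holds weakly in `y`.
      have hpair : ∀ t ∈ Icc a b, pairing c η H t = ∫ y, η y • H t (y - c * t) ∂circ := by
        intro t ht
        have := integral_circ_add (g := fun y => η y • H t (y - c * t))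
          (fun y => by simp only [hper t ht y, hp y]) (c * t)
        simpa [pairing] using this
      have h1 := h η hη hp t ht
      have i1 := integral_cyl_pairing hNti hη.continuous hp c (θ := fun _ => 1) continuous_const
      simp only [one_mul, one_smul] at i1
      have i2 := (slab_pairing hNt hη.continuous hp c).integral_shear i1.1 c
      rw [e0, ← i1.2, i2, hpair t ht, hpair a ha] at h1
      simp only [sub_add_cancel] at h1
      simp only [Pi.sub_apply, smul_sub]
      rw [integral_sub, integral_sub, h1, sub_eq_zero]
      · apply integral_congr_ae
        filter_upwards with y
        rw [integral_smul]
      · exact integrable_smul_circ hη.continuous hp (hshift t ht)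
      · exact integrable_smul_circ hη.continuous hp (hshift a ha)
      · exact (integrable_smul_circ hη.continuous hp (hshift t ht)).sub
          (integrable_smul_circ hη.continuous hp (hshift a ha))
      · exact integrable_smul_circ hη.continuous hp hI
    have hz' : ∀ᵐ y, H t (y - c * t) - H a (y - c * a) - ∫ r in Icc a t, N r (y - c * r) = 0 := by
      refine ae_of_ae_circ (fun y => ?_) hz
      have : ∫ r in Icc a t, N r (y + period - c * r) = ∫ r in Icc a t, N r (y - c * r) := by
        apply setIntegral_congr_fun measurableSet_Icc
        intro r hr
        simp only
        rw [add_sub_right_comm, hNt.per r hr]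
      rw [this, show H t (y + period - c * t) = _ from hper t ht y,
        show H a (y + period - c * a) = _ from hper a ha y]
    filter_upwards [hz'] with y hy
    rw [sub_sub, sub_eq_zero] at hy
    exact hy
  have ha : a ∈ Icc a b := ⟨le_rfl, ht.1.trans ht.2⟩
  filter_upwards [key s hs, key t ht, hN.integrable_line hNi c] with y h1 h2 h3
  rw [h1, h2, ← intervalIntegral.integral_add_adjacent_intervals
    (intervalIntegrable_of_Icc h3 ha hs) (intervalIntegrable_of_Icc h3 hs ht), add_assoc]

/-- The derivative `φ_t + c φ_x`. -/
noncomputable def nullDer (c : ℝ) (φx φt : ℝ → ℝ → Amb k) (t x : ℝ) : Amb k := φt t x + c • φx t x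

/-- The right-hand side of the wave maps equation with source `F`. -/
noncomputable def nonlin (F φ φx φt : ℝ → ℝ → Amb k) (t x : ℝ) : Amb k :=
  (‖φt t x‖ ^ 2 - ‖φx t x‖ ^ 2) • φ t x + F t x

/-- The case `c = 0`, where the lines are `x = const`. -/
theorem IsEnergyPath.ae_eq {φ φx φt : ℝ → ℝ → Amb k} (h : IsEnergyPath a b φ φx φt)
    (hab : a < b) {s t : ℝ} (hs : s ∈ Icc a b) (ht : t ∈ Icc a b) :
    ∀ᵐ x, φ t x = φ s x + ∫ r in s..t, φt r x := by
  have := ae_line_eq_of_pairing (fun t ht => memLp_integrable_circ (h.cont.memLp t ht))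
    h.cont.periodic h.cont_t.slab h.cont_t.integrable_cyl 0 (fun η hη hp t ht => by
      have := h.pairing_sub hab hη hp 0 (left_mem_Icc.2 hab.le) ht
      simpa using this) hs ht
  simpa using this

theorem IsEnergyPath.nullDer_memLp {φ φx φt : ℝ → ℝ → Amb k} (h : IsEnergyPath a b φ φx φt)
    (c : ℝ) {t : ℝ} (ht : t ∈ Icc a b) : MemLp (nullDer c φx φt t) 2 circ :=
  (h.cont_t.memLp t ht).add ((h.cont_x.memLp t ht).const_smul c)

theorem IsEnergyPath.nullDer_slab {φ φx φt : ℝ → ℝ → Amb k} (h : IsEnergyPath a b φ φx φt)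
    (c : ℝ) : Slab a b (nullDer c φx φt) :=
  h.cont_t.slab.comp₂ h.cont_x.slab (f := fun v w => v + c • w)
    (by simp only [Function.uncurry_def]; fun_prop)

theorem IsEnergyPath.norm_eq_one {φ φx φt : ℝ → ℝ → Amb k} (h : IsEnergyPath a b φ φx φt) :
    ∀ᵐ p ∂cyl a b, ‖φ p.1 p.2‖ = 1 := by
  have := (h.cont.slab.comp (f := fun v : Amb k => ‖v‖ - 1) (by fun_prop)).ae_of_forall
    (fun t ht => by
      filter_upwards [h.tangent t ht] with x hx
      rw [hx.1, sub_self])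
  filter_upwards [this] with p hp
  exact sub_eq_zero.1 hp

/-- `φ_t` is tangent by definition of the energy path, and `φ_x` because `|φ| = 1`. -/
theorem IsEnergyPath.inner_nullDer {φ φx φt : ℝ → ℝ → Amb k} (h : IsEnergyPath a b φ φx φt)
    (c : ℝ) : ∀ᵐ p ∂cyl a b, ⟪nullDer c φx φt p.1 p.2, φ p.1 p.2⟫ = 0 := by
  refine ((h.nullDer_slab c).comp₂ h.cont.slab (f := fun v w : Amb k => ⟪v, w⟫)
    (by simp only [Function.uncurry_def]; fun_prop)).ae_of_forall (fun t ht => ?_)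
  have h1 := inner_eq_zero_of_norm_eq_one (h.weakDeriv_x t ht)
    (memLp_integrable_circ (h.cont.memLp t ht)) (memLp_integrable_circ (h.cont_x.memLp t ht))
    (by filter_upwards [h.tangent t ht] with x hx using hx.1)
  filter_upwards [h.tangent t ht, h1] with x hx hx'
  rw [nullDer, inner_add_left, real_inner_smul_left, real_inner_comm, hx.2, real_inner_comm, hx']
  simp

theorem nonlin_slab {F φ φx φt : ℝ → ℝ → Amb k} (h : IsEnergyPath a b φ φx φt)
    (hF : Slab a b F) : Slab a b (nonlin F φ φx φt) := by
  have h1 := h.cont_t.slab.comp₂ h.cont_x.slab (f := fun v w : Amb k => ‖v‖ ^ 2 - ‖w‖ ^ 2)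
    (by simp only [Function.uncurry_def]; fun_prop)
  have h2 := h1.comp₂ h.cont.slab (f := fun (r : ℝ) (v : Amb k) => r • v)
    (by simp only [Function.uncurry_def]; fun_prop)
  exact h2.comp₂ hF (f := fun v w => v + w) (by simp only [Function.uncurry_def]; fun_prop)

/-- The energy class alone makes the quadratic term integrable but not square integrable; the latter
uses the null structure, in `IsControlled.lintegral_nonlin_lt_top`. -/
theorem nonlin_integrable {F φ φx φt : ℝ → ℝ → Amb k} (h : IsEnergyPath a b φ φx φt)
    (hF : Integrable (fun p : ℝ × ℝ => F p.1 p.2) (cyl a b)) :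
    Integrable (fun p : ℝ × ℝ => (‖φt p.1 p.2‖ ^ 2 - ‖φx p.1 p.2‖ ^ 2) • φ p.1 p.2) (cyl a b) ∧
    Integrable (fun p : ℝ × ℝ => nonlin F φ φx φt p.1 p.2) (cyl a b) := by
  have h1 : Integrable (fun p : ℝ × ℝ => ‖φt p.1 p.2‖ ^ 2 - ‖φx p.1 p.2‖ ^ 2) (cyl a b) :=
    ((memLp_two_iff_integrable_sq_norm h.cont_t.memLp_cyl.1).1 h.cont_t.memLp_cyl).sub
      ((memLp_two_iff_integrable_sq_norm h.cont_x.memLp_cyl.1).1 h.cont_x.memLp_cyl)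
  have h2 : Integrable (fun p : ℝ × ℝ => (‖φt p.1 p.2‖ ^ 2 - ‖φx p.1 p.2‖ ^ 2) • φ p.1 p.2)
      (cyl a b) := by
    refine h1.smul_bdd 1 h.cont.memLp_cyl.1 ?_
    filter_upwards [h.norm_eq_one] with p hp using hp.le
  exact ⟨h2, h2.add hF⟩

theorem inner_pairing {h : ℝ → ℝ → Amb k} {c : ℝ} {η : ℝ → ℝ} {t : ℝ}
    (hi : Integrable (fun x => η (x + c * t) • h t x) circ) (e : Amb k) :
    ⟪e, pairing c η h t⟫ = ∫ x, ⟪e, η (x + c * t) • h t x⟫ ∂circ := by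
  rw [pairing, integral_inner hi]

/-- The weak equation tested with `η (x + c t)` leaves space-time integrals of `η' φ_x` and `c η'
φ_t`. The travelling identity for `φ` against `η'` has the same two integrals and the boundary
values of `φ_x`; since `c * c = 1`, a combination cancels the integrals and completes `φ_t` to `φ_t
+ c φ_x`. -/
theorem IsSolution.pairing_sub {F φ φx φt : ℝ → ℝ → Amb k} (h : IsSolution a b F φ φx φt)
    (hF : Integrable (fun p : ℝ × ℝ => F p.1 p.2) (cyl a b)) (hab : a < b) {c : ℝ}
    (hc : c * c = 1) {η : ℝ → ℝ} (hη : ContDiff ℝ ∞ η) (hp : Function.Periodic η period)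
    {t : ℝ} (ht : t ∈ Icc a b) :
    pairing c η (nullDer c φx φt) t - pairing c η (nullDer c φx φt) a =
      - ∫ r in a..t, pairing c η (nonlin F φ φx φt) r := by
  -- The weak equation is available only for times beyond `a`; at `a` itself both sides vanish.
  rcases ht.1.eq_or_lt with rfl | hat
  · simp
  have hη' : ContDiff ℝ ∞ (deriv η) := (contDiff_infty_iff_deriv.1 hη).2
  have hp' := periodic_deriv hp
  have ha : a ∈ Icc a b := left_mem_Icc.2 hab.le
  have hsub : Icc a t ⊆ Icc a b := Icc_subset_Icc_right ht.2
  have hμ := cyl_mono hsub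
  have hN := (nonlin_integrable h.path hF).2
  have P := h.path
  -- the travelling identity for `η'`
  have h1 := P.pairing_sub hab hη' hp' c ha ht
  have hxd : ∀ r ∈ Icc a b, pairing c (deriv η) φ r = - pairing c η φx r := by
    intro r hr
    have := P.weakDeriv_x r hr (fun x => η (x + c * r)) (by fun_prop) (periodic_comp_add hp _)
    simpa only [deriv_comp_add_const, pairing] using this
  rw [hxd t ht, hxd a ha] at h1
  have icx : ∀ r ∈ Icc a b, Integrable (φx r) circ := fun r hr =>
    memLp_integrable_circ (P.cont_x.memLp r hr)
  have ict : ∀ r ∈ Icc a b, Integrable (φt r) circ := fun r hr =>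
    memLp_integrable_circ (P.cont_t.memLp r hr)
  have hnull : ∀ r ∈ Icc a b, pairing c η (nullDer c φx φt) r =
      pairing c η φt r + c • pairing c η φx r := by
    intro r hr
    simp only [pairing, nullDer, smul_add]
    rw [integral_add (integrable_pairing hη.continuous hp (ict r hr) _), ← integral_smul]
    · simp only [smul_comm c]
    · simp only [smul_comm _ c]
      exact (integrable_pairing hη.continuous hp (icx r hr) _).smul c
  have e0 : ∀ f : ℝ → Amb k, ∫ r in a..t, f r = ∫ r in Icc a t, f r := fun f => by
    rw [intervalIntegral.integral_of_le hat.le, integral_Icc_eq_integral_Ioc]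
  have cylint : ∀ {ζ : ℝ → ℝ} {g : ℝ → ℝ → Amb k}, Continuous ζ → Function.Periodic ζ period →
      Integrable (fun p : ℝ × ℝ => g p.1 p.2) (cyl a b) →
      Integrable (fun p : ℝ × ℝ => ζ (p.2 + c * p.1) • g p.1 p.2) (cyl a t) ∧
      ∫ p, ζ (p.2 + c * p.1) • g p.1 p.2 ∂cyl a t = ∫ r in a..t, pairing c ζ g r := by
    intro ζ g hζ hζp hg
    have := integral_cyl_pairing (hg.mono_measure hμ) hζ hζp c (θ := fun _ => 1) continuous_const
    simp only [one_mul, one_smul] at this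
    rw [e0]
    exact this
  have jt := cylint hη'.continuous hp' P.cont_t.integrable_cyl
  have jx := cylint hη'.continuous hp' P.cont_x.integrable_cyl
  have jN := cylint hη.continuous hp hN
  have h2 : ∫ r in a..t, (pairing c (deriv η) φt r - c • pairing c (deriv η) φx r) =
      (∫ p, deriv η (p.2 + c * p.1) • φt p.1 p.2 ∂cyl a t) -
        c • ∫ p, deriv η (p.2 + c * p.1) • φx p.1 p.2 ∂cyl a t := by
    rw [jt.2, jx.2, ← intervalIntegral.integral_smul, intervalIntegral.integral_sub]
    · exact intervalIntegrable_of_Icc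
        (integrableOn_pairing P.cont_t.integrable_cyl hη'.continuous hp' c) ha ht
    · exact (intervalIntegrable_of_Icc
        (integrableOn_pairing P.cont_x.integrable_cyl hη'.continuous hp' c) ha ht).smul c
  rw [h2] at h1
  rw [hnull t ht, hnull a ha, ← jN.2]
  -- The weak equation is scalar, so the vector identity is tested against each constant direction
  -- `e`.
  refine ext_inner_left ℝ fun e => ?_
  have heq := h.equation t ⟨hat, ht.2⟩ (fun t x => η (x + c * t) • e)
    (by
      have : ContDiff ℝ 1 η := hη.of_le (by simp)
      simp only [Function.uncurry_def]; fun_prop)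
    (fun t x => by simp only [periodic_comp_add hp (c * t) x])
  have d0 : ∀ z, HasDerivAt η (deriv η z) z := fun z =>
    (hη.differentiable (by simp)).differentiableAt.hasDerivAt
  have dx : ∀ p : ℝ × ℝ, deriv (fun x => η (x + c * p.1) • e) p.2 =
      deriv η (p.2 + c * p.1) • e := fun p =>
    (((d0 _).comp_add_const p.2 (c * p.1)).smul_const e).deriv
  have dt : ∀ p : ℝ × ℝ, deriv (fun s => η (p.2 + c * s) • e) p.1 =
      (deriv η (p.2 + c * p.1) * c) • e := fun p => by
    have hd1 : HasDerivAt (fun s : ℝ => p.2 + c * s) c p.1 := by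
      simpa using ((hasDerivAt_id p.1).const_mul c).const_add p.2
    exact (((d0 _).comp p.1 hd1).smul_const e).deriv
  simp only [dx, dt] at heq
  have hL : ∀ p : ℝ × ℝ, ⟪φx p.1 p.2, deriv η (p.2 + c * p.1) • e⟫
          - ⟪φt p.1 p.2, (deriv η (p.2 + c * p.1) * c) • e⟫
          + (‖φt p.1 p.2‖ ^ 2 - ‖φx p.1 p.2‖ ^ 2) * ⟪φ p.1 p.2, η (p.2 + c * p.1) • e⟫
          + ⟪F p.1 p.2, η (p.2 + c * p.1) • e⟫ =
      ⟪e, deriv η (p.2 + c * p.1) • φx p.1 p.2⟫ - c * ⟪e, deriv η (p.2 + c * p.1) • φt p.1 p.2⟫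
        + ⟪e, η (p.2 + c * p.1) • nonlin F φ φx φt p.1 p.2⟫ := by
    intro p
    simp only [nonlin, real_inner_smul_right, inner_add_right, real_inner_comm e]
    ring
  simp only [hL] at heq
  rw [integral_add, integral_sub, integral_const_mul, integral_inner jx.1, integral_inner jt.1,
    integral_inner jN.1] at heq
  · have hR : ∀ r ∈ Icc a b, ∫ x, ⟪φt r x, η (x + c * r) • e⟫ ∂circ = ⟪e, pairing c η φt r⟫ := by
      intro r hr
      rw [inner_pairing (integrable_pairing hη.continuous hp (ict r hr) _)]
      simp only [real_inner_smul_right, real_inner_comm e]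
    rw [hR a ha, hR t ht] at heq
    have h3 := congrArg (fun v => ⟪e, v⟫) h1
    simp only [inner_sub_right, inner_add_right, inner_neg_right, real_inner_smul_right] at h3 ⊢
    generalize ⟪e, ∫ p, deriv η (p.2 + c * p.1) • φt p.1 p.2 ∂cyl a t⟫ = A at *
    generalize ⟪e, ∫ p, deriv η (p.2 + c * p.1) • φx p.1 p.2 ∂cyl a t⟫ = B at *
    -- `A` cancels at once between the equation and `c` times the travelling identity; `B` cancels
    -- up to `c * c - 1`.
    linear_combination heq - c * h3 + B * hc
  · exact (jx.1.const_inner e)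
  · exact (jt.1.const_inner e).const_mul c
  · exact (jx.1.const_inner e).sub ((jt.1.const_inner e).const_mul c)
  · exact jN.1.const_inner e

/-- The wave maps equation, integrated along the characteristics `x + c t = const`. -/
theorem IsSolution.nullDer_eq {F φ φx φt : ℝ → ℝ → Amb k} (h : IsSolution a b F φ φx φt)
    (hFs : Slab a b F) (hF : Integrable (fun p : ℝ × ℝ => F p.1 p.2) (cyl a b)) (hab : a < b)
    {c : ℝ} (hc : c * c = 1) {s t : ℝ} (hs : s ∈ Icc a b) (ht : t ∈ Icc a b) :
    ∀ᵐ y, nullDer c φx φt t (y - c * t) = nullDer c φx φt s (y - c * s)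
      - ∫ r in s..t, nonlin F φ φx φt r (y - c * r) := by
  have hN := (nonlin_integrable h.path hF).2
  have := ae_line_eq_of_pairing
    (fun t ht => memLp_integrable_circ (h.path.nullDer_memLp c ht)) (h.path.nullDer_slab c).per
    ((nonlin_slab h.path hFs).comp (f := fun v => -v) continuous_neg) hN.neg c
    (fun η hη hp t ht => by
      rw [h.pairing_sub hF hab hc hη hp ht, ← intervalIntegral.integral_neg]
      simp only [pairing, smul_neg, integral_neg]) hs ht
  filter_upwards [this] with y hy
  rw [hy, intervalIntegral.integral_neg, ← sub_eq_add_neg]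

end WaveMapS1

/-! ### The energy inequality on a single characteristic -/

namespace WaveMapS1

variable {k : ℕ} {a b : ℝ}

theorem aestronglyMeasurable_of_circ {E : Type*} [TopologicalSpace E]
    [TopologicalSpace.PseudoMetrizableSpace E] {g : ℝ → E} (hg : AEStronglyMeasurable g circ)
    (hp : Function.Periodic g period) : AEStronglyMeasurable g volume := by
  rw [← Measure.restrict_univ (μ := (volume : Measure ℝ)), ← iUnion_Ioc_int_mul_period,
    aestronglyMeasurable_iUnion_iff]
  intro n
  have h0 : circ = volume.restrict (Ioc 0 (0 + period)) := by simp [circ]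
  rw [h0] at hg
  have := ((isAddFundamentalDomain_Ioc period_pos 0).aestronglyMeasurable_on_iff
    (isAddFundamentalDomain_Ioc period_pos (n * period)) (μ := volume) (f := g)
    hp.map_vadd_zmultiples).1 hg
  rwa [show (n + 1 : ℝ) * period = n * period + period by ring]

/-- `v` is only integrable, so the square is differentiated as a product of absolutely continuous
functions. -/
theorem sq_primitive {v : ℝ → ℝ} {s t : ℝ} (hv : IntervalIntegrable v volume s t) (d : ℝ) :
    (d + ∫ r in s..t, v r) ^ 2 = d ^ 2 + ∫ r in s..t, 2 * ((d + ∫ ρ in s..r, v ρ) * v r) := by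
  set U : ℝ → ℝ := fun r => d + ∫ ρ in s..r, v ρ with hU
  have hprim := hv.absolutelyContinuousOnInterval_intervalIntegral (c := s) (by simp)
  have hc : AbsolutelyContinuousOnInterval (fun _ : ℝ => d) s t :=
    (contDiff_const (n := 1)).contDiffOn.absolutelyContinuousOnInterval
  have hUac : AbsolutelyContinuousOnInterval U s t := hc.add hprim
  have h1 := hUac.integral_deriv_mul_eq_sub hUac
  have h2 : ∫ r in s..t, (deriv U r * U r + U r * deriv U r) = ∫ r in s..t, 2 * (U r * v r) := by
    apply intervalIntegral.integral_congr_ae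
    filter_upwards [hv.ae_hasDerivAt_integral] with r hr hr'
    rw [((hr (uIoc_subset_uIcc hr') s (by simp)).const_add d).deriv]
    ring
  rw [h2] at h1
  have h3 : U s = d := by simp [hU]
  rw [h1, h3]
  simp only [hU]
  ring

theorem norm_sq_primitive {v : ℝ → Amb k} {s t : ℝ} (hv : IntervalIntegrable v volume s t)
    (d : Amb k) : ‖d + ∫ r in s..t, v r‖ ^ 2 =
      ‖d‖ ^ 2 + ∫ r in s..t, 2 * ⟪d + ∫ ρ in s..r, v ρ, v r⟫ := by
  have hvi : ∀ i, IntervalIntegrable (fun r => v r i) volume s t := fun i =>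
    ⟨integrable_apply hv.1 i, integrable_apply hv.2 i⟩
  have hcont : ∀ i, ContinuousOn (fun r => d i + ∫ ρ in s..r, v ρ i) (uIcc s t) := fun i =>
    continuousOn_const.add
      ((hvi i).absolutelyContinuousOnInterval_intervalIntegral (c := s) (by simp)).continuousOn
  have e1 : ∫ r in s..t, 2 * ⟪d + ∫ ρ in s..r, v ρ, v r⟫ =
      ∫ r in s..t, ∑ i, 2 * ((d i + ∫ ρ in s..r, v ρ i) * v r i) := by
    apply intervalIntegral.integral_congr
    intro r hr
    have hr' : IntervalIntegrable v volume s r := hv.mono_set (uIcc_subset_uIcc_left hr)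
    simp only [PiLp.inner_apply, Finset.mul_sum, PiLp.add_apply, intervalIntegral_apply hr']
    apply Finset.sum_congr rfl
    intro i _
    simp
    ring
  rw [e1, intervalIntegral.integral_finsetSum]
  · rw [EuclideanSpace.norm_sq_eq, EuclideanSpace.norm_sq_eq, ← Finset.sum_add_distrib]
    apply Finset.sum_congr rfl
    intro i _
    rw [PiLp.add_apply, intervalIntegral_apply hv, Real.norm_eq_abs, sq_abs, Real.norm_eq_abs,
      sq_abs, sq_primitive (hvi i)]
  · intro i _
    exact ((hvi i).continuousOn_mul (hcont i)).const_mul 2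

/-- The oriented integral is a difference of integrals over two sets that depend measurably on the
parameter. `ae_ae_line_eq` needs this to exchange quantifiers. -/
theorem stronglyMeasurable_primitive {N : ℝ × ℝ → Amb k} (hN : StronglyMeasurable N) (s : ℝ) :
    StronglyMeasurable fun p : ℝ × ℝ => ∫ ρ in s..p.1, N (ρ, p.2) := by
  have main : ∀ {S : Set ((ℝ × ℝ) × ℝ)}, MeasurableSet S →
      StronglyMeasurable fun p : ℝ × ℝ => ∫ ρ in {ρ | (p, ρ) ∈ S}, N (ρ, p.2) := by
    intro S hS
    have h1 : StronglyMeasurable (S.indicator fun q : (ℝ × ℝ) × ℝ => N (q.2, q.1.2)) :=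
      (hN.comp_measurable (by fun_prop)).indicator hS
    have h2 := h1.integral_prod_right' (ν := (volume : Measure ℝ))
    have e : (fun p : ℝ × ℝ => ∫ ρ in {ρ | (p, ρ) ∈ S}, N (ρ, p.2)) =
        fun p : ℝ × ℝ => ∫ ρ, S.indicator (fun q : (ℝ × ℝ) × ℝ => N (q.2, q.1.2)) (p, ρ) := by
      ext1 p
      have hm : MeasurableSet {ρ | (p, ρ) ∈ S} := measurable_prodMk_left hS
      rw [← integral_indicator hm]
      rfl
    rw [e]
    exact h2
  have m1 : MeasurableSet {q : (ℝ × ℝ) × ℝ | s < q.2 ∧ q.2 ≤ q.1.1} :=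
    (measurableSet_lt measurable_const measurable_snd).inter
      (measurableSet_le measurable_snd (measurable_fst.comp measurable_fst))
  have m2 : MeasurableSet {q : (ℝ × ℝ) × ℝ | q.1.1 < q.2 ∧ q.2 ≤ s} :=
    (measurableSet_lt (measurable_fst.comp measurable_fst) measurable_snd).inter
      (measurableSet_le measurable_snd measurable_const)
  exact (main m1).sub (main m2)

/-- Passing from an identity at every time to an identity on almost every characteristic. -/
theorem ae_ae_line_eq {H N : ℝ → ℝ → Amb k} (hH : Slab a b H) (hN : Slab a b N)
    {c s : ℝ} (hs : s ∈ Icc a b) {g : ℝ → Amb k} (hg : AEStronglyMeasurable g circ)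
    (h : ∀ t ∈ Icc a b, ∀ᵐ y, H t (y - c * t) = g y - ∫ r in s..t, N r (y - c * r)) :
    ∀ᵐ y ∂circ, ∀ᵐ t ∂volume.restrict (Icc a b),
      H t (y - c * t) = g y - ∫ r in s..t, N r (y - c * r) := by
  have hH' := hH.shear_circ c
  have hN' := hN.shear_circ c
  rw [cyl] at hH' hN'
  -- With strongly measurable representatives the set where the identity holds is measurable, so
  -- Fubini's theorem allows "every time, almost every line" to be reversed.
  set Hm := hH'.mk _
  set Nm := hN'.mk _
  set gm := hg.mk _
  have hHm := hH'.ae_eq_mk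
  have hNm := hN'.ae_eq_mk
  have hD : StronglyMeasurable fun p : ℝ × ℝ => Hm p - (gm p.2 - ∫ r in s..p.1, Nm (r, p.2)) :=
    hH'.stronglyMeasurable_mk.sub ((hg.stronglyMeasurable_mk.comp_measurable measurable_snd).sub
      (stronglyMeasurable_primitive hN'.stronglyMeasurable_mk s))
  have hS : MeasurableSet {p : ℝ × ℝ | Hm p - (gm p.2 - ∫ r in s..p.1, Nm (r, p.2)) = 0} :=
    hD.measurable (measurableSet_singleton 0)
  have swap : ∀ {P : ℝ × ℝ → Prop}, (∀ᵐ p ∂(volume.restrict (Icc a b)).prod circ, P p) →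
      ∀ᵐ y ∂circ, ∀ᵐ t ∂volume.restrict (Icc a b), P (t, y) := by
    intro P hP
    have := (Measure.measurePreserving_swap (μ := circ)
      (ν := volume.restrict (Icc a b))).quasiMeasurePreserving.ae hP
    exact Measure.ae_ae_of_ae_prod this
  have hN1 := swap hNm
  have hint : ∀ᵐ y ∂circ, ∀ t ∈ Icc a b, ∫ r in s..t, N r (y - c * r) = ∫ r in s..t, Nm (r, y) := by
    filter_upwards [hN1] with y hy t ht
    apply intervalIntegral.integral_congr_ae
    rw [ae_restrict_iff' measurableSet_Icc] at hy
    filter_upwards [hy] with r hr hr'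
    exact hr (uIcc_subset_Icc hs ht (uIoc_subset_uIcc hr'))
  have hall : ∀ᵐ p ∂(volume.restrict (Icc a b)).prod circ,
      Hm p - (gm p.2 - ∫ r in s..p.1, Nm (r, p.2)) = 0 := by
    rw [Measure.ae_prod_iff_ae_ae hS]
    filter_upwards [Measure.ae_ae_of_ae_prod hHm, ae_restrict_mem measurableSet_Icc] with t ht ht'
    filter_upwards [ht, ae_circ_of_ae (h t ht'), hint, hg.ae_eq_mk] with y h1 h2 h3 h4
    have h1' : H t (y - c * t) = Hm (t, y) := h1
    rw [← h1', h2, h3 t ht', show g y = gm y from h4, sub_self]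
  filter_upwards [swap hall, swap hHm, hint, hg.ae_eq_mk] with y h1 h2 h3 h4
  filter_upwards [h1, h2, ae_restrict_mem measurableSet_Icc] with t h5 h6 ht
  have h6' : H t (y - c * t) = Hm (t, y) := h6
  rw [h6', h3 t ht, h4]
  exact sub_eq_zero.1 h5

/-- The null form: no product of two null derivatives of the same family occurs. -/
theorem nonlin_eq {F φ φx φt : ℝ → ℝ → Amb k} {c : ℝ} (hc : c * c = 1) (t x : ℝ) :
    nonlin F φ φx φt t x =
      ⟪nullDer c φx φt t x, nullDer (-c) φx φt t x⟫ • φ t x + F t x := by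
  have : ⟪nullDer c φx φt t x, nullDer (-c) φx φt t x⟫ = ‖φt t x‖ ^ 2 - ‖φx t x‖ ^ 2 := by
    simp only [nullDer, inner_add_left, inner_add_right, real_inner_smul_left,
      real_inner_smul_right, real_inner_self_eq_norm_sq, real_inner_comm (φx t x)]
    linear_combination (-‖φx t x‖ ^ 2) * hc
  rw [nonlin, this]

theorem enorm_sq_eq_ofReal {E : Type*} [NormedAddCommGroup E] (v : E) :
    ‖v‖ₑ ^ 2 = ENNReal.ofReal (‖v‖ ^ 2) := by
  rw [ENNReal.ofReal_pow (norm_nonneg _), ofReal_norm]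

/-- The energy inequality along a single characteristic. -/
theorem IsSolution.enorm_nullDer_sq_le {F φ φx φt : ℝ → ℝ → Amb k}
    (h : IsSolution a b F φ φx φt) (hFs : Slab a b F)
    (hF : Integrable (fun p : ℝ × ℝ => F p.1 p.2) (cyl a b)) (hab : a < b)
    {c : ℝ} (hc : c * c = 1)
    (h0 : (0 : ℝ) ∈ Icc a b) {t : ℝ} (ht : t ∈ Icc a b) :
    ∀ᵐ y ∂circ, ‖nullDer c φx φt t (y - c * t)‖ₑ ^ 2 ≤ ‖nullDer c φx φt 0 y‖ₑ ^ 2 +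
      ∫⁻ r in uIoc 0 t, (‖nullDer c φx φt r (y - c * r)‖ₑ ^ 2 + ‖F r (y - c * r)‖ₑ ^ 2) := by
  have P := h.path
  have hNs := nonlin_slab P hFs
  have hNi := (nonlin_integrable P hF).2
  have heq : ∀ t ∈ Icc a b, ∀ᵐ y, nullDer c φx φt t (y - c * t) = nullDer c φx φt 0 y -
      ∫ r in (0)..t, nonlin F φ φx φt r (y - c * r) := by
    intro t ht
    have := h.nullDer_eq hFs hF hab hc h0 ht
    simpa using this
  -- The formula for the squared norm of a primitive needs the identity at almost all times of one
  -- fixed characteristic, whereas `heq` fixes the time first.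
  have hae := ae_ae_line_eq (P.nullDer_slab c) hNs h0 (P.nullDer_memLp c h0).1 heq
  -- The quadratic term is a multiple of `φ`, hence orthogonal to the null derivative: only the
  -- source does work.
  have hperp : ∀ᵐ p ∂cyl a b, ⟪nullDer c φx φt p.1 p.2, nonlin F φ φx φt p.1 p.2⟫ -
      ⟪nullDer c φx φt p.1 p.2, F p.1 p.2⟫ = 0 := by
    filter_upwards [P.inner_nullDer c] with p hp
    rw [nonlin_eq hc, inner_add_right, real_inner_smul_right, hp]
    ring
  have hinn : ∀ {G H : ℝ → ℝ → Amb k}, Slab a b G → Slab a b H →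
      Slab a b (fun t x => ⟪G t x, H t x⟫) := fun hG hH =>
    hG.comp₂ hH (f := fun v w : Amb k => ⟪v, w⟫) (by simp only [Function.uncurry_def]; fun_prop)
  have hline := ((hinn (P.nullDer_slab c) hNs).comp₂ (hinn (P.nullDer_slab c) hFs)
    (f := fun r s : ℝ => r - s) (by simp only [Function.uncurry_def]; fun_prop)).ae_line_of_ae
    hperp c
  filter_upwards [hae, ae_circ_of_ae (heq t ht), ae_circ_of_ae hline,
    ae_circ_of_ae (hNs.integrable_line hNi c)] with y h1 h2 h3 h4
  have hv : IntervalIntegrable (fun r => - nonlin F φ φx φt r (y - c * r)) volume 0 t :=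
    (intervalIntegrable_of_Icc h4 h0 ht).neg
  have h5 := norm_sq_primitive hv (nullDer c φx φt 0 y)
  simp only [intervalIntegral.integral_neg, ← sub_eq_add_neg] at h5
  rw [← h2] at h5
  have h6 : ∫ r in (0)..t, 2 * ⟪nullDer c φx φt 0 y -
      ∫ ρ in (0)..r, nonlin F φ φx φt ρ (y - c * ρ), - nonlin F φ φx φt r (y - c * r)⟫ =
      ∫ r in (0)..t, -(2 * ⟪nullDer c φx φt r (y - c * r), F r (y - c * r)⟫) := by
    apply intervalIntegral.integral_congr_ae
    rw [ae_restrict_iff' measurableSet_Icc] at h1 h3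
    filter_upwards [h1, h3] with r h7 h8 hr
    have hr' : r ∈ Icc a b := uIcc_subset_Icc h0 ht (uIoc_subset_uIcc hr)
    rw [← h7 hr', inner_neg_right, sub_eq_zero.1 (h8 hr')]
    ring
  rw [h6] at h5
  rw [enorm_sq_eq_ofReal, h5]
  refine ENNReal.ofReal_add_le.trans ?_
  rw [← enorm_sq_eq_ofReal]
  gcongr
  refine (Real.ofReal_le_enorm _).trans ((enorm_intervalIntegral_le _ _ _).trans ?_)
  gcongr with r
  rw [enorm_neg, ← ofReal_norm, enorm_sq_eq_ofReal, enorm_sq_eq_ofReal,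
    ← ENNReal.ofReal_add (by positivity) (by positivity)]
  apply ENNReal.ofReal_le_ofReal
  rw [norm_mul, Real.norm_ofNat]
  have := norm_inner_le_norm (𝕜 := ℝ) (nullDer c φx φt r (y - c * r)) (F r (y - c * r))
  nlinarith [sq_nonneg (‖nullDer c φx φt r (y - c * r)‖ - ‖F r (y - c * r)‖)]

end WaveMapS1

/-! ### Exponential weights, Grönwall's inequality and controlled solutions -/

namespace WaveMapS1

variable {k : ℕ} {a b : ℝ}

/-- The absorption step. Finiteness of `S` is essential, which is why qualitative bounds are
established beside the quantitative ones. -/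
theorem le_two_mul_of_le_add_half {S X : ℝ≥0∞} (hS : S ≠ ⊤) (h : S ≤ X + 2⁻¹ * S) :
    S ≤ 2 * X := by
  rcases eq_or_ne X ⊤ with rfl | hX
  · simp
  lift S to ℝ≥0 using hS
  lift X to ℝ≥0 using hX
  have h' : S ≤ X + 2⁻¹ * S := by
    rw [← ENNReal.coe_two, ← ENNReal.coe_inv two_ne_zero] at h
    exact_mod_cast h
  have : S ≤ 2 * X := by
    rw [← NNReal.coe_le_coe] at h' ⊢
    push_cast at h' ⊢
    linarith
  exact_mod_cast this

/-- The exponential weight `exp (-κ |t|)`. -/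
noncomputable def weight (κ t : ℝ) : ℝ≥0∞ := ENNReal.ofReal (Real.exp (-(κ * |t|)))

theorem measurable_weight (κ : ℝ) : Measurable (weight κ) := by
  unfold weight; fun_prop

theorem weight_ne_top (κ t : ℝ) : weight κ t ≠ ⊤ := ENNReal.ofReal_ne_top

theorem weight_ne_zero (κ t : ℝ) : weight κ t ≠ 0 := by
  simp [weight, Real.exp_pos]

theorem weight_le_one {κ : ℝ} (hκ : 0 ≤ κ) (t : ℝ) : weight κ t ≤ 1 := by
  rw [weight, ENNReal.ofReal_le_one, Real.exp_le_one_iff]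
  have := abs_nonneg t
  nlinarith

theorem weight_inv (κ t : ℝ) : (weight κ t)⁻¹ = weight (-κ) t := by
  rw [weight, weight, ← ENNReal.ofReal_inv_of_pos (Real.exp_pos _), ← Real.exp_neg]
  ring_nf

theorem weight_mul_weight (κ μ t : ℝ) : weight κ t * weight μ t = weight (κ + μ) t := by
  rw [weight, weight, weight, ← ENNReal.ofReal_mul (Real.exp_pos _).le, ← Real.exp_add]
  ring_nf

theorem one_le_weight_mul {κ T t : ℝ} (hκ : 0 ≤ κ) (ht : t ∈ Icc (-T) T) :
    1 ≤ ENNReal.ofReal (Real.exp (κ * T)) * weight κ t := by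
  rw [weight, ← ENNReal.ofReal_mul (Real.exp_pos _).le, ← Real.exp_add, ENNReal.one_le_ofReal,
    Real.one_le_exp_iff]
  have : |t| ≤ T := abs_le.2 ht
  nlinarith

/-- The origin of every gain `1 / κ`: integrating `e^{κ|r|}` up to `t` costs at most `e^{κ|t|} / κ`.
Negative times follow by reflection. -/
theorem lintegral_weight_le {κ : ℝ} (hκ : 0 < κ) (t : ℝ) :
    weight κ t * ∫⁻ r in uIoc 0 t, weight (-κ) r ≤ ENNReal.ofReal (1 / κ) := by
  have main : ∀ T, 0 ≤ T → weight κ T * ∫⁻ r in Ioc 0 T, weight (-κ) r ≤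
      ENNReal.ofReal (1 / κ) := by
    intro T hT
    have e1 : ∫⁻ r in Ioc 0 T, weight (-κ) r = ENNReal.ofReal (∫ r in (0)..T, Real.exp (κ * r)) := by
      rw [intervalIntegral.integral_of_le hT, ofReal_integral_eq_lintegral_ofReal]
      · apply setLIntegral_congr_fun measurableSet_Ioc
        intro r hr
        simp only [weight, abs_of_pos hr.1]
        ring_nf
      · exact ((Real.continuous_exp.comp (continuous_const.mul continuous_id)).integrableOn_Ioc)
      · exact ae_of_all _ fun r => (Real.exp_pos _).le
    rw [e1, weight, ← ENNReal.ofReal_mul (Real.exp_pos _).le]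
    apply ENNReal.ofReal_le_ofReal
    have e2 : ∫ r in (0)..T, Real.exp (κ * r) = (Real.exp (κ * T) - 1) / κ := by
      rw [intervalIntegral.integral_comp_mul_left (fun x => Real.exp x) hκ.ne', integral_exp]
      simp [div_eq_inv_mul]
    rw [e2, abs_of_nonneg hT, mul_div_assoc', div_le_div_iff_of_pos_right hκ, mul_sub,
      ← Real.exp_add]
    simp [Real.exp_nonneg]
  rcases le_total 0 t with ht | ht
  · rw [uIoc_of_le ht]
    exact main t ht
  · rw [uIoc_of_ge ht]
    have h1 := main (-t) (by linarith)
    have e1 : ∫⁻ r in Ioc t 0, weight (-κ) r = ∫⁻ r in Ioc 0 (-t), weight (-κ) r := by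
      have := (Measure.measurePreserving_neg (volume : Measure ℝ)).setLIntegral_comp_preimage_emb
        (measurableEmbedding_neg) (weight (-κ)) (Ioc t 0)
      rw [← this, ← restrict_Ico_eq_restrict_Ioc]
      have e2 : (Neg.neg ⁻¹' Ioc t 0 : Set ℝ) = Ico 0 (-t) := by
        ext x
        simp only [mem_preimage, mem_Ioc, mem_Ico]
        constructor <;> rintro ⟨h1, h2⟩ <;> constructor <;> linarith
      rw [e2]
      simp [weight]
    rw [e1]
    simpa [weight] using h1

/-- A Grönwall inequality without continuity. -/
theorem gronwall_lintegral {e : ℝ → ℝ≥0∞} {T : ℝ} {B X : ℝ≥0∞} (hB : B ≠ ⊤)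
    (he : ∀ t ∈ Icc (-T) T, e t ≤ B) {L : ℝ} (hL : 0 < L)
    (h : ∀ t ∈ Icc (-T) T, e t ≤ X + ENNReal.ofReal L * ∫⁻ r in uIoc 0 t, e r) :
    ∀ t ∈ Icc (-T) T, e t ≤ 2 * X * ENNReal.ofReal (Real.exp (2 * L * T)) := by
  -- This rate makes `L / κ = 1 / 2`, the factor that can be absorbed.
  set κ := 2 * L with hκ
  have hκ0 : 0 < κ := by positivity
  set S := ⨆ t ∈ Icc (-T) T, weight κ t * e t with hS
  have hle : ∀ t ∈ Icc (-T) T, weight κ t * e t ≤ S := fun t ht =>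
    le_iSup₂ (f := fun t (_ : t ∈ Icc (-T) T) => weight κ t * e t) t ht
  have hSB : S ≤ B := iSup₂_le fun t ht => by
    calc _ ≤ 1 * B := by
          gcongr
          exacts [weight_le_one hκ0.le t, he t ht]
      _ = B := one_mul _
  have hST : S ≠ ⊤ := ne_top_of_le_ne_top hB hSB
  have hbound : ∀ t ∈ Icc (-T) T, e t ≤ S * weight (-κ) t := fun t ht => by
    rw [← weight_inv, ← div_eq_mul_inv, ENNReal.le_div_iff_mul_le (Or.inl (weight_ne_zero _ _))
      (Or.inl (weight_ne_top _ _)), mul_comm]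
    exact hle t ht
  have hmain : S ≤ X + 2⁻¹ * S := by
    refine iSup₂_le fun t ht => ?_
    have h0 : (0 : ℝ) ∈ Icc (-T) T := ⟨by linarith [ht.1, ht.2], by linarith [ht.1, ht.2]⟩
    calc weight κ t * e t
        ≤ weight κ t * (X + ENNReal.ofReal L * ∫⁻ r in uIoc 0 t, S * weight (-κ) r) := by
          gcongr
          refine (h t ht).trans ?_
          gcongr X + ENNReal.ofReal L * ?_
          apply setLIntegral_mono' measurableSet_uIoc
          intro r hr
          exact hbound r (uIcc_subset_Icc h0 ht (uIoc_subset_uIcc hr))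
      _ = weight κ t * X + ENNReal.ofReal L * S *
            (weight κ t * ∫⁻ r in uIoc 0 t, weight (-κ) r) := by
          rw [lintegral_const_mul' _ _ hST]
          ring
      _ ≤ 1 * X + ENNReal.ofReal L * S * ENNReal.ofReal (1 / κ) := by
          gcongr
          exacts [weight_le_one hκ0.le t, lintegral_weight_le hκ0 t]
      _ = X + 2⁻¹ * S := by
          rw [one_mul, mul_right_comm, ← ENNReal.ofReal_mul hL.le]
          have : L * (1 / κ) = 2⁻¹ := by rw [hκ]; field_simp
          rw [this, ENNReal.ofReal_inv_of_pos (by norm_num)]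
          simp
  have hfin := le_two_mul_of_le_add_half hST hmain
  intro t ht
  calc e t = 1 * e t := (one_mul _).symm
    _ ≤ ENNReal.ofReal (Real.exp (κ * T)) * weight κ t * e t := by
        gcongr
        exact one_le_weight_mul hκ0.le ht
    _ = weight κ t * e t * ENNReal.ofReal (Real.exp (κ * T)) := by ring
    _ ≤ 2 * X * ENNReal.ofReal (Real.exp (κ * T)) := by
        exact mul_le_mul' ((hle t ht).trans hfin) le_rfl

theorem Slab.time_mul {H : ℝ → ℝ → ℝ≥0∞} (h : Slab a b H) {χ : ℝ → ℝ≥0∞} (hχ : Measurable χ) :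
    Slab a b (fun t x => χ t * H t x) :=
  ⟨((hχ.comp measurable_fst).aemeasurable.mul h.meas.aemeasurable).aestronglyMeasurable,
    fun t ht x => by simp only [h.per t ht x]⟩

/-- Writing the time interval as an indicator on the fixed slab lets the Tonelli statements for the
whole cylinder apply to any subinterval. -/
theorem lintegral_uIoc_eq {s t : ℝ} (hs : s ∈ Icc a b) (ht : t ∈ Icc a b) (f : ℝ → ℝ≥0∞) :
    ∫⁻ r in uIoc s t, f r = ∫⁻ r in Icc a b, (uIoc s t).indicator 1 r * f r := by
  have hsub : uIoc s t ⊆ Icc a b := uIoc_subset_uIcc.trans (uIcc_subset_Icc hs ht)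
  have e : ∀ r, (uIoc s t).indicator 1 r * f r = (uIoc s t).indicator f r := fun r => by
    by_cases hr : r ∈ uIoc s t <;> simp [hr]
  simp_rw [e]
  rw [lintegral_indicator measurableSet_uIoc, Measure.restrict_restrict measurableSet_uIoc,
    inter_eq_self_of_subset_left hsub]

theorem Slab.lintegral_uIoc {H : ℝ → ℝ → ℝ≥0∞} (h : Slab a b H) {s t : ℝ}
    (hs : s ∈ Icc a b) (ht : t ∈ Icc a b) :
    ∫⁻ r in uIoc s t, (∫⁻ x, H r x ∂circ) =
      ∫⁻ p, (uIoc s t).indicator 1 p.1 * H p.1 p.2 ∂cyl a b := by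
  have hχ : Measurable ((uIoc s t).indicator (1 : ℝ → ℝ≥0∞)) :=
    measurable_one.indicator measurableSet_uIoc
  rw [(h.time_mul hχ).lintegral_eq, lintegral_uIoc_eq hs ht]
  apply lintegral_congr
  intro r
  rw [lintegral_const_mul']
  by_cases hr : r ∈ uIoc s t <;> simp [hr]

theorem Slab.lintegral_line_uIoc {H : ℝ → ℝ → ℝ≥0∞} (h : Slab a b H) (c : ℝ) {s t : ℝ}
    (hs : s ∈ Icc a b) (ht : t ∈ Icc a b) :
    ∫⁻ y, (∫⁻ r in uIoc s t, H r (y - c * r)) ∂circ =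
      ∫⁻ p, (uIoc s t).indicator 1 p.1 * H p.1 p.2 ∂cyl a b := by
  have hχ : Measurable ((uIoc s t).indicator (1 : ℝ → ℝ≥0∞)) :=
    measurable_one.indicator measurableSet_uIoc
  have h1 := (h.time_mul hχ).lintegral_shear c
  simp only [lintegral_uIoc_eq hs ht]
  exact h1

/-- A solution whose initial energy and source are controlled by `M`; the source may contain a
term of size `K |φ_t|`. -/
structure IsControlled (T : ℝ) (M K : ℝ≥0) (f F φ φx φt : ℝ → ℝ → Amb k) : Prop where
  sol : IsSolution (-T) T F φ φx φt
  slab : Slab (-T) T F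
  slab' : Slab (-T) T f
  bound : ∀ᵐ p ∂cyl (-T) T, ‖F p.1 p.2‖ₑ ^ 2 ≤
    2 * (‖f p.1 p.2‖ₑ ^ 2 + (K : ℝ≥0∞) ^ 2 * ‖φt p.1 p.2‖ₑ ^ 2)
  source : ∫⁻ p, ‖f p.1 p.2‖ₑ ^ 2 ∂cyl (-T) T ≤ (M : ℝ≥0∞) ^ 2
  init : (∫⁻ x, ‖φt 0 x‖ₑ ^ 2 ∂circ) + ∫⁻ x, ‖φx 0 x‖ₑ ^ 2 ∂circ ≤ (M : ℝ≥0∞) ^ 2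

end WaveMapS1

/-! ### Energy bound and null majorants for one solution -/

namespace WaveMapS1

variable {k : ℕ} {a b : ℝ}

/-- The parallelogram law; both null derivatives together carry exactly twice the energy density. -/
theorem enorm_nullDer_sq_add {c : ℝ} (hc : c * c = 1) (φx φt : ℝ → ℝ → Amb k) (t x : ℝ) :
    ‖nullDer c φx φt t x‖ₑ ^ 2 + ‖nullDer (-c) φx φt t x‖ₑ ^ 2 =
      2 * (‖φt t x‖ₑ ^ 2 + ‖φx t x‖ₑ ^ 2) := by
  have h := parallelogram_law_with_norm ℝ (φt t x) (c • φx t x)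
  have hn : ‖c • φx t x‖ ^ 2 = ‖φx t x‖ ^ 2 := by
    rw [norm_smul, mul_pow, Real.norm_eq_abs, sq_abs, sq c, hc, one_mul]
  rw [hn] at h
  simp only [enorm_sq_eq_ofReal]
  rw [← ENNReal.ofReal_add (by positivity) (by positivity),
    ← ENNReal.ofReal_add (by positivity) (by positivity), two_mul,
    ← ENNReal.ofReal_add (by positivity) (by positivity)]
  congr 1
  simp only [nullDer, neg_smul, ← sub_eq_add_neg]
  linarith

theorem enorm_timeDer_sq_le {c : ℝ} (hc : c * c = 1) (φx φt : ℝ → ℝ → Amb k) (t x : ℝ) :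
    ‖φt t x‖ₑ ^ 2 ≤ ‖nullDer c φx φt t x‖ₑ ^ 2 + ‖nullDer (-c) φx φt t x‖ₑ ^ 2 := by
  rw [enorm_nullDer_sq_add hc, two_mul]
  exact le_self_add.trans le_self_add

theorem enorm_spaceDer_sq_le {c : ℝ} (hc : c * c = 1) (φx φt : ℝ → ℝ → Amb k) (t x : ℝ) :
    ‖φx t x‖ₑ ^ 2 ≤ ‖nullDer c φx φt t x‖ₑ ^ 2 + ‖nullDer (-c) φx φt t x‖ₑ ^ 2 := by
  rw [enorm_nullDer_sq_add hc, two_mul, add_comm (‖φt t x‖ₑ ^ 2)]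
  exact le_self_add.trans le_self_add

theorem IsEnergyPath.nullDer_sq_slab {φ φx φt : ℝ → ℝ → Amb k} (h : IsEnergyPath a b φ φx φt)
    (c : ℝ) : Slab a b (fun t x => ‖nullDer c φx φt t x‖ₑ ^ 2) :=
  (h.nullDer_slab c).enorm.comp (f := fun z : ℝ≥0∞ => z ^ 2) (by fun_prop)

theorem Slab.enorm_sq {E : Type*} [NormedAddCommGroup E] {H : ℝ → ℝ → E} (h : Slab a b H) :
    Slab a b (fun t x => ‖H t x‖ₑ ^ 2) :=
  h.enorm.comp (f := fun z : ℝ≥0∞ => z ^ 2) (by fun_prop)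

theorem Slab.add {H H' : ℝ → ℝ → ℝ≥0∞} (h : Slab a b H) (h' : Slab a b H') :
    Slab a b (fun t x => H t x + H' t x) :=
  h.comp₂ h' (f := fun y z : ℝ≥0∞ => y + z) (by simp only [Function.uncurry_def]; fun_prop)

theorem Slab.aemeasurable {H : ℝ → ℝ → ℝ≥0∞} (h : Slab a b H) :
    AEMeasurable (fun p : ℝ × ℝ => H p.1 p.2) (cyl a b) := h.meas.aemeasurable

variable {T : ℝ} {M K : ℝ≥0} {f F φ φx φt : ℝ → ℝ → Amb k}

/-- The total energy at time `t`, in null components. -/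
noncomputable def nullEnergy (c : ℝ) (φx φt : ℝ → ℝ → Amb k) (t : ℝ) : ℝ≥0∞ :=
  (∫⁻ x, ‖nullDer c φx φt t x‖ₑ ^ 2 ∂circ) + ∫⁻ x, ‖nullDer (-c) φx φt t x‖ₑ ^ 2 ∂circ

theorem IsEnergyPath.aemeasurable_nullDer (h : IsEnergyPath a b φ φx φt) (c : ℝ) {t : ℝ}
    (ht : t ∈ Icc a b) : AEMeasurable (fun x => ‖nullDer c φx φt t x‖ₑ ^ 2) circ :=
  (h.nullDer_memLp c ht).1.enorm.pow_const 2

theorem IsEnergyPath.nullEnergy_eq (h : IsEnergyPath a b φ φx φt) {c : ℝ} (hc : c * c = 1) {t : ℝ}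
    (ht : t ∈ Icc a b) : nullEnergy c φx φt t =
      2 * ((∫⁻ x, ‖φt t x‖ₑ ^ 2 ∂circ) + ∫⁻ x, ‖φx t x‖ₑ ^ 2 ∂circ) := by
  rw [nullEnergy, ← lintegral_add_left' (h.aemeasurable_nullDer c ht),
    ← lintegral_add_left' ((h.cont_t.memLp t ht).1.enorm.pow_const 2),
    ← lintegral_const_mul' _ _ (by norm_num)]
  simp only [enorm_nullDer_sq_add hc]

theorem lintegral_circ_shear {g : ℝ → ℝ → Amb k} {t : ℝ} (hp : Function.Periodic (g t) period)
    (d : ℝ) : ∫⁻ y, ‖g t (y - d)‖ₑ ^ 2 ∂circ = ∫⁻ x, ‖g t x‖ₑ ^ 2 ∂circ :=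
  lintegral_circ_sub (g := fun x => ‖g t x‖ₑ ^ 2) (fun x => by simp only [hp x]) d

theorem IsControlled.integrable (h : IsControlled T M K f F φ φx φt) :
    MemLp (fun p : ℝ × ℝ => F p.1 p.2) 2 (cyl (-T) T) := by
  refine memLp_two_of_lintegral h.slab.meas ((lintegral_mono_ae h.bound).trans_lt ?_)
  rw [lintegral_const_mul' _ _ (by norm_num), lintegral_add_left' h.slab'.enorm_sq.aemeasurable,
    lintegral_const_mul' _ _ (by finiteness)]
  have h1 := h.source.trans_lt (show (M : ℝ≥0∞) ^ 2 < ⊤ by finiteness)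
  have h2 := h.sol.path.cont_t.lintegral_lt_top
  finiteness

/-- The growth rate of the energy. -/
noncomputable def growthRate (K : ℝ≥0) : ℝ := 1 + 4 * K ^ 2

/-- The bound for the energy. -/
noncomputable def energyBound (T : ℝ) (M K : ℝ≥0) : ℝ≥0∞ :=
  2 * (6 * (M : ℝ≥0∞) ^ 2) * ENNReal.ofReal (Real.exp (2 * growthRate K * T))

/-- The two characteristic inequalities have to be added before Grönwall can be applied: a damping
term involves `φ_t`, hence both null derivatives. The coefficient `4 K²` in `growthRate` arises here
as `2 · 2 K²`. -/
theorem IsControlled.sum_bound (h : IsControlled T M K f F φ φx φt) {c : ℝ} (hc : c * c = 1) :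
    ∀ᵐ p ∂cyl (-T) T, (‖nullDer c φx φt p.1 p.2‖ₑ ^ 2 + ‖F p.1 p.2‖ₑ ^ 2) +
      (‖nullDer (-c) φx φt p.1 p.2‖ₑ ^ 2 + ‖F p.1 p.2‖ₑ ^ 2) ≤
      4 * ‖f p.1 p.2‖ₑ ^ 2 + ENNReal.ofReal (growthRate K) *
        (‖nullDer c φx φt p.1 p.2‖ₑ ^ 2 + ‖nullDer (-c) φx φt p.1 p.2‖ₑ ^ 2) := by
  have hL : ENNReal.ofReal (growthRate K) = 1 + 4 * (K : ℝ≥0∞) ^ 2 := by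
    rw [growthRate, ENNReal.ofReal_add (by norm_num) (by positivity),
      ENNReal.ofReal_mul (by norm_num), ENNReal.ofReal_pow (by positivity)]
    simp
  filter_upwards [h.bound] with p hp
  have h1 := enorm_timeDer_sq_le hc φx φt p.1 p.2
  rw [hL]
  generalize ‖nullDer c φx φt p.1 p.2‖ₑ ^ 2 = P at *
  generalize ‖nullDer (-c) φx φt p.1 p.2‖ₑ ^ 2 = Q at *
  calc (P + ‖F p.1 p.2‖ₑ ^ 2) + (Q + ‖F p.1 p.2‖ₑ ^ 2)
      = P + Q + 2 * ‖F p.1 p.2‖ₑ ^ 2 := by ring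
    _ ≤ P + Q + 2 * (2 * (‖f p.1 p.2‖ₑ ^ 2 + (K : ℝ≥0∞) ^ 2 * (P + Q))) := by
        gcongr
        refine hp.trans ?_
        gcongr
    _ = _ := by ring

/-- The characteristic inequalities for `c` and `-c` are integrated over the circle and fed to
Grönwall. The initial energy contributes `2 M²` and the source `4 M²`, together the `6 M²` of
`energyBound`. `Ct` and `Cx` only certify finiteness and do not enter the bound. -/
theorem IsControlled.energy_le (h : IsControlled T M K f F φ φx φt) (hT : 0 < T) {c : ℝ}
    (hc : c * c = 1) : ∀ t ∈ Icc (-T) T, nullEnergy c φx φt t ≤ energyBound T M K := by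
  have hab : -T < T := by linarith
  have h0 : (0 : ℝ) ∈ Icc (-T) T := ⟨by linarith, hT.le⟩
  have P := h.sol.path
  have hL : 0 < growthRate K := by unfold growthRate; positivity
  have hFi := h.integrable.integrable (by norm_num)
  obtain ⟨Ct, hCt, hCt'⟩ := P.cont_t.exists_bound
  obtain ⟨Cx, hCx, hCx'⟩ := P.cont_x.exists_bound
  refine gronwall_lintegral (B := 2 * (Ct ^ 2 + Cx ^ 2)) (by finiteness) (fun t ht => ?_) hL
    (fun t ht => ?_)
  · rw [P.nullEnergy_eq hc ht, ← eLpNorm_two_sq, ← eLpNorm_two_sq]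
    gcongr
    exacts [hCt' t ht, hCx' t ht]
  · set χ : ℝ → ℝ≥0∞ := (uIoc 0 t).indicator 1 with hχ
    have hχm : Measurable χ := measurable_one.indicator measurableSet_uIoc
    have hχ1 : ∀ r, χ r ≤ 1 := fun r => by
      by_cases hr : r ∈ uIoc 0 t <;> simp [hχ, hr]
    have one : ∀ {d : ℝ}, d * d = 1 → ∫⁻ x, ‖nullDer d φx φt t x‖ₑ ^ 2 ∂circ ≤
        (∫⁻ x, ‖nullDer d φx φt 0 x‖ₑ ^ 2 ∂circ) +
        ∫⁻ p, χ p.1 * (‖nullDer d φx φt p.1 p.2‖ₑ ^ 2 + ‖F p.1 p.2‖ₑ ^ 2) ∂cyl (-T) T := by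
      intro d hd
      have h1 := h.sol.enorm_nullDer_sq_le h.slab hFi hab hd h0 ht
      rw [← lintegral_circ_shear ((P.nullDer_slab d).per t ht) (d * t),
        ← ((P.nullDer_sq_slab d).add h.slab.enorm_sq).lintegral_line_uIoc d h0 ht,
        ← lintegral_add_left' (P.aemeasurable_nullDer d h0)]
      exact lintegral_mono_ae h1
    have hs1 := ((P.nullDer_sq_slab c).add h.slab.enorm_sq).time_mul hχm
    have hs2 := ((P.nullDer_sq_slab c).add (P.nullDer_sq_slab (-c))).time_mul hχm
    calc nullEnergy c φx φt t
        ≤ nullEnergy c φx φt 0 + ∫⁻ p, χ p.1 * ((‖nullDer c φx φt p.1 p.2‖ₑ ^ 2 +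
            ‖F p.1 p.2‖ₑ ^ 2) + (‖nullDer (-c) φx φt p.1 p.2‖ₑ ^ 2 +
            ‖F p.1 p.2‖ₑ ^ 2)) ∂cyl (-T) T := by
          simp only [mul_add (χ _) (_ + _) (_ + _)]
          rw [lintegral_add_left' hs1.aemeasurable, nullEnergy, nullEnergy]
          refine (add_le_add (one hc) (one (d := -c) (by simpa using hc))).trans_eq ?_
          abel
      _ ≤ nullEnergy c φx φt 0 + ∫⁻ p, (4 * ‖f p.1 p.2‖ₑ ^ 2 + ENNReal.ofReal (growthRate K) *
            (χ p.1 * (‖nullDer c φx φt p.1 p.2‖ₑ ^ 2 +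
              ‖nullDer (-c) φx φt p.1 p.2‖ₑ ^ 2))) ∂cyl (-T) T := by
          gcongr 1
          apply lintegral_mono_ae
          filter_upwards [h.sum_bound hc] with p hp
          calc _ ≤ χ p.1 * _ := mul_le_mul' le_rfl hp
            _ = χ p.1 * (4 * ‖f p.1 p.2‖ₑ ^ 2) + ENNReal.ofReal (growthRate K) *
                (χ p.1 * (‖nullDer c φx φt p.1 p.2‖ₑ ^ 2 +
                  ‖nullDer (-c) φx φt p.1 p.2‖ₑ ^ 2)) := by ring
            _ ≤ _ := by
                gcongr ?_ + _
                exact (mul_le_mul' (hχ1 _) le_rfl).trans_eq (one_mul _)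
      _ = nullEnergy c φx φt 0 + (4 * ∫⁻ p, ‖f p.1 p.2‖ₑ ^ 2 ∂cyl (-T) T) +
            ENNReal.ofReal (growthRate K) * ∫⁻ r in uIoc 0 t, nullEnergy c φx φt r := by
          have e : ∫⁻ r in uIoc 0 t, nullEnergy c φx φt r =
              ∫⁻ r in uIoc 0 t, ∫⁻ x, (‖nullDer c φx φt r x‖ₑ ^ 2 +
                ‖nullDer (-c) φx φt r x‖ₑ ^ 2) ∂circ := by
            apply setLIntegral_congr_fun measurableSet_uIoc
            intro r hr
            have hr' := uIcc_subset_Icc h0 ht (uIoc_subset_uIcc hr)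
            simp only [nullEnergy]
            rw [← lintegral_add_left' (P.aemeasurable_nullDer c hr')]
          rw [e, ((P.nullDer_sq_slab c).add (P.nullDer_sq_slab (-c))).lintegral_uIoc h0 ht,
            lintegral_add_left' (h.slab'.enorm_sq.aemeasurable.const_mul 4),
            lintegral_const_mul' _ _ (by norm_num), lintegral_const_mul' _ _ (by finiteness),
            add_assoc]
      _ ≤ 2 * (M : ℝ≥0∞) ^ 2 + 4 * (M : ℝ≥0∞) ^ 2 +
            ENNReal.ofReal (growthRate K) * ∫⁻ r in uIoc 0 t, nullEnergy c φx φt r := by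
          rw [P.nullEnergy_eq hc h0]
          gcongr
          exacts [h.init, h.source]
      _ = _ := by ring

/-- The bound for the square integral of the null majorants. -/
noncomputable def majorantBound (T : ℝ) (M K : ℝ≥0) : ℝ≥0∞ :=
  energyBound T M K + (4 * (M : ℝ≥0∞) ^ 2 +
    ENNReal.ofReal (growthRate K) * (energyBound T M K * ENNReal.ofReal (2 * T)))

theorem majorantBound_ne_top (T : ℝ) (M K : ℝ≥0) : majorantBound T M K ≠ ⊤ := by
  unfold majorantBound energyBound; finiteness

/-- The null derivative `φ_t + c φ_x` of a solution is bounded by a square integrable function of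
`x + c t` alone. -/
theorem IsControlled.exists_majorant (h : IsControlled T M K f F φ φx φt) (hT : 0 < T) {c : ℝ}
    (hc : c * c = 1) : ∃ A : ℝ → ℝ≥0∞, AEMeasurable A ∧ Function.Periodic A period ∧
      ∫⁻ x, A x ∂circ ≤ majorantBound T M K ∧
      ∀ t ∈ Icc (-T) T, ∀ᵐ x, ‖nullDer c φx φt t x‖ₑ ^ 2 ≤ A (x + c * t) := by
  have hab : -T < T := by linarith
  have h0 : (0 : ℝ) ∈ Icc (-T) T := ⟨by linarith, hT.le⟩
  have P := h.sol.path
  have hFi := h.integrable.integrable (by norm_num)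
  have hp0 := (P.nullDer_slab c).per 0 h0
  have hsl := (P.nullDer_sq_slab c).add h.slab.enorm_sq
  -- Integrating over the whole time interval makes the bound independent of `t`, so that a single
  -- function of `y` serves all times.
  set A : ℝ → ℝ≥0∞ := fun y => ‖nullDer c φx φt 0 y‖ₑ ^ 2 +
    ∫⁻ r in Icc (-T) T, (‖nullDer c φx φt r (y - c * r)‖ₑ ^ 2 + ‖F r (y - c * r)‖ₑ ^ 2) with hA
  have hAp : Function.Periodic A period := by
    intro y
    simp only [hA, hp0 y]
    congr 1
    apply setLIntegral_congr_fun measurableSet_Icc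
    intro r hr
    have := hsl.per r hr (y - c * r)
    simp only at this ⊢
    rw [add_sub_right_comm, this]
  refine ⟨A, ?_, hAp, ?_, fun t ht => ?_⟩
  · refine ((aestronglyMeasurable_of_circ (P.nullDer_memLp c h0).1 hp0).enorm.pow_const 2).add ?_
    exact (hsl.shear c).aemeasurable.lintegral_prod_left'
  · rw [hA, lintegral_add_left' (P.aemeasurable_nullDer c h0), hsl.lintegral_shear c, majorantBound]
    gcongr ?_ + ?_
    · exact le_self_add.trans (h.energy_le hT hc 0 h0)
    · calc ∫⁻ p, (‖nullDer c φx φt p.1 p.2‖ₑ ^ 2 + ‖F p.1 p.2‖ₑ ^ 2) ∂cyl (-T) T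
          ≤ ∫⁻ p, (4 * ‖f p.1 p.2‖ₑ ^ 2 + ENNReal.ofReal (growthRate K) *
            (‖nullDer c φx φt p.1 p.2‖ₑ ^ 2 +
              ‖nullDer (-c) φx φt p.1 p.2‖ₑ ^ 2)) ∂cyl (-T) T := by
            apply lintegral_mono_ae
            filter_upwards [h.sum_bound hc] with p hp
            exact le_self_add.trans hp
        _ = (4 * ∫⁻ p, ‖f p.1 p.2‖ₑ ^ 2 ∂cyl (-T) T) + ENNReal.ofReal (growthRate K) *
              ∫⁻ r in Icc (-T) T, nullEnergy c φx φt r := by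
            have e : ∫⁻ r in Icc (-T) T, nullEnergy c φx φt r =
                ∫⁻ r in Icc (-T) T, ∫⁻ x, (‖nullDer c φx φt r x‖ₑ ^ 2 +
                  ‖nullDer (-c) φx φt r x‖ₑ ^ 2) ∂circ := by
              apply setLIntegral_congr_fun measurableSet_Icc
              intro r hr
              simp only [nullEnergy]
              rw [← lintegral_add_left' (P.aemeasurable_nullDer c hr)]
            rw [e, ← ((P.nullDer_sq_slab c).add (P.nullDer_sq_slab (-c))).lintegral_eq,
              lintegral_add_left' (h.slab'.enorm_sq.aemeasurable.const_mul 4),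
              lintegral_const_mul' _ _ (by norm_num), lintegral_const_mul' _ _ (by finiteness)]
        _ ≤ 4 * (M : ℝ≥0∞) ^ 2 + ENNReal.ofReal (growthRate K) *
              ∫⁻ r in Icc (-T) T, energyBound T M K := by
            gcongr ?_ + _ * ?_
            · gcongr
              exact h.source
            · exact setLIntegral_mono' measurableSet_Icc fun r hr => h.energy_le hT hc r hr
        _ = _ := by
            rw [lintegral_const]
            simp [two_mul]
  · have h1 : ∀ᵐ y, ‖nullDer c φx φt t (y - c * t)‖ₑ ^ 2 ≤ A y := by
      refine ae_of_ae_circ (fun y => ?_) ?_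
      · rw [hAp y, add_sub_right_comm, (P.nullDer_slab c).per t ht]
      filter_upwards [h.sol.enorm_nullDer_sq_le h.slab hFi hab hc h0 ht] with y hy
      refine hy.trans ?_
      simp only [hA]
      gcongr
      exact uIoc_subset_uIcc.trans (uIcc_subset_Icc h0 ht)
    filter_upwards [ae_add h1 (c * t)] with x hx
    simpa using hx

end WaveMapS1

/-! ### Bilinear estimate, weighted majorants and the null structure of differences -/

namespace WaveMapS1

variable {k : ℕ} {a b : ℝ}

theorem Slab.of_fun {g : ℝ → ℝ≥0∞} (hg : AEMeasurable g) (hp : Function.Periodic g period) :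
    Slab a b (fun _ x => g x) :=
  ⟨(hg.restrict (s := Ioc 0 period)).comp_snd.aestronglyMeasurable, fun _ _ => hp⟩

theorem Slab.mul {H H' : ℝ → ℝ → ℝ≥0∞} (h : Slab a b H) (h' : Slab a b H') :
    Slab a b (fun t x => H t x * H' t x) :=
  ⟨(h.meas.aemeasurable.mul h'.meas.aemeasurable).aestronglyMeasurable,
    fun t ht x => by simp only [h.per t ht x, h'.per t ht x]⟩

/-- The bilinear estimate for products of functions of the two null coordinates. -/
theorem lintegral_mul_null_le {g h : ℝ → ℝ≥0∞} (hgm : AEMeasurable g) (hhm : AEMeasurable h)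
    (hg : Function.Periodic g period) (hh : Function.Periodic h period) (T : ℝ)
    {c : ℝ} (hc : c = 1 ∨ c = -1) :
    ∫⁻ r in Icc (-T) T, ∫⁻ x, g (x + c * r) * h (x - c * r) ∂circ
      ≤ covering (4 * T) * ((∫⁻ x, g x ∂circ) * ∫⁻ x, h x ∂circ) := by
  have hs : Slab (-T) T (fun _ x => h x) := Slab.of_fun hhm hh
  -- Shifting each slice by `c * r` freezes `g`, while `h` then travels at speed `2 c`; integrating
  -- in time first leaves a bounded number of periods of `h`.
  calc ∫⁻ r in Icc (-T) T, ∫⁻ x, g (x + c * r) * h (x - c * r) ∂circ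
      = ∫⁻ r in Icc (-T) T, ∫⁻ y, g y * h (y - (2 * c) * r) ∂circ := by
        apply lintegral_congr
        intro r
        have : Function.Periodic (fun y => g y * h (y - (2 * c) * r)) period := by
          intro y
          simp only [hg y]
          rw [add_sub_right_comm, hh]
        rw [← lintegral_circ_add this (c * r)]
        apply lintegral_congr
        intro x
        ring_nf
    _ = ∫⁻ y, (∫⁻ r in Icc (-T) T, g y * h (y - (2 * c) * r)) ∂circ := by
        rw [lintegral_lintegral_swap]
        exact (hgm.restrict (s := Ioc 0 period)).comp_snd.mul (hs.shear_circ (2 * c)).aemeasurable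
    _ = ∫⁻ y, g y * (∫⁻ r in Icc (-T) T, h (y - (2 * c) * r)) ∂circ := by
        apply lintegral_congr_ae
        filter_upwards [ae_circ_of_ae (hs.line (2 * c))] with y hy
        rw [lintegral_const_mul'' _ hy.aemeasurable]
    _ ≤ ∫⁻ y, g y * (covering (4 * T) * ∫⁻ x, h x ∂circ) ∂circ := by
        gcongr with y
        have := lintegral_comp_add_mul_le h hh (T := T) (c := -(2 * c))
          (by rcases hc with rfl | rfl <;> norm_num) y
        simpa only [neg_mul, ← sub_eq_add_neg] using this
    _ = _ := by
        rw [lintegral_mul_const'' _ (show AEMeasurable g circ from hgm.restrict)]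
        ring

/-- The Cauchy-Schwarz inequality with an exponential weight. -/
theorem weight_mul_lintegral_sq_le {T κ : ℝ} (hκ : 0 < κ) {g : ℝ → ℝ≥0∞}
    (hg : AEMeasurable g (volume.restrict (Icc (-T) T))) {t : ℝ} (ht : t ∈ Icc (-T) T) :
    weight κ t * (∫⁻ r in uIoc 0 t, g r) ^ 2 ≤
      ENNReal.ofReal (1 / κ) * ∫⁻ r in Icc (-T) T, weight κ r * g r ^ 2 := by
  have h0 : (0 : ℝ) ∈ Icc (-T) T := ⟨by linarith [ht.1, ht.2], by linarith [ht.1, ht.2]⟩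
  have hsub : uIoc 0 t ⊆ Icc (-T) T := uIoc_subset_uIcc.trans (uIcc_subset_Icc h0 ht)
  have hg' : AEMeasurable g (volume.restrict (uIoc 0 t)) := hg.mono_set hsub
  have hm : ∀ μ, Measurable (weight μ) := measurable_weight
  -- The integrand is split as `e^{κ|r|/2}` times `e^{-κ|r|/2} g`; squared, the first factor yields
  -- the gain and the second the weighted norm.
  have hCS := ENNReal.lintegral_mul_le_Lp_mul_Lq (volume.restrict (uIoc 0 t))
    Real.HolderConjugate.two_two (f := weight (-κ / 2)) (g := fun r => weight (κ / 2) r * g r)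
    (hm _).aemeasurable ((hm _).aemeasurable.mul hg')
  have e1 : ∀ r, (weight (-κ / 2) * fun r => weight (κ / 2) r * g r) r = g r := by
    intro r
    rw [Pi.mul_apply, ← mul_assoc, weight_mul_weight]
    have : -κ / 2 + κ / 2 = 0 := by ring
    simp [this, weight]
  have e2 : ∀ r, weight (-κ / 2) r ^ (2 : ℝ) = weight (-κ) r := by
    intro r
    rw [ENNReal.rpow_ofNat, sq, weight_mul_weight]
    ring_nf
  have e3 : ∀ r, (weight (κ / 2) r * g r) ^ (2 : ℝ) = weight κ r * g r ^ 2 := by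
    intro r
    rw [ENNReal.rpow_ofNat, mul_pow, sq (weight _ _), weight_mul_weight]
    ring_nf
  simp only [e1, e2, e3] at hCS
  calc weight κ t * (∫⁻ r in uIoc 0 t, g r) ^ 2
      ≤ weight κ t * ((∫⁻ r in uIoc 0 t, weight (-κ) r) *
          ∫⁻ r in uIoc 0 t, weight κ r * g r ^ 2) := by
        gcongr
        calc _ ≤ _ := pow_le_pow_left₀ (by simp) hCS 2
          _ = _ := by
            rw [mul_pow, ← ENNReal.rpow_natCast, ← ENNReal.rpow_mul, ← ENNReal.rpow_natCast,
              ← ENNReal.rpow_mul]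
            norm_num
    _ = (weight κ t * ∫⁻ r in uIoc 0 t, weight (-κ) r) *
          ∫⁻ r in uIoc 0 t, weight κ r * g r ^ 2 := by ring
    _ ≤ _ := by
        gcongr
        exact lintegral_weight_le hκ t

variable {T : ℝ}

/-- The weighted majorant on the characteristic `x + c t = y` of a function with value `g` at time
`0` and derivative `G`. -/
noncomputable def lineMajorant (T κ c : ℝ) (g : ℝ → Amb k) (G : ℝ → ℝ → Amb k) (y : ℝ) : ℝ≥0∞ :=
  2 * ‖g y‖ₑ ^ 2 + 2 * (ENNReal.ofReal (1 / κ) *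
    ∫⁻ r in Icc (-T) T, weight κ r * ‖G r (y - c * r)‖ₑ ^ 2)

section lineMajorant

variable {κ c : ℝ} {g : ℝ → Amb k} {G H : ℝ → ℝ → Amb k}

theorem lineMajorant_periodic (hg : Function.Periodic g period) (hG : Slab (-T) T G) :
    Function.Periodic (lineMajorant T κ c g G) period := by
  intro y
  simp only [lineMajorant, hg y]
  congr 3
  apply setLIntegral_congr_fun measurableSet_Icc
  intro r hr
  simp only
  rw [add_sub_right_comm, hG.per r hr]

theorem aemeasurable_lineMajorant (hg : Function.Periodic g period)
    (hgm : AEStronglyMeasurable g circ) (hG : Slab (-T) T G) :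
    AEMeasurable (lineMajorant T κ c g G) := by
  refine (((aestronglyMeasurable_of_circ hgm hg).enorm.pow_const 2).const_mul 2).add ?_
  refine (AEMeasurable.const_mul ?_ _).const_mul _
  exact ((hG.enorm_sq.time_mul (measurable_weight κ)).shear c).aemeasurable.lintegral_prod_left'

theorem lintegral_lineMajorant (hgm : AEStronglyMeasurable g circ) (hG : Slab (-T) T G) :
    ∫⁻ y, lineMajorant T κ c g G y ∂circ = 2 * (∫⁻ y, ‖g y‖ₑ ^ 2 ∂circ) +
      2 * (ENNReal.ofReal (1 / κ) *
        ∫⁻ p, weight κ p.1 * ‖G p.1 p.2‖ₑ ^ 2 ∂cyl (-T) T) := by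
  simp only [lineMajorant]
  rw [lintegral_add_left' ((hgm.enorm.pow_const 2).const_mul 2),
    lintegral_const_mul' _ _ (by norm_num), lintegral_const_mul' _ _ (by norm_num),
    lintegral_const_mul' _ _ (by norm_num),
    (hG.enorm_sq.time_mul (measurable_weight κ)).lintegral_shear c]

/-- `(a + b)² ≤ 2a² + 2b²` separates the value at time 0 from the integral; the first merely loses
its weight, the second gains `1 / κ` by Cauchy-Schwarz. -/
theorem weight_mul_le_lineMajorant (hκ : 0 < κ) (hG : Slab (-T) T G)
    {t : ℝ} (ht : t ∈ Icc (-T) T)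
    (h : ∀ᵐ y, H t (y - c * t) = g y - ∫ r in (0)..t, G r (y - c * r)) :
    ∀ᵐ x, weight κ t * ‖H t x‖ₑ ^ 2 ≤ lineMajorant T κ c g G (x + c * t) := by
  have h1 : ∀ᵐ y, weight κ t * ‖H t (y - c * t)‖ₑ ^ 2 ≤ lineMajorant T κ c g G y := by
    filter_upwards [h, hG.line c] with y hy hm
    have hm' := weight_mul_lintegral_sq_le hκ hm.enorm ht
    calc weight κ t * ‖H t (y - c * t)‖ₑ ^ 2
        ≤ weight κ t * (2 * (‖g y‖ₑ ^ 2 + (∫⁻ r in uIoc 0 t, ‖G r (y - c * r)‖ₑ) ^ 2)) := by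
          gcongr
          refine le_trans ?_ (add_sq_le_two_mul _ _)
          gcongr
          rw [hy]
          refine enorm_sub_le.trans ?_
          gcongr
          exact enorm_intervalIntegral_le _ _ _
      _ = 2 * (weight κ t * ‖g y‖ₑ ^ 2) +
            2 * (weight κ t * (∫⁻ r in uIoc 0 t, ‖G r (y - c * r)‖ₑ) ^ 2) := by ring
      _ ≤ 2 * (1 * ‖g y‖ₑ ^ 2) + 2 * (ENNReal.ofReal (1 / κ) *
            ∫⁻ r in Icc (-T) T, weight κ r * ‖G r (y - c * r)‖ₑ ^ 2) := by
          gcongr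
          exact weight_le_one hκ.le t
      _ = _ := by rw [one_mul, lineMajorant]
  filter_upwards [ae_add h1 (c * t)] with x hx
  simpa using hx

end lineMajorant

theorem add_six_sq_le (x₁ x₂ x₃ x₄ x₅ x₆ : ℝ≥0∞) : (x₁ + x₂ + x₃ + (x₄ + x₅ + x₆)) ^ 2 ≤
    8 * (x₁ ^ 2 + x₂ ^ 2 + x₃ ^ 2 + (x₄ ^ 2 + x₅ ^ 2 + x₆ ^ 2)) := by
  have three : ∀ x y z : ℝ≥0∞, (x + y + z) ^ 2 ≤ 4 * (x ^ 2 + y ^ 2 + z ^ 2) := fun x y z => by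
    calc _ ≤ 2 * ((x + y) ^ 2 + z ^ 2) := add_sq_le_two_mul _ _
      _ ≤ 2 * (2 * (x ^ 2 + y ^ 2) + 2 * z ^ 2) := by
          gcongr
          · exact add_sq_le_two_mul _ _
          · exact le_mul_of_one_le_left (by simp) (by norm_num)
      _ = _ := by ring
  calc _ ≤ 2 * ((x₁ + x₂ + x₃) ^ 2 + (x₄ + x₅ + x₆) ^ 2) := add_sq_le_two_mul _ _
    _ ≤ 2 * (4 * (x₁ ^ 2 + x₂ ^ 2 + x₃ ^ 2) + 4 * (x₄ ^ 2 + x₅ ^ 2 + x₆ ^ 2)) := by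
        gcongr <;> exact three _ _ _
    _ = _ := by ring

theorem enorm_real_inner_le (v w : Amb k) : ‖⟪v, w⟫‖ₑ ≤ ‖v‖ₑ * ‖w‖ₑ := by
  rw [← ofReal_norm, ← ofReal_norm, ← ofReal_norm, ← ENNReal.ofReal_mul (norm_nonneg _)]
  exact ENNReal.ofReal_le_ofReal (norm_inner_le_norm v w)

variable {F φ φx φt F' φ' φx' φt' : ℝ → ℝ → Amb k}

theorem nullDer_sub (c : ℝ) (t x : ℝ) : nullDer c (φx - φx') (φt - φt') t x =
    nullDer c φx φt t x - nullDer c φx' φt' t x := by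
  simp only [nullDer, Pi.sub_apply, smul_sub]
  abel

/-- The null structure of the difference of two solutions. -/
theorem enorm_nonlin_sub_le {c : ℝ} (hc : c * c = 1) {t x : ℝ} (h1 : ‖φ t x‖ = 1) :
    ‖nonlin F φ φx φt t x - nonlin F' φ' φx' φt' t x‖ₑ ≤
      ‖nullDer c (φx - φx') (φt - φt') t x‖ₑ * ‖nullDer (-c) φx φt t x‖ₑ +
      ‖nullDer c φx' φt' t x‖ₑ * ‖nullDer (-c) (φx - φx') (φt - φt') t x‖ₑ +
      ‖nullDer c φx' φt' t x‖ₑ * ‖nullDer (-c) φx' φt' t x‖ₑ * ‖φ t x - φ' t x‖ₑ +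
      ‖F t x - F' t x‖ₑ := by
  rw [nullDer_sub, nullDer_sub, nonlin_eq hc, nonlin_eq hc]
  generalize nullDer c φx φt t x = p
  generalize nullDer (-c) φx φt t x = q
  generalize nullDer c φx' φt' t x = p'
  generalize nullDer (-c) φx' φt' t x = q'
  have h1' : ‖φ t x‖ₑ = 1 := by rw [← ofReal_norm, h1, ENNReal.ofReal_one]
  -- One factor is exchanged at a time, with `φ` left in place until last, so that `‖φ‖ = 1` removes
  -- it from two of the terms. In this order only `q`, `p'` and `q'` occur as undifferenced null
  -- derivatives.
  have e : ⟪p, q⟫ • φ t x + F t x - (⟪p', q'⟫ • φ' t x + F' t x) =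
      ⟪p - p', q⟫ • φ t x + ⟪p', q - q'⟫ • φ t x + ⟪p', q'⟫ • (φ t x - φ' t x) +
        (F t x - F' t x) := by
    simp only [inner_sub_left, inner_sub_right, sub_smul, smul_sub]
    abel
  rw [e]
  refine (enorm_add_le _ _).trans (add_le_add ((enorm_add_le _ _).trans
    (add_le_add ((enorm_add_le _ _).trans (add_le_add ?_ ?_)) ?_)) le_rfl)
  · rw [enorm_smul, h1', mul_one]
    exact enorm_real_inner_le _ _
  · rw [enorm_smul, h1', mul_one]
    exact enorm_real_inner_le _ _
  · rw [enorm_smul]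
    gcongr
    exact enorm_real_inner_le _ _

end WaveMapS1

/-! ### Weighted majorants for the difference of two solutions -/

namespace WaveMapS1

variable {k : ℕ} {a b T : ℝ}

theorem Slab.travel {A : ℝ → ℝ≥0∞} (hA : AEMeasurable A) (hp : Function.Periodic A period)
    (c : ℝ) : Slab a b (fun t x => A (x + c * t)) := by
  refine ⟨?_, fun t _ => periodic_comp_add hp _⟩
  have := (Slab.of_fun (a := a) (b := b) hA hp).shear_circ (-c)
  simp only [neg_mul, sub_neg_eq_add] at this
  exact this

/-- Truncated subtraction turns the inequality into the vanishing of a nonnegative slab function. -/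
theorem Slab.ae_le_of_forall {H H' : ℝ → ℝ → ℝ≥0∞} (h : Slab a b H) (h' : Slab a b H')
    (hle : ∀ t ∈ Icc a b, ∀ᵐ x ∂circ, H t x ≤ H' t x) :
    ∀ᵐ p ∂cyl a b, H p.1 p.2 ≤ H' p.1 p.2 := by
  have hs : Slab a b (fun t x => H t x - H' t x) :=
    ⟨(h.aemeasurable.sub h'.aemeasurable).aestronglyMeasurable,
      fun t ht x => by simp only [h.per t ht x, h'.per t ht x]⟩
  have h1 := hs.lintegral_eq
  have h2 : ∫⁻ r in Icc a b, (∫⁻ x, (H r x - H' r x) ∂circ) = 0 := by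
    rw [lintegral_eq_zero_of_ae_eq_zero]
    filter_upwards [ae_restrict_mem measurableSet_Icc] with r hr
    rw [Pi.zero_apply, lintegral_eq_zero_of_ae_eq_zero]
    filter_upwards [hle r hr] with x hx
    exact tsub_eq_zero_of_le hx
  rw [h2, lintegral_eq_zero_iff' hs.aemeasurable] at h1
  filter_upwards [h1] with p hp
  exact tsub_eq_zero_iff_le.1 hp

theorem lintegral_cyl_travel {A : ℝ → ℝ≥0∞} (hA : AEMeasurable A)
    (hp : Function.Periodic A period) (c : ℝ) :
    ∫⁻ p, A (p.2 + c * p.1) ∂cyl (-T) T = ENNReal.ofReal (2 * T) * ∫⁻ x, A x ∂circ := by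
  rw [(Slab.travel hA hp c).lintegral_eq]
  simp only [lintegral_circ_add hp]
  rw [lintegral_const, mul_comm]
  simp [two_mul]

theorem lintegral_cyl_mul_le {A B : ℝ → ℝ≥0∞} (hA : AEMeasurable A)
    (hp : Function.Periodic A period) (hB : AEMeasurable B) (hq : Function.Periodic B period) :
    ∫⁻ p, A (p.2 + 1 * p.1) * B (p.2 + (-1) * p.1) ∂cyl (-T) T
      ≤ covering (4 * T) * ((∫⁻ x, A x ∂circ) * ∫⁻ x, B x ∂circ) := by
  rw [((Slab.travel hA hp 1).mul (Slab.travel hB hq (-1))).lintegral_eq]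
  have := lintegral_mul_null_le hA hB hp hq T (c := 1) (Or.inl rfl)
  simpa only [neg_mul, ← sub_eq_add_neg] using this

variable {M K : ℝ≥0} {f F φ φx φt f' F' φ' φx' φt' : ℝ → ℝ → Amb k} {κ : ℝ}

theorem IsContL2.sub {h h' : ℝ → ℝ → Amb k} (H : IsContL2 a b h) (H' : IsContL2 a b h') :
    IsContL2 a b (h - h') where
  aestronglyMeasurable := H.aestronglyMeasurable.sub H'.aestronglyMeasurable
  periodic t ht x := by simp only [Pi.sub_apply, H.periodic t ht x, H'.periodic t ht x]
  memLp t ht := (H.memLp t ht).sub (H'.memLp t ht)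
  continuous t ht := by
    have h1 := (H.continuous t ht).add (H'.continuous t ht)
    rw [add_zero] at h1
    refine tendsto_of_tendsto_of_tendsto_of_le_of_le' tendsto_const_nhds h1
      (Eventually.of_forall fun s => zero_le) ?_
    filter_upwards [self_mem_nhdsWithin] with s hs
    have e : (fun x => (h - h') s x - (h - h') t x) =
        (fun x => h s x - h t x) - fun x => h' s x - h' t x := by
      ext1 x
      simp only [Pi.sub_apply]
      abel
    rw [e]
    exact eLpNorm_sub_le ((H.memLp s hs).sub (H.memLp t ht)).1
      ((H'.memLp s hs).sub (H'.memLp t ht)).1 (by norm_num)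

theorem HasWeakDeriv.sub {g g' h h' : ℝ → Amb k} (H : HasWeakDeriv g g') (H' : HasWeakDeriv h h')
    (hg : Integrable g circ) (hg' : Integrable g' circ) (hh : Integrable h circ)
    (hh' : Integrable h' circ) : HasWeakDeriv (g - h) (g' - h') := by
  intro η hη hp
  have hη' : Continuous (deriv η) := hη.continuous_deriv (by simp)
  simp only [Pi.sub_apply, smul_sub]
  rw [integral_sub (integrable_smul_circ hη' (periodic_deriv hp) hg)
    (integrable_smul_circ hη' (periodic_deriv hp) hh),
    integral_sub (integrable_smul_circ hη.continuous hp hg')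
    (integrable_smul_circ hη.continuous hp hh'), H η hη hp, H' η hη hp]
  abel

/-- The difference of the right-hand sides of two wave maps equations. -/
noncomputable def nonlinDiff (F φ φx φt F' φ' φx' φt' : ℝ → ℝ → Amb k) (t x : ℝ) : Amb k :=
  nonlin F φ φx φt t x - nonlin F' φ' φx' φt' t x

theorem nonlinDiff_slab (h : IsControlled T M K f F φ φx φt)
    (h' : IsControlled T M K f' F' φ' φx' φt') :
    Slab (-T) T (nonlinDiff F φ φx φt F' φ' φx' φt') :=
  (nonlin_slab h.sol.path h.slab).comp₂ (nonlin_slab h'.sol.path h'.slab)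
    (f := fun v w => v - w) (by simp only [Function.uncurry_def]; fun_prop)

theorem nullDer_sub_eq (h : IsControlled T M K f F φ φx φt)
    (h' : IsControlled T M K f' F' φ' φx' φt') (hT : 0 < T) {c : ℝ} (hc : c * c = 1) {t : ℝ}
    (ht : t ∈ Icc (-T) T) :
    ∀ᵐ y, nullDer c (φx - φx') (φt - φt') t (y - c * t) =
      nullDer c (φx - φx') (φt - φt') 0 y -
        ∫ r in (0)..t, nonlinDiff F φ φx φt F' φ' φx' φt' r (y - c * r) := by
  have hab : -T < T := by linarith
  have h0 : (0 : ℝ) ∈ Icc (-T) T := ⟨by linarith, hT.le⟩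
  have i1 := h.integrable.integrable (by norm_num)
  have i2 := h'.integrable.integrable (by norm_num)
  have j1 := (nonlin_slab h.sol.path h.slab).integrable_line
    (nonlin_integrable h.sol.path i1).2 c
  have j2 := (nonlin_slab h'.sol.path h'.slab).integrable_line
    (nonlin_integrable h'.sol.path i2).2 c
  filter_upwards [h.sol.nullDer_eq h.slab i1 hab hc h0 ht,
    h'.sol.nullDer_eq h'.slab i2 hab hc h0 ht, j1, j2] with y h1 h2 h3 h4
  simp only [nullDer_sub, nonlinDiff]
  rw [h1, h2, intervalIntegral.integral_sub (intervalIntegrable_of_Icc h3 h0 ht)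
    (intervalIntegrable_of_Icc h4 h0 ht)]
  simp only [mul_zero, sub_zero]
  abel

/-- The speed 0 and the minus sign cast the identity into the form required by
`weight_mul_le_lineMajorant`. -/
theorem pos_sub_eq (h : IsEnergyPath (-T) T φ φx φt) (h' : IsEnergyPath (-T) T φ' φx' φt')
    (hT : 0 < T) {t : ℝ} (ht : t ∈ Icc (-T) T) :
    ∀ᵐ y, (φ - φ') t (y - 0 * t) = (φ - φ') 0 y -
      ∫ r in (0)..t, (fun s x => -(φt - φt') s x) r (y - 0 * r) := by
  have hab : -T < T := by linarith
  have h0 : (0 : ℝ) ∈ Icc (-T) T := ⟨by linarith, hT.le⟩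
  have j1 := h.cont_t.slab.integrable_line h.cont_t.integrable_cyl 0
  have j2 := h'.cont_t.slab.integrable_line h'.cont_t.integrable_cyl 0
  filter_upwards [h.ae_eq hab h0 ht, h'.ae_eq hab h0 ht, j1, j2] with y h1 h2 h3 h4
  simp only [zero_mul, sub_zero, Pi.sub_apply, intervalIntegral.integral_neg] at h3 h4 ⊢
  rw [h1, h2, intervalIntegral.integral_sub (intervalIntegrable_of_Icc h3 h0 ht)
    (intervalIntegrable_of_Icc h4 h0 ht)]
  abel

theorem nullDer_sub_slab (h : IsEnergyPath a b φ φx φt) (h' : IsEnergyPath a b φ' φx' φt')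
    (c : ℝ) : Slab a b (nullDer c (φx - φx') (φt - φt')) :=
  (h.cont_t.sub h'.cont_t).slab.comp₂ (h.cont_x.sub h'.cont_x).slab (f := fun v w => v + c • w)
    (by simp only [Function.uncurry_def]; fun_prop)

theorem nullDer_sub_memLp (h : IsEnergyPath a b φ φx φt) (h' : IsEnergyPath a b φ' φx' φt')
    (c : ℝ) {t : ℝ} (ht : t ∈ Icc a b) : MemLp (nullDer c (φx - φx') (φt - φt') t) 2 circ :=
  ((h.cont_t.sub h'.cont_t).memLp t ht).add (((h.cont_x.sub h'.cont_x).memLp t ht).const_smul c)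

/-- The weighted space-time norm of the difference of the nonlinearities. -/
noncomputable def diffNorm (T κ : ℝ) (F φ φx φt F' φ' φx' φt' : ℝ → ℝ → Amb k) : ℝ≥0∞ :=
  ∫⁻ p, weight κ p.1 * ‖nonlinDiff F φ φx φt F' φ' φx' φt' p.1 p.2‖ₑ ^ 2 ∂cyl (-T) T

/-- The integral of the two weighted null majorants of the difference. -/
noncomputable def majorantSum (T κ : ℝ) (F φ φx φt F' φ' φx' φt' : ℝ → ℝ → Amb k) : ℝ≥0∞ :=
  2 * nullEnergy 1 (φx - φx') (φt - φt') 0 +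
    4 * (ENNReal.ofReal (1 / κ) * diffNorm T κ F φ φx φt F' φ' φx' φt')

/-- The weighted null majorant of `w_t + c w_x` for the difference `w` of two solutions. -/
noncomputable def diffMajorant (T κ c : ℝ) (F φ φx φt F' φ' φx' φt' : ℝ → ℝ → Amb k) :
    ℝ → ℝ≥0∞ :=
  lineMajorant T κ c (nullDer c (φx - φx') (φt - φt') 0) (nonlinDiff F φ φx φt F' φ' φx' φt')

theorem diffMajorant_spec (h : IsControlled T M K f F φ φx φt)
    (h' : IsControlled T M K f' F' φ' φx' φt') (hT : 0 < T) (hκ : 0 < κ) {c : ℝ}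
    (hc : c * c = 1) :
    AEMeasurable (diffMajorant T κ c F φ φx φt F' φ' φx' φt') ∧
    Function.Periodic (diffMajorant T κ c F φ φx φt F' φ' φx' φt') period ∧
    ∀ t ∈ Icc (-T) T, ∀ᵐ x, weight κ t * ‖nullDer c (φx - φx') (φt - φt') t x‖ₑ ^ 2 ≤
      diffMajorant T κ c F φ φx φt F' φ' φx' φt' (x + c * t) := by
  have h0 : (0 : ℝ) ∈ Icc (-T) T := ⟨by linarith, hT.le⟩
  have hp := (nullDer_sub_slab h.sol.path h'.sol.path c).per 0 h0
  exact ⟨aemeasurable_lineMajorant hp (nullDer_sub_memLp h.sol.path h'.sol.path c h0).1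
      (nonlinDiff_slab h h'), lineMajorant_periodic hp (nonlinDiff_slab h h'),
    fun t ht => weight_mul_le_lineMajorant hκ (nonlinDiff_slab h h') ht
      (nullDer_sub_eq h h' hT hc ht)⟩

theorem lintegral_diffMajorant_add (h : IsControlled T M K f F φ φx φt)
    (h' : IsControlled T M K f' F' φ' φx' φt') (hT : 0 < T) :
    (∫⁻ x, diffMajorant T κ 1 F φ φx φt F' φ' φx' φt' x ∂circ) +
      (∫⁻ x, diffMajorant T κ (-1) F φ φx φt F' φ' φx' φt' x ∂circ) =
      majorantSum T κ F φ φx φt F' φ' φx' φt' := by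
  have h0 : (0 : ℝ) ∈ Icc (-T) T := ⟨by linarith, hT.le⟩
  simp only [diffMajorant]
  rw [lintegral_lineMajorant (nullDer_sub_memLp h.sol.path h'.sol.path _ h0).1
    (nonlinDiff_slab h h'), lintegral_lineMajorant
    (nullDer_sub_memLp h.sol.path h'.sol.path _ h0).1 (nonlinDiff_slab h h'), majorantSum,
    nullEnergy, diffNorm]
  ring

theorem weight_mul_nullEnergy_le (h : IsControlled T M K f F φ φx φt)
    (h' : IsControlled T M K f' F' φ' φx' φt') (hT : 0 < T) (hκ : 0 < κ) {t : ℝ}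
    (ht : t ∈ Icc (-T) T) : weight κ t * nullEnergy 1 (φx - φx') (φt - φt') t ≤
      majorantSum T κ F φ φx φt F' φ' φx' φt' := by
  have one : ∀ {c : ℝ}, c * c = 1 →
      weight κ t * ∫⁻ x, ‖nullDer c (φx - φx') (φt - φt') t x‖ₑ ^ 2 ∂circ ≤
      ∫⁻ x, diffMajorant T κ c F φ φx φt F' φ' φx' φt' x ∂circ := by
    intro c hc
    obtain ⟨_, h2, h3⟩ := diffMajorant_spec h h' hT hκ hc
    rw [← lintegral_const_mul' _ _ (weight_ne_top _ _), ← lintegral_circ_add h2 (c * t)]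
    exact lintegral_mono_ae (ae_circ_of_ae (h3 t ht))
  rw [← lintegral_diffMajorant_add h h' hT, nullEnergy, mul_add]
  exact add_le_add (one (by norm_num)) (one (by norm_num))

/-- `w` is recovered from its initial value by integrating `w_t` along the lines `x = const`, and
`w_t` is bounded by the null energy. The gain `1 / κ` is not needed here and is discarded using `1 ≤
κ`. -/
theorem weight_mul_pos_le (h : IsControlled T M K f F φ φx φt)
    (h' : IsControlled T M K f' F' φ' φx' φt') (hT : 0 < T) (hκ : 1 ≤ κ) {t : ℝ}
    (ht : t ∈ Icc (-T) T) : weight κ t * ∫⁻ x, ‖(φ - φ') t x‖ₑ ^ 2 ∂circ ≤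
      2 * (∫⁻ x, ‖(φ - φ') 0 x‖ₑ ^ 2 ∂circ) +
        2 * (ENNReal.ofReal (2 * T) * majorantSum T κ F φ φx φt F' φ' φx' φt') := by
  have hκ0 : 0 < κ := by linarith
  have h0 : (0 : ℝ) ∈ Icc (-T) T := ⟨by linarith, hT.le⟩
  have P := h.sol.path
  have P' := h'.sol.path
  have hs : Slab (-T) T (fun s x => -(φt - φt') s x) :=
    (P.cont_t.sub P'.cont_t).slab.comp (f := fun v => -v) (by fun_prop)
  have h1 := weight_mul_le_lineMajorant hκ0 hs ht (pos_sub_eq P P' hT ht)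
  have hm0 := ((P.cont.sub P'.cont).memLp 0 h0).1
  simp only [zero_mul, add_zero] at h1
  rw [← lintegral_const_mul' _ _ (weight_ne_top _ _)]
  refine (lintegral_mono_ae (ae_circ_of_ae h1)).trans ?_
  rw [lintegral_lineMajorant hm0 hs]
  gcongr _ + 2 * ?_
  calc _ ≤ 1 * ∫⁻ p, weight κ p.1 * ‖-(φt - φt') p.1 p.2‖ₑ ^ 2 ∂cyl (-T) T := by
        gcongr
        rw [ENNReal.ofReal_le_one, div_le_one hκ0]
        exact hκ
    _ = ∫⁻ r in Icc (-T) T, weight κ r * ∫⁻ x, ‖(φt - φt') r x‖ₑ ^ 2 ∂circ := by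
        rw [one_mul, (hs.enorm_sq.time_mul (measurable_weight κ)).lintegral_eq]
        simp only [enorm_neg]
        apply lintegral_congr
        intro r
        rw [lintegral_const_mul' _ _ (weight_ne_top _ _)]
    _ ≤ ∫⁻ r in Icc (-T) T, majorantSum T κ F φ φx φt F' φ' φx' φt' := by
        apply setLIntegral_mono' measurableSet_Icc
        intro r hr
        refine le_trans ?_ (weight_mul_nullEnergy_le h h' hT hκ0 hr)
        gcongr
        rw [nullEnergy, ← lintegral_add_left'
          ((nullDer_sub_memLp P P' 1 hr).1.enorm.pow_const 2)]
        exact lintegral_mono fun x => enorm_timeDer_sq_le (by norm_num) _ _ _ _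
    _ = _ := by
        rw [lintegral_const, mul_comm]
        simp [two_mul]

/-- The bound for the weighted supremum of the difference. -/
noncomputable def supBound (T κ : ℝ) (F φ φx φt F' φ' φx' φt' : ℝ → ℝ → Amb k) : ℝ≥0∞ :=
  2 * ENNReal.ofReal period * (2 * (∫⁻ x, ‖(φ - φ') 0 x‖ₑ ^ 2 ∂circ) +
        2 * (ENNReal.ofReal (2 * T) * majorantSum T κ F φ φx φt F' φ' φx' φt') +
        majorantSum T κ F φ φx φt F' φ' φx' φt')

/-- Sobolev's inequality in each slice. The cubic part of the difference contains `w`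
undifferentiated against two null derivatives, so it is needed in `L^∞`. -/
theorem weight_mul_sup_le (h : IsControlled T M K f F φ φx φt)
    (h' : IsControlled T M K f' F' φ' φx' φt') (hT : 0 < T) (hκ : 1 ≤ κ) {t : ℝ}
    (ht : t ∈ Icc (-T) T) : ∀ᵐ x ∂circ, weight κ t * ‖(φ - φ') t x‖ₑ ^ 2 ≤
      supBound T κ F φ φx φt F' φ' φx' φt' := by
  have P := h.sol.path
  have P' := h'.sol.path
  have hw := (P.weakDeriv_x t ht).sub (P'.weakDeriv_x t ht)
    (memLp_integrable_circ (P.cont.memLp t ht)) (memLp_integrable_circ (P.cont_x.memLp t ht))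
    (memLp_integrable_circ (P'.cont.memLp t ht)) (memLp_integrable_circ (P'.cont_x.memLp t ht))
  filter_upwards [hw.enorm_sq_le ((P.cont.sub P'.cont).memLp t ht)
    ((P.cont_x.sub P'.cont_x).memLp t ht)] with x hx
  calc weight κ t * ‖(φ - φ') t x‖ₑ ^ 2
      ≤ weight κ t * (2 * ENNReal.ofReal period * ((∫⁻ y, ‖(φ - φ') t y‖ₑ ^ 2 ∂circ) +
          ∫⁻ y, ‖(φx - φx') t y‖ₑ ^ 2 ∂circ)) := mul_le_mul' le_rfl hx
    _ = 2 * ENNReal.ofReal period * (weight κ t * (∫⁻ y, ‖(φ - φ') t y‖ₑ ^ 2 ∂circ) +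
          weight κ t * ∫⁻ y, ‖(φx - φx') t y‖ₑ ^ 2 ∂circ) := by ring
    _ ≤ _ := by
        rw [supBound]
        refine mul_le_mul' le_rfl (add_le_add ?_ ?_)
        · exact weight_mul_pos_le h h' hT hκ ht
        · refine le_trans ?_ (weight_mul_nullEnergy_le h h' hT (by linarith) ht)
          gcongr
          rw [nullEnergy, ← lintegral_add_left'
            ((nullDer_sub_memLp P P' 1 ht).1.enorm.pow_const 2)]
          exact lintegral_mono fun x => enorm_spaceDer_sq_le (by norm_num) _ _ _ _

end WaveMapS1

/-! ### Closing the estimate for the difference -/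

namespace WaveMapS1

variable {k : ℕ} {a b T : ℝ} {M K : ℝ≥0} {f F φ φx φt f' F' φ' φx' φt' : ℝ → ℝ → Amb k} {κ : ℝ}

/-- Two controlled solutions whose sources differ by a Lipschitz expression. -/
structure IsControlledPair (T : ℝ) (M K : ℝ≥0) (f F φ φx φt f' F' φ' φx' φt' : ℝ → ℝ → Amb k) :
    Prop where
  left : IsControlled T M K f F φ φx φt
  right : IsControlled T M K f' F' φ' φx' φt'
  lip : ∀ᵐ p ∂cyl (-T) T, ‖F p.1 p.2 - F' p.1 p.2‖ₑ ≤ ‖(f - f') p.1 p.2‖ₑ +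
    2 * ‖f' p.1 p.2‖ₑ * ‖(φ - φ') p.1 p.2‖ₑ + K * ‖(φt - φt') p.1 p.2‖ₑ

theorem IsControlled.ae_cyl_majorant (h : IsControlled T M K f F φ φx φt) (hT : 0 < T) {c : ℝ}
    (hc : c * c = 1) : ∃ A : ℝ → ℝ≥0∞, AEMeasurable A ∧ Function.Periodic A period ∧
      ∫⁻ x, A x ∂circ ≤ majorantBound T M K ∧
      ∀ᵐ p ∂cyl (-T) T, ‖nullDer c φx φt p.1 p.2‖ₑ ^ 2 ≤ A (p.2 + c * p.1) := by
  obtain ⟨A, hm, hp, hA, h1⟩ := h.exists_majorant hT hc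
  exact ⟨A, hm, hp, hA, (h.sol.path.nullDer_sq_slab c).ae_le_of_forall (Slab.travel hm hp c)
    fun t ht => ae_circ_of_ae (h1 t ht)⟩

/-- The squared null form is at most a product of majorants in opposite null coordinates, to which
the bilinear estimate applies. -/
theorem IsControlled.lintegral_nonlin_lt_top (h : IsControlled T M K f F φ φx φt) (hT : 0 < T) :
    ∫⁻ p, ‖nonlin F φ φx φt p.1 p.2‖ₑ ^ 2 ∂cyl (-T) T < ⊤ := by
  obtain ⟨A, hAm, hAp, hA, hA'⟩ := h.ae_cyl_majorant hT (c := 1) (by norm_num)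
  obtain ⟨B, hBm, hBp, hB, hB'⟩ := h.ae_cyl_majorant hT (c := -1) (by norm_num)
  have hF : ∫⁻ p, ‖F p.1 p.2‖ₑ ^ 2 ∂cyl (-T) T < ⊤ := by
    rw [← eLpNorm_two_sq]
    exact ENNReal.pow_lt_top h.integrable.2
  have hAB := lintegral_cyl_mul_le (T := T) hAm hAp hBm hBp
  have hmB := (majorantBound_ne_top T M K)
  calc _ ≤ ∫⁻ p, (2 * (A (p.2 + 1 * p.1) * B (p.2 + (-1) * p.1)) +
          2 * ‖F p.1 p.2‖ₑ ^ 2) ∂cyl (-T) T := by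
        apply lintegral_mono_ae
        filter_upwards [hA', hB', h.sol.path.norm_eq_one] with p h1 h2 h3
        rw [nonlin_eq (c := 1) (by norm_num)]
        have h3' : ‖φ p.1 p.2‖ₑ = 1 := by rw [← ofReal_norm, h3, ENNReal.ofReal_one]
        refine (pow_le_pow_left' (b := ‖nullDer 1 φx φt p.1 p.2‖ₑ * ‖nullDer (-1) φx φt p.1 p.2‖ₑ +
          ‖F p.1 p.2‖ₑ) ?_ 2).trans ((add_sq_le_two_mul _ _).trans ?_)
        · refine (enorm_add_le _ _).trans (add_le_add ?_ le_rfl)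
          rw [enorm_smul, h3', mul_one]
          exact enorm_real_inner_le _ _
        · rw [mul_pow, mul_add]
          gcongr
    _ = 2 * (∫⁻ p, A (p.2 + 1 * p.1) * B (p.2 + (-1) * p.1) ∂cyl (-T) T) +
          2 * ∫⁻ p, ‖F p.1 p.2‖ₑ ^ 2 ∂cyl (-T) T := by
        rw [lintegral_add_left' (((Slab.travel hAm hAp 1).mul
          (Slab.travel hBm hBp (-1))).aemeasurable.const_mul 2),
          lintegral_const_mul' _ _ (by norm_num), lintegral_const_mul' _ _ (by norm_num)]
    _ ≤ 2 * (covering (4 * T) * (majorantBound T M K * majorantBound T M K)) +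
          2 * ∫⁻ p, ‖F p.1 p.2‖ₑ ^ 2 ∂cyl (-T) T := by
        gcongr
        refine hAB.trans ?_
        gcongr
    _ < ⊤ := by finiteness

/-- Only finiteness matters: it licenses the absorption in `diffNorm_weightRate_le`. -/
theorem diffNorm_ne_top (h : IsControlledPair T M K f F φ φx φt f' F' φ' φx' φt') (hT : 0 < T)
    (hκ : 0 ≤ κ) : diffNorm T κ F φ φx φt F' φ' φx' φt' ≠ ⊤ := by
  have h1 := h.left.lintegral_nonlin_lt_top hT
  have h2 := h.right.lintegral_nonlin_lt_top hT
  refine ne_top_of_le_ne_top (b := 2 * ((∫⁻ p, ‖nonlin F φ φx φt p.1 p.2‖ₑ ^ 2 ∂cyl (-T) T) +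
    ∫⁻ p, ‖nonlin F' φ' φx' φt' p.1 p.2‖ₑ ^ 2 ∂cyl (-T) T)) (by finiteness) ?_
  rw [← lintegral_add_left' (nonlin_slab h.left.sol.path h.left.slab).enorm_sq.aemeasurable,
    ← lintegral_const_mul' _ _ (by norm_num)]
  apply lintegral_mono
  intro p
  calc _ ≤ 1 * (‖nonlin F φ φx φt p.1 p.2‖ₑ + ‖nonlin F' φ' φx' φt' p.1 p.2‖ₑ) ^ 2 := by
        exact mul_le_mul' (weight_le_one hκ _) (pow_le_pow_left' enorm_sub_le 2)
    _ ≤ _ := by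
        rw [one_mul]
        exact add_sq_le_two_mul _ _

/-- The constant in the estimate of the difference of the nonlinearities. -/
noncomputable def diffConst (T : ℝ) (M K : ℝ≥0) : ℝ≥0∞ :=
  8 * (covering (4 * T) * majorantBound T M K +
    (covering (4 * T) * majorantBound T M K ^ 2 + 4 * (M : ℝ≥0∞) ^ 2) *
      (2 * ENNReal.ofReal period * (3 + 2 * ENNReal.ofReal (2 * T))) +
    (K : ℝ≥0∞) ^ 2 * ENNReal.ofReal (2 * T))

theorem diffConst_ne_top (T : ℝ) (M K : ℝ≥0) : diffConst T M K ≠ ⊤ := by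
  have := majorantBound_ne_top T M K
  unfold diffConst
  finiteness

/-- In each product the weight is spent on the one factor that comes from `w`, and the other factors
are replaced by their unweighted majorants. The two products containing a null derivative of `w`
then pair functions of opposite null coordinates. -/
theorem weight_mul_nonlinDiff_le (h : IsControlledPair T M K f F φ φx φt f' F' φ' φx' φt')
    (hT : 0 < T) (hκ : 1 ≤ κ) {B A' B' : ℝ → ℝ≥0∞}
    (hB : ∀ᵐ p ∂cyl (-T) T, ‖nullDer (-1) φx φt p.1 p.2‖ₑ ^ 2 ≤ B (p.2 + (-1) * p.1))
    (hA' : ∀ᵐ p ∂cyl (-T) T, ‖nullDer 1 φx' φt' p.1 p.2‖ₑ ^ 2 ≤ A' (p.2 + 1 * p.1))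
    (hB' : ∀ᵐ p ∂cyl (-T) T, ‖nullDer (-1) φx' φt' p.1 p.2‖ₑ ^ 2 ≤ B' (p.2 + (-1) * p.1)) :
    ∀ᵐ p ∂cyl (-T) T, weight κ p.1 * ‖nonlinDiff F φ φx φt F' φ' φx' φt' p.1 p.2‖ₑ ^ 2 ≤
      8 * (diffMajorant T κ 1 F φ φx φt F' φ' φx' φt' (p.2 + 1 * p.1) * B (p.2 + (-1) * p.1) +
        A' (p.2 + 1 * p.1) * diffMajorant T κ (-1) F φ φx φt F' φ' φx' φt' (p.2 + (-1) * p.1) +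
        supBound T κ F φ φx φt F' φ' φx' φt' * (A' (p.2 + 1 * p.1) * B' (p.2 + (-1) * p.1)) +
        (‖(f - f') p.1 p.2‖ₑ ^ 2 +
          supBound T κ F φ φx φt F' φ' φx' φt' * (4 * ‖f' p.1 p.2‖ₑ ^ 2) +
          (K : ℝ≥0∞) ^ 2 * (diffMajorant T κ 1 F φ φx φt F' φ' φx' φt' (p.2 + 1 * p.1) +
            diffMajorant T κ (-1) F φ φx φt F' φ' φx' φt' (p.2 + (-1) * p.1)))) := by
  have hκ0 : 0 < κ := by linarith
  have P := h.left.sol.path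
  have P' := h.right.sol.path
  have hR : ∀ {c : ℝ}, c * c = 1 → ∀ᵐ p ∂cyl (-T) T,
      weight κ p.1 * ‖nullDer c (φx - φx') (φt - φt') p.1 p.2‖ₑ ^ 2 ≤
      diffMajorant T κ c F φ φx φt F' φ' φx' φt' (p.2 + c * p.1) := by
    intro c hc
    obtain ⟨h1, h2, h3⟩ := diffMajorant_spec h.left h.right hT hκ0 hc
    exact ((nullDer_sub_slab P P' c).enorm_sq.time_mul (measurable_weight κ)).ae_le_of_forall
      (Slab.travel h1 h2 c) fun t ht => ae_circ_of_ae (h3 t ht)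
  have hW : ∀ᵐ p ∂cyl (-T) T, weight κ p.1 * ‖(φ - φ') p.1 p.2‖ₑ ^ 2 ≤
      supBound T κ F φ φx φt F' φ' φx' φt' :=
    ((P.cont.sub P'.cont).slab.enorm_sq.time_mul (measurable_weight κ)).ae_le_of_forall
      (Slab.of_fun (aemeasurable_const) fun _ => rfl)
      fun t ht => weight_mul_sup_le h.left h.right hT hκ ht
  filter_upwards [hB, hA', hB', hR (c := 1) (by norm_num), hR (c := -1) (by norm_num), hW, h.lip,
    P.norm_eq_one] with p h1 h2 h3 h4 h5 h6 h7 h8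
  have hn := enorm_nonlin_sub_le (F := F) (φx := φx) (φt := φt) (F' := F') (φ' := φ') (φx' := φx')
    (φt' := φt') (c := 1) (by norm_num) h8
  have ht := enorm_timeDer_sq_le (c := 1) (by norm_num) (φx - φx') (φt - φt') p.1 p.2
  have hχ := weight_le_one hκ0.le p.1
  have e : φ p.1 p.2 - φ' p.1 p.2 = (φ - φ') p.1 p.2 := rfl
  rw [e] at hn
  simp only [nonlinDiff]
  generalize ‖nonlin F φ φx φt p.1 p.2 - nonlin F' φ' φx' φt' p.1 p.2‖ₑ = N at *
  generalize ‖nullDer 1 (φx - φx') (φt - φt') p.1 p.2‖ₑ = w₁ at *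
  generalize ‖nullDer (-1) (φx - φx') (φt - φt') p.1 p.2‖ₑ = w₂ at *
  generalize ‖nullDer (-1) φx φt p.1 p.2‖ₑ = q at *
  generalize ‖nullDer 1 φx' φt' p.1 p.2‖ₑ = p' at *
  generalize ‖nullDer (-1) φx' φt' p.1 p.2‖ₑ = q' at *
  generalize ‖(φ - φ') p.1 p.2‖ₑ = w at *
  generalize ‖(φt - φt') p.1 p.2‖ₑ = wt at *
  generalize ‖f' p.1 p.2‖ₑ = s' at *
  generalize ‖(f - f') p.1 p.2‖ₑ = s at *
  generalize weight κ p.1 = χ at *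
  calc χ * N ^ 2 ≤ χ * (w₁ * q + p' * w₂ + p' * q' * w + (s + 2 * s' * w + K * wt)) ^ 2 := by
        gcongr
        exact hn.trans (add_le_add le_rfl h7)
    _ ≤ χ * (8 * ((w₁ * q) ^ 2 + (p' * w₂) ^ 2 + (p' * q' * w) ^ 2 +
          (s ^ 2 + (2 * s' * w) ^ 2 + (K * wt) ^ 2))) := by
        gcongr
        exact add_six_sq_le _ _ _ _ _ _
    _ = 8 * (χ * w₁ ^ 2 * q ^ 2 + p' ^ 2 * (χ * w₂ ^ 2) + χ * w ^ 2 * (p' ^ 2 * q' ^ 2) +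
          (χ * s ^ 2 + χ * w ^ 2 * (4 * s' ^ 2) + (K : ℝ≥0∞) ^ 2 * (χ * wt ^ 2))) := by ring
    _ ≤ _ := by
        gcongr
        · exact mul_le_of_le_one_left (by simp) hχ
        · calc χ * wt ^ 2 ≤ χ * (w₁ ^ 2 + w₂ ^ 2) := by gcongr
            _ ≤ _ := by
              rw [mul_add]
              gcongr

theorem majorantSum_ne_top (h : IsControlledPair T M K f F φ φx φt f' F' φ' φx' φt') (hT : 0 < T)
    (hκ : 0 ≤ κ) : majorantSum T κ F φ φx φt F' φ' φx' φt' ≠ ⊤ := by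
  have h0 : (0 : ℝ) ∈ Icc (-T) T := ⟨by linarith, hT.le⟩
  have h1 := diffNorm_ne_top h hT hκ
  have e : ∀ c, ∫⁻ x, ‖nullDer c (φx - φx') (φt - φt') 0 x‖ₑ ^ 2 ∂circ ≠ ⊤ := fun c => by
    rw [← eLpNorm_two_sq]
    exact (ENNReal.pow_lt_top (nullDer_sub_memLp h.left.sol.path h.right.sol.path c h0).2).ne
  have e1 := e 1
  have e2 := e (-1)
  unfold majorantSum nullEnergy
  finiteness

theorem lintegral_pos_sub_ne_top (h : IsControlledPair T M K f F φ φx φt f' F' φ' φx' φt')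
    (hT : 0 < T) : ∫⁻ x, ‖(φ - φ') 0 x‖ₑ ^ 2 ∂circ ≠ ⊤ := by
  rw [← eLpNorm_two_sq]
  exact (ENNReal.pow_lt_top ((h.left.sol.path.cont.sub h.right.sol.path.cont).memLp 0
    ⟨by linarith, hT.le⟩).2).ne

theorem supBound_ne_top (h : IsControlledPair T M K f F φ φx φt f' F' φ' φx' φt') (hT : 0 < T)
    (hκ : 0 ≤ κ) : supBound T κ F φ φx φt F' φ' φx' φt' ≠ ⊤ := by
  have h1 := majorantSum_ne_top h hT hκ
  have h2 := lintegral_pos_sub_ne_top h hT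
  unfold supBound
  finiteness

/-- The pointwise bound is integrated with the bilinear estimate. The decisive point is that
`diffConst` does not depend on `κ`, so the rate can be chosen afterwards. -/
theorem diffNorm_le (h : IsControlledPair T M K f F φ φx φt f' F' φ' φx' φt')
    (hT : 0 < T) (hκ : 1 ≤ κ) : diffNorm T κ F φ φx φt F' φ' φx' φt' ≤
      diffConst T M K * (majorantSum T κ F φ φx φt F' φ' φx' φt' +
        ∫⁻ x, ‖(φ - φ') 0 x‖ₑ ^ 2 ∂circ) +
      8 * ∫⁻ p, ‖(f - f') p.1 p.2‖ₑ ^ 2 ∂cyl (-T) T := by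
  have hκ0 : 0 < κ := by linarith
  obtain ⟨B, hBm, hBp, hBi, hB⟩ := h.left.ae_cyl_majorant hT (c := -1) (by norm_num)
  obtain ⟨A', hAm', hAp', hAi', hA'⟩ := h.right.ae_cyl_majorant hT (c := 1) (by norm_num)
  obtain ⟨B', hBm', hBp', hBi', hB'⟩ := h.right.ae_cyl_majorant hT (c := -1) (by norm_num)
  obtain ⟨m1, p1, -⟩ := diffMajorant_spec h.left h.right hT hκ0 (c := 1) (by norm_num)
  obtain ⟨m2, p2, -⟩ := diffMajorant_spec h.left h.right hT hκ0 (c := -1) (by norm_num)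
  have hsum := lintegral_diffMajorant_add (κ := κ) h.left h.right hT
  have hmain := lintegral_mono_ae (weight_mul_nonlinDiff_le h hT hκ hB hA' hB')
  have hsup : supBound T κ F φ φx φt F' φ' φx' φt' ≤
      2 * ENNReal.ofReal period * (3 + 2 * ENNReal.ofReal (2 * T)) *
      (majorantSum T κ F φ φx φt F' φ' φx' φt' + ∫⁻ x, ‖(φ - φ') 0 x‖ₑ ^ 2 ∂circ) := by
    rw [supBound, mul_assoc (2 * ENNReal.ofReal period)]
    refine mul_le_mul' le_rfl ?_
    generalize majorantSum T κ F φ φx φt F' φ' φx' φt' = ρ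
    generalize ∫⁻ x, ‖(φ - φ') 0 x‖ₑ ^ 2 ∂circ = w₀
    generalize ENNReal.ofReal (2 * T) = τ
    calc 2 * w₀ + 2 * (τ * ρ) + ρ ≤ 2 * w₀ + 2 * (τ * ρ) + ρ + (2 * ρ + w₀ + 2 * (τ * w₀)) :=
          le_self_add
      _ = _ := by ring
  have hW := supBound_ne_top h hT hκ0.le
  set R₁ := diffMajorant T κ 1 F φ φx φt F' φ' φx' φt' with hR₁
  set R₂ := diffMajorant T κ (-1) F φ φx φt F' φ' φx' φt' with hR₂
  set W := supBound T κ F φ φx φt F' φ' φx' φt' with hWdef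
  have a1 := ((Slab.travel (a := -T) (b := T) m1 p1 1).mul (Slab.travel hBm hBp (-1))).aemeasurable
  have a2 := ((Slab.travel (a := -T) (b := T) hAm' hAp' 1).mul
    (Slab.travel m2 p2 (-1))).aemeasurable
  have a3 := ((Slab.travel (a := -T) (b := T) hAm' hAp' 1).mul
    (Slab.travel hBm' hBp' (-1))).aemeasurable.const_mul W
  have a4 : AEMeasurable (fun p : ℝ × ℝ => ‖(f - f') p.1 p.2‖ₑ ^ 2) (cyl (-T) T) :=
    (h.left.slab'.meas.sub h.right.slab'.meas).enorm.pow_const 2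
  have a5 := (h.right.slab'.enorm_sq.aemeasurable.const_mul 4).const_mul W
  have a6 := (Slab.travel (a := -T) (b := T) m1 p1 1).aemeasurable
  have a12 : AEMeasurable (fun p : ℝ × ℝ => R₁ (p.2 + 1 * p.1) * B (p.2 + (-1) * p.1) +
    A' (p.2 + 1 * p.1) * R₂ (p.2 + (-1) * p.1)) (cyl (-T) T) := a1.add a2
  have a123 : AEMeasurable (fun p : ℝ × ℝ => R₁ (p.2 + 1 * p.1) * B (p.2 + (-1) * p.1) +
    A' (p.2 + 1 * p.1) * R₂ (p.2 + (-1) * p.1) +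
    W * (A' (p.2 + 1 * p.1) * B' (p.2 + (-1) * p.1))) (cyl (-T) T) := a12.add a3
  have a45 : AEMeasurable (fun p : ℝ × ℝ => ‖(f - f') p.1 p.2‖ₑ ^ 2 +
    W * (4 * ‖f' p.1 p.2‖ₑ ^ 2)) (cyl (-T) T) := a4.add a5
  have b1 := lintegral_cyl_mul_le (T := T) m1 p1 hBm hBp
  have b2 := lintegral_cyl_mul_le (T := T) hAm' hAp' m2 p2
  have b3 := lintegral_cyl_mul_le (T := T) hAm' hAp' hBm' hBp'
  have b6 := lintegral_cyl_travel (T := T) m1 p1 1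
  have b7 := lintegral_cyl_travel (T := T) m2 p2 (-1)
  rw [lintegral_const_mul' _ _ (by norm_num), lintegral_add_left' a123,
    lintegral_add_left' a12, lintegral_add_left' a1, lintegral_add_left' a45,
    lintegral_add_left' a4, lintegral_const_mul' _ _ hW, lintegral_const_mul' _ _ hW,
    lintegral_const_mul' _ _ (by norm_num), lintegral_const_mul' _ _ (by finiteness),
    lintegral_add_left' a6, b6, b7] at hmain
  have hs := h.right.source
  rw [diffNorm, diffConst]
  set mB := majorantBound T M K
  set τ := ENNReal.ofReal (2 * T)
  set w₀ := ∫⁻ x, ‖(φ - φ') 0 x‖ₑ ^ 2 ∂circ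
  set D := ∫⁻ p, ‖(f - f') p.1 p.2‖ₑ ^ 2 ∂cyl (-T) T
  set ρ := majorantSum T κ F φ φx φt F' φ' φx' φt'
  set κ₀ := 2 * ENNReal.ofReal period * (3 + 2 * τ)
  set Cv : ℝ≥0∞ := (covering (4 * T) : ℝ≥0∞)
  set r₁ := ∫⁻ x, R₁ x ∂circ
  set r₂ := ∫⁻ x, R₂ x ∂circ
  calc _ ≤ _ := hmain
    _ ≤ 8 * (Cv * (r₁ * mB) + Cv * (mB * r₂) + κ₀ * (ρ + w₀) * (Cv * (mB * mB)) +
          (D + κ₀ * (ρ + w₀) * (4 * (M : ℝ≥0∞) ^ 2) + (K : ℝ≥0∞) ^ 2 * (τ * r₁ + τ * r₂))) := by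
        gcongr
        · refine b1.trans ?_
          gcongr
        · refine b2.trans ?_
          gcongr
        · refine b3.trans ?_
          gcongr
    _ = 8 * (Cv * mB * ρ + κ₀ * (ρ + w₀) * (Cv * (mB * mB)) +
          (D + κ₀ * (ρ + w₀) * (4 * (M : ℝ≥0∞) ^ 2) + (K : ℝ≥0∞) ^ 2 * τ * ρ)) := by
        rw [← hsum]
        ring
    -- Enlarging `ρ` to `ρ + w₀` gives all terms but the source difference a common factor.
    _ ≤ 8 * (Cv * mB * (ρ + w₀) + κ₀ * (ρ + w₀) * (Cv * (mB * mB)) +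
          (D + κ₀ * (ρ + w₀) * (4 * (M : ℝ≥0∞) ^ 2) + (K : ℝ≥0∞) ^ 2 * τ * (ρ + w₀))) := by
        gcongr <;> exact le_self_add
    _ = _ := by ring

/-- The rate of the exponential weight. -/
noncomputable def weightRate (T : ℝ) (M K : ℝ≥0) : ℝ := 8 * (diffConst T M K).toReal + 1

theorem one_le_weightRate (T : ℝ) (M K : ℝ≥0) : 1 ≤ weightRate T M K := by
  have := ENNReal.toReal_nonneg (a := diffConst T M K)
  unfold weightRate
  linarith

/-- With `C` for `diffConst`, this is `4 C / (8 C + 1) ≤ 1 / 2`; the summand 1 in the rate keeps it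
at least one. -/
theorem diffConst_mul_le (T : ℝ) (M K : ℝ≥0) :
    diffConst T M K * (4 * ENNReal.ofReal (1 / weightRate T M K)) ≤ 2⁻¹ := by
  have h1 := one_le_weightRate T M K
  rw [← ENNReal.ofReal_toReal (diffConst_ne_top T M K), show (4 : ℝ≥0∞) = ENNReal.ofReal 4 by simp,
    ← ENNReal.ofReal_mul (by norm_num), ← ENNReal.ofReal_mul ENNReal.toReal_nonneg,
    show (2 : ℝ≥0∞)⁻¹ = ENNReal.ofReal 2⁻¹ by rw [ENNReal.ofReal_inv_of_pos (by norm_num)]; simp]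
  apply ENNReal.ofReal_le_ofReal
  rw [mul_one_div, mul_div_assoc', div_le_iff₀ (by linarith)]
  unfold weightRate
  linarith

/-- The norm of the difference reappears on the right through `majorantSum`, with a coefficient at
most 1/2 at this rate, and is absorbed. -/
theorem diffNorm_weightRate_le (h : IsControlledPair T M K f F φ φx φt f' F' φ' φx' φt')
    (hT : 0 < T) : diffNorm T (weightRate T M K) F φ φx φt F' φ' φx' φt' ≤
      2 * (diffConst T M K * (2 * nullEnergy 1 (φx - φx') (φt - φt') 0 +
        ∫⁻ x, ‖(φ - φ') 0 x‖ₑ ^ 2 ∂circ) +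
      8 * ∫⁻ p, ‖(f - f') p.1 p.2‖ₑ ^ 2 ∂cyl (-T) T) := by
  have h1 := one_le_weightRate T M K
  refine le_two_mul_of_le_add_half (diffNorm_ne_top h hT (by linarith)) ?_
  refine (diffNorm_le h hT h1).trans ?_
  have h2 := diffConst_mul_le T M K
  rw [majorantSum]
  set Y := diffNorm T (weightRate T M K) F φ φx φt F' φ' φx' φt'
  set r := ENNReal.ofReal (1 / weightRate T M K)
  calc _ = diffConst T M K * (2 * nullEnergy 1 (φx - φx') (φt - φt') 0 +
        ∫⁻ x, ‖(φ - φ') 0 x‖ₑ ^ 2 ∂circ) +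
      8 * (∫⁻ p, ‖(f - f') p.1 p.2‖ₑ ^ 2 ∂cyl (-T) T) + diffConst T M K * (4 * r) * Y := by ring
    _ ≤ _ := by gcongr

/-- The size of the initial difference and of the difference of the sources. -/
noncomputable def dataSize (T : ℝ) (f φ φx φt f' φ' φx' φt' : ℝ → ℝ → Amb k) : ℝ≥0∞ :=
  (∫⁻ x, ‖(φ - φ') 0 x‖ₑ ^ 2 ∂circ) + (∫⁻ x, ‖(φx - φx') 0 x‖ₑ ^ 2 ∂circ) +
    (∫⁻ x, ‖(φt - φt') 0 x‖ₑ ^ 2 ∂circ) + ∫⁻ p, ‖(f - f') p.1 p.2‖ₑ ^ 2 ∂cyl (-T) T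

theorem nullEnergy_sub_eq (h : IsEnergyPath a b φ φx φt) (h' : IsEnergyPath a b φ' φx' φt')
    {c : ℝ} (hc : c * c = 1) {t : ℝ} (ht : t ∈ Icc a b) :
    nullEnergy c (φx - φx') (φt - φt') t = 2 * ((∫⁻ x, ‖(φt - φt') t x‖ₑ ^ 2 ∂circ) +
      ∫⁻ x, ‖(φx - φx') t x‖ₑ ^ 2 ∂circ) := by
  rw [nullEnergy, ← lintegral_add_left' ((nullDer_sub_memLp h h' c ht).1.enorm.pow_const 2),
    ← lintegral_add_left' (((h.cont_t.sub h'.cont_t).memLp t ht).1.enorm.pow_const 2),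
    ← lintegral_const_mul' _ _ (by norm_num)]
  simp only [enorm_nullDer_sq_add hc]

/-- The stability constant of the weighted majorants. -/
noncomputable def stabilityConst (T : ℝ) (M K : ℝ≥0) : ℝ≥0∞ :=
  4 + 4 * (2 * (diffConst T M K * 4 + 8))

theorem majorantSum_le (h : IsControlledPair T M K f F φ φx φt f' F' φ' φx' φt') (hT : 0 < T) :
    majorantSum T (weightRate T M K) F φ φx φt F' φ' φx' φt' ≤
      stabilityConst T M K * dataSize T f φ φx φt f' φ' φx' φt' := by
  have h0 : (0 : ℝ) ∈ Icc (-T) T := ⟨by linarith, hT.le⟩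
  have h1 := one_le_weightRate T M K
  have hY := diffNorm_weightRate_le h hT
  have hr : ENNReal.ofReal (1 / weightRate T M K) ≤ 1 := by
    rw [ENNReal.ofReal_le_one, div_le_one (by linarith)]
    exact h1
  have he : 2 * nullEnergy 1 (φx - φx') (φt - φt') 0 + ∫⁻ x, ‖(φ - φ') 0 x‖ₑ ^ 2 ∂circ ≤
      4 * dataSize T f φ φx φt f' φ' φx' φt' := by
    rw [nullEnergy_sub_eq h.left.sol.path h.right.sol.path (by norm_num) h0, dataSize]
    generalize ∫⁻ x, ‖(φ - φ') 0 x‖ₑ ^ 2 ∂circ = x₁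
    generalize ∫⁻ x, ‖(φx - φx') 0 x‖ₑ ^ 2 ∂circ = x₂
    generalize ∫⁻ x, ‖(φt - φt') 0 x‖ₑ ^ 2 ∂circ = x₃
    generalize ∫⁻ p, ‖(f - f') p.1 p.2‖ₑ ^ 2 ∂cyl (-T) T = x₄
    calc _ ≤ 2 * (2 * (x₃ + x₂)) + x₁ + (3 * x₁ + 4 * x₄) := le_self_add
      _ = _ := by ring
  have hD : ∫⁻ p, ‖(f - f') p.1 p.2‖ₑ ^ 2 ∂cyl (-T) T ≤ dataSize T f φ φx φt f' φ' φx' φt' :=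
    le_add_self
  rw [majorantSum, stabilityConst]
  calc _ ≤ 4 * dataSize T f φ φx φt f' φ' φx' φt' + 4 * (1 * (2 * (diffConst T M K *
        (4 * dataSize T f φ φx φt f' φ' φx' φt') + 8 * dataSize T f φ φx φt f' φ' φx' φt'))) := by
        refine add_le_add (le_self_add.trans he) (mul_le_mul' le_rfl (mul_le_mul' hr ?_))
        refine hY.trans ?_
        gcongr
    _ = _ := by ring

theorem stabilityConst_ne_top (T : ℝ) (M K : ℝ≥0) : stabilityConst T M K ≠ ⊤ := by
  have := diffConst_ne_top T M K
  unfold stabilityConst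
  finiteness

/-- Stability of solutions: the null derivatives of the difference are bounded by square integrable
functions of one null coordinate. -/
theorem exists_stability (T : ℝ) (hT : 0 < T) (M K : ℝ≥0) : ∃ C : ℝ≥0∞, C ≠ ⊤ ∧
    ∀ {k : ℕ} {f F φ φx φt f' F' φ' φx' φt' : ℝ → ℝ → Amb k},
      IsControlledPair T M K f F φ φx φt f' F' φ' φx' φt' →
      (∀ c : ℝ, c * c = 1 → ∃ R : ℝ → ℝ≥0∞, AEMeasurable R ∧ Function.Periodic R period ∧
        ∫⁻ x, R x ∂circ ≤ C * dataSize T f φ φx φt f' φ' φx' φt' ∧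
        ∀ t ∈ Icc (-T) T, ∀ᵐ x, ‖nullDer c (φx - φx') (φt - φt') t x‖ₑ ^ 2 ≤ R (x + c * t)) ∧
      ∀ t ∈ Icc (-T) T, ∫⁻ x, ‖(φ - φ') t x‖ₑ ^ 2 ∂circ ≤
        C * dataSize T f φ φx φt f' φ' φx' φt' := by
  set κ := weightRate T M K with hκdef
  have hκ : 1 ≤ κ := one_le_weightRate T M K
  have hκ0 : 0 < κ := by linarith
  -- The price of removing the weight on `[-T, T]`.
  set E := ENNReal.ofReal (Real.exp (κ * T)) with hE
  have hE' : E ≠ ⊤ := ENNReal.ofReal_ne_top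
  set S := stabilityConst T M K
  have hS : S ≠ ⊤ := stabilityConst_ne_top T M K
  -- One constant for both conclusions: `S` serves the null majorants, the other summands the `L²`
  -- norm of `w`.
  refine ⟨E * (S + (2 + 2 * (ENNReal.ofReal (2 * T) * S))), by finiteness,
    fun {k f F φ φx φt f' F' φ' φx' φt'} h => ⟨fun c hc => ?_, fun t ht => ?_⟩⟩
  · obtain ⟨h1, h2, h3⟩ := diffMajorant_spec h.left h.right hT hκ0 hc
    refine ⟨fun x => E * diffMajorant T κ c F φ φx φt F' φ' φx' φt' x, h1.const_mul E,
      fun x => by simp only [h2 x], ?_, fun t ht => ?_⟩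
    · rw [lintegral_const_mul' _ _ hE', mul_assoc E, add_mul]
      refine mul_le_mul' le_rfl (le_trans ?_ le_self_add)
      refine le_trans ?_ (majorantSum_le h hT)
      rw [← lintegral_diffMajorant_add h.left h.right hT]
      rcases mul_self_eq_one_iff.1 hc with rfl | rfl
      exacts [le_self_add, le_add_self]
    · filter_upwards [h3 t ht] with x hx
      calc _ = 1 * ‖nullDer c (φx - φx') (φt - φt') t x‖ₑ ^ 2 := (one_mul _).symm
        _ ≤ E * weight κ t * ‖nullDer c (φx - φx') (φt - φt') t x‖ₑ ^ 2 := by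
          gcongr
          exact one_le_weight_mul hκ0.le ht
        _ ≤ _ := by
          rw [mul_assoc]
          gcongr
  · calc _ = 1 * ∫⁻ x, ‖(φ - φ') t x‖ₑ ^ 2 ∂circ := (one_mul _).symm
      _ ≤ E * weight κ t * ∫⁻ x, ‖(φ - φ') t x‖ₑ ^ 2 ∂circ := by
          gcongr
          exact one_le_weight_mul hκ0.le ht
      _ ≤ E * (2 * dataSize T f φ φx φt f' φ' φx' φt' + 2 * (ENNReal.ofReal (2 * T) *
            (S * dataSize T f φ φx φt f' φ' φx' φt'))) := by
          rw [mul_assoc]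
          refine mul_le_mul' le_rfl ((weight_mul_pos_le h.left h.right hT hκ ht).trans ?_)
          refine add_le_add (mul_le_mul' le_rfl ?_) (mul_le_mul' le_rfl (mul_le_mul' le_rfl ?_))
          · exact le_self_add.trans (le_self_add.trans le_self_add)
          · exact majorantSum_le h hT
      _ ≤ E * (S * dataSize T f φ φx φt f' φ' φx' φt' +
            (2 * dataSize T f φ φx φt f' φ' φx' φt' + 2 * (ENNReal.ofReal (2 * T) *
            (S * dataSize T f φ φx φt f' φ' φx' φt')))) :=
          mul_le_mul' le_rfl le_add_self
      _ = _ := by ring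

end WaveMapS1

/-! ### From null majorants to the mixed norms -/

namespace WaveMapS1

variable {k : ℕ} {T : ℝ}

theorem rpow_half_sq (x : ℝ≥0∞) : (x ^ (1 / 2 : ℝ)) ^ 2 = x := by
  rw [← ENNReal.rpow_natCast, ← ENNReal.rpow_mul]
  norm_num

theorem sq_rpow_half (x : ℝ≥0∞) : (x ^ 2) ^ (1 / 2 : ℝ) = x := by
  rw [← ENNReal.rpow_natCast, ← ENNReal.rpow_mul]
  norm_num

theorem le_rpow_half {x y : ℝ≥0∞} (h : x ^ 2 ≤ y) : x ≤ y ^ (1 / 2 : ℝ) := by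
  rw [← sq_rpow_half x]
  exact ENNReal.rpow_le_rpow h (by norm_num)

/-- A majorant independent of `β` bounds the supremum over `β` before integrating in `α`, and the
integral in `α` for almost every `β`, by the same quantity. -/
theorem add_mixedNorms_le {N : ℝ → ℝ → Amb k} {S : ℝ → ℝ≥0∞}
    (h : ∀ᵐ p : ℝ × ℝ, ‖N p.1 p.2‖ₑ ^ 2 ≤ S p.1) :
    normL2Linf N + normLinfL2 N ≤ 2 * (∫⁻ x, S x) ^ (1 / 2 : ℝ) := by
  rw [Measure.volume_eq_prod] at h
  rw [two_mul]
  refine add_le_add ?_ ?_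
  · rw [normL2Linf]
    refine ENNReal.rpow_le_rpow (lintegral_mono_ae ?_) (by norm_num)
    filter_upwards [Measure.ae_ae_of_ae_prod h] with α hα
    rw [← rpow_half_sq (S α)]
    refine pow_le_pow_left' ?_ 2
    rw [eLpNorm_exponent_top]
    refine essSup_le_of_ae_le _ ?_
    filter_upwards [hα] with β hβ
    exact le_rpow_half hβ
  · rw [normLinfL2]
    refine essSup_le_of_ae_le _ ?_
    have h' := (Measure.measurePreserving_swap (μ := (volume : Measure ℝ))
      (ν := (volume : Measure ℝ))).quasiMeasurePreserving.ae h
    filter_upwards [Measure.ae_ae_of_ae_prod h'] with β hβ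
    apply le_rpow_half
    rw [eLpNorm_two_sq]
    exact lintegral_mono_ae hβ

/-- The passage from null coordinates to time and space. -/
noncomputable def ofNullCoord : (ℝ × ℝ) ≃ₗ[ℝ] (ℝ × ℝ) where
  toFun p := ((p.1 + p.2) / 2, (p.1 - p.2) / 2)
  invFun q := (q.2 + q.1, q.1 - q.2)
  map_add' p q := by ext <;> simp <;> ring
  map_smul' c p := by ext <;> simp <;> ring
  left_inv p := by ext <;> simp <;> ring
  right_inv p := by ext <;> simp <;> ring

/-- An invertible linear map pulls null sets back to null sets; the Jacobian is irrelevant for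
pointwise bounds. -/
theorem quasiMeasurePreserving_ofNullCoord :
    Measure.QuasiMeasurePreserving (fun p : ℝ × ℝ => ((p.1 + p.2) / 2, (p.1 - p.2) / 2)) :=
  Measure.LinearMap.quasiMeasurePreserving _ (ofNullCoord : (ℝ × ℝ) →ₗ[ℝ] (ℝ × ℝ))
    (LinearEquiv.isUnit_det' ofNullCoord).ne_zero

/-- On the support of the extension, `x + c t` stays in a bounded window, so the periodic `R` may be
cut off and becomes integrable over `ℝ` whenever it is over the circle. -/
theorem ae_nullExt_le {h : ℝ → ℝ → Amb k} {R : ℝ → ℝ≥0∞} {c : ℝ} (hc : c * c = 1)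
    (hR : ∀ᵐ q ∂cyl (-T) T, ‖h q.1 q.2‖ₑ ^ 2 ≤ R (q.2 + c * q.1)) :
    ∀ᵐ p : ℝ × ℝ, ‖nullExt T h p.1 p.2‖ₑ ^ 2 ≤ (Ioc (-(2 * T)) (period + 2 * T)).indicator R
      ((p.1 - p.2) / 2 + c * ((p.1 + p.2) / 2)) := by
  rw [cyl, circ, Measure.prod_restrict, ← Measure.volume_eq_prod,
    ae_restrict_iff' (measurableSet_Icc.prod measurableSet_Ioc)] at hR
  filter_upwards [quasiMeasurePreserving_ofNullCoord.ae hR] with p hp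
  rw [nullExt]
  split_ifs with hmem
  · refine (hp hmem).trans (le_of_eq ?_)
    rw [indicator_of_mem]
    obtain ⟨⟨h1, h2⟩, h3, h4⟩ := hmem
    rcases mul_self_eq_one_iff.1 hc with rfl | rfl <;> constructor <;> linarith
  · simp

theorem lintegral_indicator_le {R : ℝ → ℝ≥0∞} (hp : Function.Periodic R period) :
    ∫⁻ x, (Ioc (-(2 * T)) (period + 2 * T)).indicator R x ≤
      covering (period + 4 * T) * ∫⁻ x, R x ∂circ := by
  rw [lintegral_indicator measurableSet_Ioc]
  exact lintegral_Ioc_le_covering hp (by linarith)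

theorem normU_le {h : ℝ → ℝ → Amb k} {R : ℝ → ℝ≥0∞} (hp : Function.Periodic R period)
    (hR : ∀ᵐ q ∂cyl (-T) T, ‖h q.1 q.2‖ₑ ^ 2 ≤ R (q.2 + 1 * q.1)) :
    normU T h ≤ 2 * (covering (period + 4 * T) * ∫⁻ x, R x ∂circ) ^ (1 / 2 : ℝ) := by
  have h1 := ae_nullExt_le (by norm_num) hR
  refine (add_mixedNorms_le (S := (Ioc (-(2 * T)) (period + 2 * T)).indicator R) ?_).trans ?_
  · filter_upwards [h1] with p h2
    rwa [show (p.1 - p.2) / 2 + 1 * ((p.1 + p.2) / 2) = p.1 by ring] at h2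
  · gcongr
    exact lintegral_indicator_le hp

theorem normV_le {h : ℝ → ℝ → Amb k} {R : ℝ → ℝ≥0∞} (hp : Function.Periodic R period)
    (hR : ∀ᵐ q ∂cyl (-T) T, ‖h q.1 q.2‖ₑ ^ 2 ≤ R (q.2 + (-1) * q.1)) :
    normV T h ≤ 2 * (covering (period + 4 * T) * ∫⁻ x, R x ∂circ) ^ (1 / 2 : ℝ) := by
  have h1 := ae_nullExt_le (by norm_num) hR
  have h2 := (Measure.measurePreserving_swap (μ := (volume : Measure ℝ))
    (ν := (volume : Measure ℝ))).quasiMeasurePreserving.ae h1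
  -- For `c = -1` the majorant is a function of `x - t = -v`, whence the reflection.
  refine (add_mixedNorms_le
    (S := fun v => (Ioc (-(2 * T)) (period + 2 * T)).indicator R (-v)) ?_).trans ?_
  · filter_upwards [h2] with p h3
    simp only [Prod.fst_swap, Prod.snd_swap] at h3
    rwa [show (p.2 - p.1) / 2 + (-1) * ((p.2 + p.1) / 2) = -p.1 by ring] at h3
  · gcongr
    rw [lintegral_neg_eq_self]
    exact lintegral_indicator_le hp

theorem enorm_half_smul_sq_le (v : Amb k) : ‖(1 / 2 : ℝ) • v‖ₑ ^ 2 ≤ ‖v‖ₑ ^ 2 := by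
  refine pow_le_pow_left' ?_ 2
  rw [enorm_smul]
  refine mul_le_of_le_one_left (by simp) ?_
  rw [Real.enorm_eq_ofReal (by norm_num), ENNReal.ofReal_le_one]
  norm_num

variable {φ φx φt φ' φx' φt' : ℝ → ℝ → Amb k}

theorem ae_half_nullDer_le (P : IsEnergyPath (-T) T φ φx φt) (P' : IsEnergyPath (-T) T φ' φx' φt')
    {c : ℝ} {A : ℝ → ℝ≥0∞} (hAm : AEMeasurable A) (hAp : Function.Periodic A period)
    (hA : ∀ t ∈ Icc (-T) T, ∀ᵐ x, ‖nullDer c (φx - φx') (φt - φt') t x‖ₑ ^ 2 ≤ A (x + c * t)) :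
    ∀ᵐ q ∂cyl (-T) T, ‖(1 / 2 : ℝ) • nullDer c (φx - φx') (φt - φt') q.1 q.2‖ₑ ^ 2 ≤
      A (q.2 + c * q.1) := by
  filter_upwards [(nullDer_sub_slab P P' c).enorm_sq.ae_le_of_forall (Slab.travel hAm hAp c)
    fun t ht => ae_circ_of_ae (hA t ht)] with q hq
  exact (enorm_half_smul_sq_le _).trans hq

/-- The same two majorants give all three parts: restricted to a time slice they bound the energy of
`w`, and in the null plane they bound the mixed norms of `w_u` and `w_v`. -/
theorem normW_le (P : IsEnergyPath (-T) T φ φx φt) (P' : IsEnergyPath (-T) T φ' φx' φt')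
    {Q : ℝ≥0∞} (H : ∀ c : ℝ, c * c = 1 → ∃ R : ℝ → ℝ≥0∞, AEMeasurable R ∧
      Function.Periodic R period ∧ ∫⁻ x, R x ∂circ ≤ Q ∧
      ∀ t ∈ Icc (-T) T, ∀ᵐ x, ‖nullDer c (φx - φx') (φt - φt') t x‖ₑ ^ 2 ≤ R (x + c * t))
    (H' : ∀ t ∈ Icc (-T) T, ∫⁻ x, ‖(φ - φ') t x‖ₑ ^ 2 ∂circ ≤ Q) :
    normW T (φ - φ') (φx - φx') (φt - φt') ≤ (2 * Q) ^ (1 / 2 : ℝ) +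
      2 * (covering (period + 4 * T) * Q) ^ (1 / 2 : ℝ) +
      2 * (covering (period + 4 * T) * Q) ^ (1 / 2 : ℝ) := by
  obtain ⟨R, hRm, hRp, hRi, hR⟩ := H 1 (by norm_num)
  obtain ⟨S, hSm, hSp, hSi, hS⟩ := H (-1) (by norm_num)
  have hU := normU_le (h := fun t x => (1 / 2 : ℝ) • nullDer 1 (φx - φx') (φt - φt') t x) hRp
    (ae_half_nullDer_le P P' hRm hRp hR)
  have hV := normV_le (h := fun t x => (1 / 2 : ℝ) • nullDer (-1) (φx - φx') (φt - φt') t x) hSp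
    (ae_half_nullDer_le P P' hSm hSp hS)
  simp only [nullDer, one_smul, neg_smul, ← sub_eq_add_neg] at hU hV
  rw [normW]
  refine add_le_add (add_le_add (iSup₂_le fun t ht => ?_) (hU.trans ?_)) (hV.trans ?_)
  · rw [normH1L2, eLpNorm_two_sq, eLpNorm_two_sq, eLpNorm_two_sq]
    refine ENNReal.rpow_le_rpow ?_ (by norm_num)
    have hn : nullEnergy 1 (φx - φx') (φt - φt') t ≤ 2 * Q := by
      rw [two_mul]
      refine add_le_add ?_ ?_
      · rw [← lintegral_circ_add hRp (1 * t)] at hRi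
        exact (lintegral_mono_ae (ae_circ_of_ae (hR t ht))).trans hRi
      · rw [← lintegral_circ_add hSp ((-1) * t)] at hSi
        exact (lintegral_mono_ae (ae_circ_of_ae (hS t ht))).trans hSi
    rw [nullEnergy_sub_eq P P' (by norm_num) ht] at hn
    have hn' := (ENNReal.mul_le_mul_iff_right (by norm_num) (by norm_num)).1 hn
    rw [add_assoc, add_comm (∫⁻ x, ‖(φx - φx') t x‖ₑ ^ 2 ∂circ), two_mul]
    exact add_le_add (H' t ht) hn'
  · gcongr
  · gcongr

/-- Stability of solutions in the norm `normW`. -/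
theorem exists_normW_le (T : ℝ) (hT : 0 < T) (M K : ℝ≥0) : ∃ C : ℝ, 0 < C ∧
    ∀ {k : ℕ} {f F φ φx φt f' F' φ' φx' φt' : ℝ → ℝ → Amb k},
      IsControlledPair T M K f F φ φx φt f' F' φ' φx' φt' →
      normW T (φ - φ') (φx - φx') (φt - φt') ≤
        ENNReal.ofReal C * dataSize T f φ φx φt f' φ' φx' φt' ^ (1 / 2 : ℝ) := by
  obtain ⟨C, hC, H⟩ := exists_stability T hT M K
  obtain ⟨Cv, hCv⟩ : ∃ Cv : ℝ≥0∞, Cv = (covering (period + 4 * T) : ℝ≥0∞) := ⟨_, rfl⟩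
  have hCv' : Cv ≠ ⊤ := hCv ▸ ENNReal.natCast_ne_top _
  obtain ⟨E, hE⟩ : ∃ E, E = (2 * C) ^ (1 / 2 : ℝ) + 2 * (Cv * C) ^ (1 / 2 : ℝ) +
    2 * (Cv * C) ^ (1 / 2 : ℝ) := ⟨_, rfl⟩
  have hE' : E ≠ ⊤ := by
    have h1 : (2 * C) ^ (1 / 2 : ℝ) ≠ ⊤ :=
      ENNReal.rpow_ne_top_of_nonneg (by norm_num) (by finiteness)
    have h2 : (Cv * C) ^ (1 / 2 : ℝ) ≠ ⊤ :=
      ENNReal.rpow_ne_top_of_nonneg (by norm_num) (by finiteness)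
    rw [hE]
    finiteness
  -- The summand 1 only ensures a positive constant.
  refine ⟨E.toReal + 1, by positivity, fun {k f F φ φx φt f' F' φ' φx' φt'} h => ?_⟩
  have hEle : E ≤ ENNReal.ofReal (E.toReal + 1) := by
    rw [ENNReal.le_ofReal_iff_toReal_le hE' (by positivity)]
    linarith
  refine le_trans ?_ (mul_le_mul' hEle le_rfl)
  obtain ⟨H1, H2⟩ := H h
  refine (normW_le h.left.sol.path h.right.sol.path H1 H2).trans (le_of_eq ?_)
  have hroot : ∀ A : ℝ≥0∞, (A * (C * dataSize T f φ φx φt f' φ' φx' φt')) ^ (1 / 2 : ℝ) =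
      (A * C) ^ (1 / 2 : ℝ) * dataSize T f φ φx φt f' φ' φx' φt' ^ (1 / 2 : ℝ) := fun A => by
    rw [← mul_assoc, ENNReal.mul_rpow_of_nonneg _ _ (by norm_num)]
  rw [← hCv, hE, hroot, hroot]
  ring

end WaveMapS1

/-! ### The projected source and the damping as controlled sources -/

namespace WaveMapS1

variable {k : ℕ} {T M : ℝ} {f F φ φx φt f' F' φ' φx' φt' : ℝ → ℝ → Amb k} {g g' : EnergyState k}

theorem enorm_perp_le (f : Amb k) {y : Amb k} (hy : ‖y‖ = 1) : ‖perp f y‖ₑ ≤ ‖f‖ₑ := by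
  rw [← ofReal_norm, ← ofReal_norm]
  apply ENNReal.ofReal_le_ofReal
  rw [← sq_le_sq₀ (norm_nonneg _) (norm_nonneg _), perp, norm_sub_sq_real, inner_smul_right,
    norm_smul, hy, mul_one, Real.norm_eq_abs, sq_abs]
  nlinarith [sq_nonneg ⟪f, y⟫]

/-- The projection is contracting and linear in the source. Changing the base point alters `⟪f', y⟫
• y` in two places, each by at most `‖f'‖ ‖y - y'‖`. -/
theorem enorm_perp_sub_perp_le (f f' : Amb k) {y y' : Amb k} (hy : ‖y‖ = 1) (hy' : ‖y'‖ = 1) :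
    ‖perp f y - perp f' y'‖ₑ ≤ ‖f - f'‖ₑ + 2 * ‖f'‖ₑ * ‖y - y'‖ₑ := by
  have h1 : ‖y‖ₑ = 1 := by rw [← ofReal_norm, hy, ENNReal.ofReal_one]
  have h2 : ‖y'‖ₑ = 1 := by rw [← ofReal_norm, hy', ENNReal.ofReal_one]
  have e : perp f y - perp f' y' = perp (f - f') y - (⟪f', y - y'⟫ • y' + ⟪f', y⟫ • (y - y')) := by
    simp only [perp, inner_sub_left, inner_sub_right, sub_smul, smul_sub]
    abel
  rw [e]
  refine enorm_sub_le.trans (add_le_add (enorm_perp_le _ hy) ((enorm_add_le _ _).trans ?_))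
  rw [enorm_smul, enorm_smul, h2, mul_one, mul_assoc, two_mul]
  refine add_le_add (enorm_real_inner_le _ _) (mul_le_mul' ?_ le_rfl)
  simpa only [h1, mul_one] using enorm_real_inner_le f' y

/-- `HasInitialState` prescribes only `φ` and `φ_t`; the spatial derivatives agree by uniqueness of
weak derivatives. -/
theorem IsEnergyPath.initial_spaceDer (h : IsEnergyPath (-T) T φ φx φt) (hT : 0 < T)
    (hi : HasInitialState φ φt g) : φx 0 =ᵐ[circ] g.posx :=
  have h0 : (0 : ℝ) ∈ Icc (-T) T := ⟨by linarith, hT.le⟩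
  (h.weakDeriv_x 0 h0).ae_unique g.weakDeriv hi.1 (memLp_integrable_circ (h.cont_x.memLp 0 h0))
    (memLp_integrable_circ g.posx_memLp)

theorem IsEnergyPath.initial_le (h : IsEnergyPath (-T) T φ φx φt) (hT : 0 < T)
    (hi : HasInitialState φ φt g) (hM : normDotH1L2 g.posx g.vel ≤ ENNReal.ofReal M) :
    (∫⁻ x, ‖φt 0 x‖ₑ ^ 2 ∂circ) + ∫⁻ x, ‖φx 0 x‖ₑ ^ 2 ∂circ ≤ (M.toNNReal : ℝ≥0∞) ^ 2 := by
  refine le_trans (le_of_eq ?_) (pow_le_pow_left' hM 2)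
  rw [normDotH1L2, rpow_half_sq, ← eLpNorm_two_sq, ← eLpNorm_two_sq, add_comm,
    eLpNorm_congr_ae hi.2, eLpNorm_congr_ae (h.initial_spaceDer hT hi)]

theorem dataSize_eq (h : IsEnergyPath (-T) T φ φx φt) (h' : IsEnergyPath (-T) T φ' φx' φt')
    (hT : 0 < T) (hi : HasInitialState φ φt g) (hi' : HasInitialState φ' φt' g') :
    dataSize T f φ φx φt f' φ' φx' φt' =
      normH1L2 (g.pos - g'.pos) (g.posx - g'.posx) (g.vel - g'.vel) ^ 2 + normL2 T (f - f') ^ 2 := by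
  rw [normH1L2, rpow_half_sq, normL2, dataSize]
  simp only [eLpNorm_two_sq]
  have e : ∀ {u v u' v' : ℝ → Amb k}, u =ᵐ[circ] v → u' =ᵐ[circ] v' →
      ∫⁻ x, ‖(u - u') x‖ₑ ^ 2 ∂circ = ∫⁻ x, ‖(v - v') x‖ₑ ^ 2 ∂circ := by
    intro u v u' v' h1 h2
    apply lintegral_congr_ae
    filter_upwards [h1, h2] with x hx hx'
    simp only [Pi.sub_apply, hx, hx']
  rw [← e hi.1 hi'.1, ← e hi.2 hi'.2,
    ← e (h.initial_spaceDer hT hi) (h'.initial_spaceDer hT hi')]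
  rfl

theorem rpow_half_add_sq_le (x y : ℝ≥0∞) : (x ^ 2 + y ^ 2) ^ (1 / 2 : ℝ) ≤ x + y := by
  rw [← sq_rpow_half (x + y)]
  refine ENNReal.rpow_le_rpow ?_ (by norm_num)
  calc x ^ 2 + y ^ 2 ≤ x ^ 2 + y ^ 2 + 2 * x * y := le_self_add
    _ = _ := by ring

/-- The case `K = 0`: the projected source is pointwise no larger than `f`. -/
theorem SolvesInhomogeneous.isControlled (h : SolvesInhomogeneous T f g φ φx φt) (hT : 0 < T)
    (hf : IsSource T f) (hg : normDotH1L2 g.posx g.vel ≤ ENNReal.ofReal M)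
    (hfM : normL2 T f ≤ ENNReal.ofReal M) :
    IsControlled T M.toNNReal 0 f (fun t x => perp (f t x) (φ t x)) φ φx φt where
  sol := h.1
  slab := (show Slab (-T) T f from ⟨hf.2.1, hf.1⟩).comp₂ h.1.path.cont.slab (f := perp)
    (by simp only [Function.uncurry_def, perp]; fun_prop)
  slab' := ⟨hf.2.1, hf.1⟩
  bound := by
    filter_upwards [h.1.path.norm_eq_one] with p hp
    rw [two_mul]
    exact (pow_le_pow_left' (enorm_perp_le _ hp) 2).trans (le_self_add.trans le_self_add)
  source := by
    have := pow_le_pow_left' hfM 2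
    rw [normL2, eLpNorm_two_sq] at this
    exact this
  init := h.1.path.initial_le hT h.2 hg

theorem SolvesInhomogeneous.isControlledPair (h : SolvesInhomogeneous T f g φ φx φt)
    (h' : SolvesInhomogeneous T f' g' φ' φx' φt') (hT : 0 < T) (hf : IsSource T f)
    (hf' : IsSource T f') (hM : normDotH1L2 g.posx g.vel + normDotH1L2 g'.posx g'.vel +
      normL2 T f + normL2 T f' ≤ ENNReal.ofReal M) :
    IsControlledPair T M.toNNReal 0 f (fun t x => perp (f t x) (φ t x)) φ φx φt
      f' (fun t x => perp (f' t x) (φ' t x)) φ' φx' φt' where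
  left := h.isControlled hT hf
    ((le_self_add.trans (le_self_add.trans le_self_add)).trans hM)
    ((le_add_self.trans le_self_add).trans hM)
  right := h'.isControlled hT hf'
    ((le_add_self.trans (le_self_add.trans le_self_add)).trans hM) (le_add_self.trans hM)
  lip := by
    filter_upwards [h.1.path.norm_eq_one, h'.1.path.norm_eq_one] with p hp hp'
    exact (enorm_perp_sub_perp_le _ _ hp hp').trans le_self_add

variable {a : ℝ → ℝ} {K : ℝ≥0}

/-- The case `f = 0`: the whole source is the damping, with `K` a bound for `a`. -/
theorem SolvesDamped.isControlled (h : SolvesDamped T a g φ φx φt) (hT : 0 < T)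
    (ha : Continuous a) (hp : Function.Periodic a period) (hK : ∀ x, ‖a x‖ₑ ≤ K)
    (hg : normDotH1L2 g.posx g.vel ≤ ENNReal.ofReal M) :
    IsControlled T M.toNNReal K 0 (fun t x => a x • φt t x) φ φx φt where
  sol := h.1
  slab := (Slab.of_continuous (H := fun _ x => a x) (by simp only [Function.uncurry_def]; fun_prop)
    fun _ => hp).comp₂ h.1.path.cont_t.slab (f := fun s v => s • v)
    (by simp only [Function.uncurry_def]; fun_prop)
  slab' := Slab.of_continuous continuous_const fun _ _ => rfl
  bound := by
    filter_upwards with p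
    rw [enorm_smul, mul_pow, two_mul]
    exact (mul_le_mul' (pow_le_pow_left' (hK p.2) 2) le_rfl).trans
      (le_add_self.trans le_self_add)
  source := by simp
  init := h.1.path.initial_le hT h.2 hg

theorem SolvesDamped.isControlledPair (h : SolvesDamped T a g φ φx φt)
    (h' : SolvesDamped T a g' φ' φx' φt') (hT : 0 < T) (ha : Continuous a)
    (hp : Function.Periodic a period) (hK : ∀ x, ‖a x‖ₑ ≤ K)
    (hM : normDotH1L2 g.posx g.vel + normDotH1L2 g'.posx g'.vel ≤ ENNReal.ofReal M) :
    IsControlledPair T M.toNNReal K 0 (fun t x => a x • φt t x) φ φx φt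
      0 (fun t x => a x • φt' t x) φ' φx' φt' where
  left := h.isControlled hT ha hp hK (le_self_add.trans hM)
  right := h'.isControlled hT ha hp hK (le_add_self.trans hM)
  lip := by
    filter_upwards with p
    rw [← smul_sub, enorm_smul]
    exact (mul_le_mul' (hK p.2) le_rfl).trans le_add_self

end WaveMapS1
theorem mainTheorem11 :
    (∀ T M : ℝ, 0 < T → 0 < M → ∃ C : ℝ, 0 < C ∧
      ∀ (k : ℕ) (g g' : WaveMapS1.EnergyState k) (f f' : ℝ → ℝ → WaveMapS1.Amb k),
        WaveMapS1.IsSource T f → WaveMapS1.IsSource T f' →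
        WaveMapS1.normDotH1L2 g.posx g.vel + WaveMapS1.normDotH1L2 g'.posx g'.vel
            + WaveMapS1.normL2 T f + WaveMapS1.normL2 T f' ≤ ENNReal.ofReal M →
        ∀ φ φx φt φ' φx' φt' : ℝ → ℝ → WaveMapS1.Amb k,
          WaveMapS1.SolvesInhomogeneous T f g φ φx φt →
          WaveMapS1.SolvesInhomogeneous T f' g' φ' φx' φt' →
          WaveMapS1.normW T (φ - φ') (φx - φx') (φt - φt')
            ≤ ENNReal.ofReal C *
              (WaveMapS1.normH1L2 (g.pos - g'.pos) (g.posx - g'.posx) (g.vel - g'.vel)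
                + WaveMapS1.normL2 T (f - f'))) ∧
    (∀ a : ℝ → ℝ, Continuous a → Function.Periodic a WaveMapS1.period → (∀ x, 0 ≤ a x) →
      ∀ T M : ℝ, 0 < T → 0 < M → ∃ C : ℝ, 0 < C ∧
      ∀ (k : ℕ) (g g' : WaveMapS1.EnergyState k),
        WaveMapS1.normDotH1L2 g.posx g.vel + WaveMapS1.normDotH1L2 g'.posx g'.vel
            ≤ ENNReal.ofReal M →
        ∀ φ φx φt φ' φx' φt' : ℝ → ℝ → WaveMapS1.Amb k,
          WaveMapS1.SolvesDamped T a g φ φx φt →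
          WaveMapS1.SolvesDamped T a g' φ' φx' φt' →
          WaveMapS1.normW T (φ - φ') (φx - φx') (φt - φt')
            ≤ ENNReal.ofReal C *
              WaveMapS1.normH1L2 (g.pos - g'.pos) (g.posx - g'.posx) (g.vel - g'.vel)) := by
  open WaveMapS1 in
  refine ⟨fun T M hT hM => ?_, fun a ha hp _ T M hT hM => ?_⟩
  · obtain ⟨C, hC, H⟩ := exists_normW_le T hT M.toNNReal 0
    refine ⟨C, hC, fun k g g' f f' hf hf' hle φ φx φt φ' φx' φt' h h' =>
      (H (h.isControlledPair h' hT hf hf' hle)).trans (mul_le_mul' le_rfl ?_)⟩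
    rw [dataSize_eq h.1.path h'.1.path hT h.2 h'.2]
    exact rpow_half_add_sq_le _ _
  · obtain ⟨K, hK⟩ := exists_bound_of_periodic ha hp
    have hK' : ∀ x, ‖a x‖ₑ ≤ (K.toNNReal : ENNReal) := fun x => by
      rw [← ofReal_norm]
      exact ENNReal.ofReal_le_ofReal (hK x)
    obtain ⟨C, hC, H⟩ := exists_normW_le T hT M.toNNReal K.toNNReal
    refine ⟨C, hC, fun k g g' hle φ φx φt φ' φx' φt' h h' =>
      (H (h.isControlledPair h' hT ha hp hK' hle)).trans (mul_le_mul' le_rfl ?_)⟩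
    rw [dataSize_eq h.1.path h'.1.path hT h.2 h'.2]
    -- Both damped solutions have zero external source, so only the initial difference remains.
    have h0 : normL2 T ((0 : ℝ → ℝ → Amb k) - 0) = 0 := by
      rw [sub_zero]
      exact eLpNorm_zero
    exact (rpow_half_add_sq_le _ _).trans (by rw [h0, add_zero])
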